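/- **Theorem 7.1.** Let $N\ge 1$ be an integer, $d>0$, $p>1$, and $r_0:=\frac{N(p-1)}{d}$. Let $$G_d(x,t):=(2\pi)^{-N}\int_{\mathbb R^N}e^{ix\cdot\xi}e^{-t|\xi|^d}\,d\xi,\qquad x\in\mathbb R^N,\ t>0,$$ be the fundamental solution of $\partial_t u+(-\Delta)^{d/2}u=0$. For a locally integrable function $\phi:\mathbb R^N\to\mathbb R$ and $0<T\le\infty$, a solution in $\mathbb R^N\times[0,T)$ of $$\partial_t u+(-\Delta)^{\frac d2}u=|u|^p,\qquad u(\cdot,0)=\phi,\tag{SP}$$ is a function $u$ which is bounded and continuous on $\mathbb R^N\times(\tau,T)$ for every $\tau\in(0,T)$ and satisfies $$u(x,t)=\int_{\mathbb R^N}G_d(x-y,t)\phi(y)\,dy+\int_0^t\int_{\mathbb R^N}G_d(x-y,t-s)|u(y,s)|^p\,dy\,ds$$ for all $(x,t)\in\mathbb R^N\times(0,T)$, the integrals being absolutely convergent. Write $B(x,\sigma)$ for the open ball and $\frac{1}{|B|}\int_B$ for the mean value over a ball $B$. (a) Let $r_0<1$. There are $\gamma>0$ and $C>0$, depending only on $N,d,p$,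 and for every locally integrable $\phi$ there is a constant $C_\phi>0$, such that, whenever $T\in(0,\infty)$ and $$\sup_{x\in\mathbb R^N}\frac{1}{|B(x,T^{1/d})|}\int_{B(x,T^{1/d})}|\phi(y)|\,dy\le\gamma\,T^{-\frac{N}{dr_0}},$$ problem (SP) possesses a solution $u$ in $\mathbb R^N\times[0,T)$ such that, for $(x,t)\in\mathbb R^N\times(0,T)$, $$|u(x,t)|\le C\,T^{-\frac Nd\left(\frac1{r_0}-1\right)}\,t^{-\frac Nd}\qquad\text{and}\qquad |u(x,t)|\le C_\phi\,t^{-\frac Nd}.$$ Here $C$ is independent of $\phi$ and $T$, and $C_\phi$ is independent of $T$. (b) Let $r_0>1$. For every $q>1$ there are $\gamma>0$ and $C>0$, depending only on $N,d,p,q$, such that, whenever $\phi$ is locally integrable, $T\in(0,\infty]$ and $$\sup_{x\in\mathbb R^N}\ \sup_{0<\sigma<T^{1/d}}\sigma^{\frac N{r_0}}\left(\frac{1}{|B(x,\sigma)|}\int_{B(x,\sigma)}|\phi(y)|^q\,dy\right)^{\frac1q}\le\gamma,$$ problem (SP) possesses a solution $u$ in $\mathbb R^N\times[0,T)$ such that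 $|u(x,t)|\le C\,t^{-\frac{N}{dr_0}}$ for $(x,t)\in\mathbb R^N\times(0,T)$. (c) Let $r_0=1$ and $\beta>0$, and set, for $s\ge 0$ and $s>0$ respectively, $$\Phi(s):=s[\log(e+s)]^\beta,\qquad \rho(s):=s^{-N}\left[\log\left(e+s^{-1}\right)\right]^{-\frac Nd},$$ and let $\Phi^{-1}$ be the inverse of the bijection $\Phi:[0,\infty)\to[0,\infty)$. There are $\gamma>0$ and $C>0$, depending only on $N,d,p,\beta$, such that, whenever $\phi$ is locally integrable, $T\in(0,\infty)$, and, for all $0<\sigma<T^{1/d}$ and $x\in\mathbb R^N$, the function $\Phi(T^{N/d}|\phi|)$ is integrable on $B(x,\sigma)$ with $$\sup_{x\in\mathbb R^N}\Phi^{-1}\left(\frac{1}{|B(x,\sigma)|}\int_{B(x,\sigma)}\Phi\left(T^{\frac Nd}|\phi(y)|\right)dy\right)\le\gamma\,\rho\left(\sigma T^{-\frac1d}\right),\qquad 0<\sigma<T^{\frac1d},$$ problem (SP) possesses a solution $u$ in $\mathbb R^N\times[0,T)$ such that $$|u(x,t)|\le C\,t^{-\frac Nd}\left|\log\frac{t}{2T}\right|^{-\frac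 Nd},\qquad (x,t)\in\mathbb R^N\times(0,T).$$ -/

import Mathlib

open MeasureTheory Metric Set
open scoped ENNReal

noncomputable section

namespace FracHeat

/-- `ℝ^N` with the Euclidean norm. -/
abbrev Space (N : ℕ) : Type := EuclideanSpace ℝ (Fin N)

/-- The fundamental solution of `∂_t u + (-Δ)^{d/2} u = 0` on `ℝ^N × (0, ∞)`,
`G_d(x,t) = (2π)^{-N} ∫ e^{i x·ξ} e^{-t |ξ|^d} dξ`. The integral is real, since the Fourier symbol
is even; the real part only serves to obtain a real-valued function. -/
def kernel (N : ℕ) (d : ℝ) (x : Space N) (t : ℝ) : ℝ :=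
  ((2 * Real.pi) ^ N)⁻¹ *
    (∫ ξ : Space N, Complex.exp (Complex.I * ((inner ℝ x ξ : ℝ) : ℂ)) *
      ((Real.exp (-t * ‖ξ‖ ^ d) : ℝ) : ℂ)).re

/-- `u` is a solution in `ℝ^N × [0,T)`, where `0 < T ≤ ∞`, of
`∂_t u + (-Δ)^{d/2} u = |u|^p`, `u(·,0) = φ`: it is bounded and continuous on `ℝ^N × (τ,T)` for
every `τ ∈ (0,T)` and satisfies
`u(x,t) = ∫ G_d(x-y,t) φ(y) dy + ∫_0^t ∫ G_d(x-y,t-s) |u(y,s)|^p dy ds`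
on `ℝ^N × (0,T)`, with absolutely convergent integrals. -/
structure IsSolution (N : ℕ) (d p : ℝ) (φ : Space N → ℝ) (T : ℝ≥0∞)
    (u : Space N → ℝ → ℝ) : Prop where
  continuousOn : ∀ τ : ℝ, 0 < τ →
    ContinuousOn (fun z : Space N × ℝ => u z.1 z.2)
      {z : Space N × ℝ | τ < z.2 ∧ ENNReal.ofReal z.2 < T}
  bounded : ∀ τ : ℝ, 0 < τ →
    ∃ M : ℝ, ∀ (x : Space N) (t : ℝ), τ < t → ENNReal.ofReal t < T → |u x t| ≤ M
  integrable_initial : ∀ (x : Space N) (t : ℝ), 0 < t → ENNReal.ofReal t < T →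
    Integrable (fun y : Space N => kernel N d (x - y) t * φ y)
  integrable_duhamel : ∀ (x : Space N) (t : ℝ), 0 < t → ENNReal.ofReal t < T →
    IntegrableOn (fun z : ℝ × Space N => kernel N d (x - z.2) (t - z.1) * |u z.2 z.1| ^ p)
      (Ioo 0 t ×ˢ univ)
  integral_eq : ∀ (x : Space N) (t : ℝ), 0 < t → ENNReal.ofReal t < T →
    u x t = (∫ y : Space N, kernel N d (x - y) t * φ y) +
      ∫ s in Ioo 0 t, ∫ y : Space N, kernel N d (x - y) (t - s) * |u y s| ^ p

/-- `r_0 = N (p - 1) / d`. -/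
def r0 (N : ℕ) (d p : ℝ) : ℝ := N * (p - 1) / d

/-- `Φ(s) = s [log(e + s)]^β`. -/
def Phi (β s : ℝ) : ℝ := s * Real.log (Real.exp 1 + s) ^ β

theorem one_le_log_exp_add {s : ℝ} (hs : 0 ≤ s) : 1 ≤ Real.log (Real.exp 1 + s) := by
  rw [Real.le_log_iff_exp_le (by positivity)]; linarith
theorem Phi_bijOn {β : ℝ} (hβ : 0 < β) : BijOn (Phi β) (Ici 0) (Ici 0) := by
  have hmono : StrictMonoOn (Phi β) (Ici 0) := by
    intro a ha b hb hab
    simp only [mem_Ici] at ha hb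
    have h1 := one_le_log_exp_add ha
    have h2 : Real.log (Real.exp 1 + a) ^ β ≤ Real.log (Real.exp 1 + b) ^ β := by
      apply Real.rpow_le_rpow (by linarith) _ hβ.le
      exact Real.log_le_log (by positivity) (by linarith)
    have h3 : 0 < Real.log (Real.exp 1 + a) ^ β := Real.rpow_pos_of_pos (by linarith) _
    unfold Phi
    exact mul_lt_mul hab h2 h3 hb
  have hge : ∀ s, 0 ≤ s → s ≤ Phi β s := fun s hs => by
    have := Real.one_le_rpow (one_le_log_exp_add hs) hβ.le
    unfold Phi; nlinarith
  refine ⟨fun s hs => (mem_Ici.1 hs).trans (hge s hs), hmono.injOn, fun y hy => ?_⟩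
  have hc : ContinuousOn (Phi β) (Icc 0 y) := by
    unfold Phi
    refine continuousOn_id.mul (ContinuousOn.rpow_const (ContinuousOn.log (by fun_prop) ?_) ?_)
    · intro x hx; have := hx.1; positivity
    · intro x hx; right; exact hβ.le
  obtain ⟨x, hx, rfl⟩ := intermediate_value_Icc (mem_Ici.1 hy) hc
    (show y ∈ Icc (Phi β 0) (Phi β y) from ⟨by simpa [Phi] using hy, hge y hy⟩)
  exact ⟨x, hx.1, rfl⟩

/-- The inverse of the bijection `Φ : [0,∞) → [0,∞)`. -/
def PhiInv (β : ℝ) : ℝ → ℝ := Function.invFunOn (Phi β) (Ici 0)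

/-- `ρ(s) = s^{-N} [log(e + s^{-1})]^{-N/d}`. -/
def rho (N : ℕ) (d s : ℝ) : ℝ :=
  s ^ (-(N : ℝ)) * Real.log (Real.exp 1 + s⁻¹) ^ (-((N : ℝ) / d))

end FracHeat

end

open FracHeat

/-!
By scaling, and by iterated differences of the symbol `e^{-|ξ|^d}` whose derivatives are singular
only at the origin, `|G_d(x, t)| ≤ c K(x, t)` with `K(x, t) = a^ε (a + |x|)^{-(N+ε)}`,
`a = t^{1/d}`. The majorant `K` is an approximate semigroup: `K(t - s) ∗ K(s) ≤ C K(t)`. If a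
function `W` dominates the linear part of the equation, and dominates, up to a small factor, the
integral of `K(t - s) ∗ W(s)^p` in `s`, Picard iteration yields a solution bounded by a multiple
of `W`.

For a nondecreasing `h` with convex-like gauge `s ↦ s h(s)`, take for `W` a multiple of
`v = g (K(t) ∗ |φ| h(|φ|))`, where `g` is the inverse of the gauge. A Jensen-type inequality bounds
the linear part by `W`. As long as `v^{p-1} ≤ m(s) h(v)` at time `s`, one has
`v^p ≤ m(s) v h(v) = m(s) K(s) ∗ |φ| h(|φ|)`, and the approximate semigroup property turns the
Duhamel integral into the same potential at time `t`, with the factor `∫_0^t m`. The three cases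
are `h = 1`, `h(s) = s^{q-1}` and `h(s) = [log(e + s)]^β`.
-/

noncomputable section

namespace FracHeat

/-! ### Iterated differences and derivatives -/

theorem norm_fwdDiff_iter_le_of_hasDerivAt {G : Type*} [NormedAddCommGroup G] [NormedSpace ℝ G]
    {n : ℕ} {F : ℕ → ℝ → G} {a M : ℝ}
    (hF : ∀ i < n, ∀ s ∈ Icc a (a + n), HasDerivAt (F i) (F (i + 1) s) s)
    (hM : ∀ s ∈ Icc a (a + n), ‖F n s‖ ≤ M) :
    ‖(fwdDiff (1 : ℝ))^[n] (F 0) a‖ ≤ M := by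
  induction n generalizing F with
  | zero => simpa using hM a (by simp)
  | succ n ih =>
    rw [Function.iterate_succ_apply]
    push_cast at hF hM
    refine ih (F := fun i => fwdDiff (1 : ℝ) (F i)) (fun i hi s hs => ?_) fun s hs => ?_
    · have hright := hF i (by lia) (s + 1) ⟨by linarith [hs.1], by linarith [hs.2]⟩
      have hleft := hF i (by lia) s ⟨by linarith [hs.1], by linarith [hs.2]⟩
      exact (hright.comp_add_const s 1).sub hleft
    · have hmem : ∀ y ∈ Icc s (s + 1), y ∈ Icc a (a + (n + 1)) := fun y hy =>
        ⟨hs.1.trans hy.1, by linarith [hs.2, hy.2]⟩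
      simpa [fwdDiff] using (convex_Icc s (s + 1)).norm_image_sub_le_of_norm_hasDerivWithin_le
        (fun y hy => (hF n (by lia) y (hmem y hy)).hasDerivWithinAt)
        (fun y hy => hM y (hmem y hy)) (x := s) (y := s + 1) (by simp) (by simp)

theorem norm_fwdDiff_iter_le_of_contDiffAt {E G : Type*} [NormedAddCommGroup E] [NormedSpace ℝ E]
    [NormedAddCommGroup G] [NormedSpace ℝ G] {f : E → G} {n : ℕ} {ξ h : E} {M : ℝ}
    (hf : ∀ s ∈ Icc (0 : ℝ) n, ContDiffAt ℝ n f (ξ + s • h))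
    (hM : ∀ s ∈ Icc (0 : ℝ) n, ‖iteratedFDeriv ℝ n f (ξ + s • h)‖ ≤ M) :
    ‖(fwdDiff h)^[n] f ξ‖ ≤ M * ‖h‖ ^ n := by
  have hline : (fwdDiff h)^[n] f ξ = (fwdDiff (1 : ℝ))^[n] (fun s => f (ξ + s • h)) 0 := by
    simp [fwdDiff_iter_eq_sum_shift, ← Nat.cast_smul_eq_nsmul ℝ]
  rw [hline]
  refine norm_fwdDiff_iter_le_of_hasDerivAt
    (F := fun i s => iteratedFDeriv ℝ i f (ξ + s • h) fun _ => h) (fun i hi s hs => ?_)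
    fun s hs => ?_
  · rw [zero_add] at hs
    have hdiff := ((hf s hs).differentiableAt_iteratedFDeriv
      (m := i) (by exact_mod_cast hi)).hasFDerivAt
    have hpath : HasDerivAt (fun s : ℝ => ξ + s • h) h s := by
      simpa using ((hasDerivAt_id s).smul_const h).const_add ξ
    exact (hdiff.continuousMultilinear_apply_const fun _ => h).comp_hasDerivAt s hpath
  · rw [zero_add] at hs
    refine (ContinuousMultilinearMap.le_opNorm _ _).trans ?_
    simpa using mul_le_mul_of_nonneg_right (hM s hs) (pow_nonneg (norm_nonneg h) n)

theorem norm_fwdDiff_iter_le_of_norm_le {A G : Type*} [AddCommMonoid A] [SeminormedAddCommGroup G]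
    {f : A → G} {h : A} {M : ℝ} (n : ℕ) (ξ : A) (hM : ∀ k : ℕ, k ≤ n → ‖f (ξ + k • h)‖ ≤ M) :
    ‖(fwdDiff h)^[n] f ξ‖ ≤ 2 ^ n * M := by
  induction n generalizing ξ with
  | zero => simpa using hM 0 le_rfl
  | succ n ih =>
    have hleft := ih ξ fun k hk => hM k (by lia)
    have hright := ih (ξ + h) fun k hk => by
      simpa only [succ_nsmul', add_assoc] using hM (k + 1) (by lia)
    rw [Function.iterate_succ_apply', fwdDiff, pow_succ]
    linarith [norm_sub_le ((fwdDiff h)^[n] f (ξ + h)) ((fwdDiff h)^[n] f ξ)]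

theorem norm_iteratedFDeriv_comp_smul_le {E G : Type*} [NormedAddCommGroup E] [NormedSpace ℝ E]
    [NormedAddCommGroup G] [NormedSpace ℝ G] (f : E → G) {c : ℝ} (hc : c ≠ 0) (n : ℕ) (ξ : E) :
    ‖iteratedFDeriv ℝ n (fun η => f (c • η)) ξ‖ ≤ ‖iteratedFDeriv ℝ n f (c • ξ)‖ * |c| ^ n := by
  set g : E ≃L[ℝ] E := ContinuousLinearEquiv.smulLeft (Units.mk0 c hc)
  have hg : ‖(g : E →L[ℝ] E)‖ ≤ |c| :=
    ContinuousLinearMap.opNorm_le_bound _ (abs_nonneg c) fun η => (norm_smul c η).le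
  have hcomp : iteratedFDeriv ℝ n (f ∘ g) ξ =
      (iteratedFDeriv ℝ n f (g ξ)).compContinuousLinearMap fun _ => g := by
    simpa only [preimage_univ, iteratedFDerivWithin_univ] using
      g.iteratedFDerivWithin_comp_right f uniqueDiffOn_univ (mem_univ (g ξ)) n
  calc ‖iteratedFDeriv ℝ n (f ∘ g) ξ‖
      ≤ ‖iteratedFDeriv ℝ n f (g ξ)‖ * ∏ _i : Fin n, ‖(g : E →L[ℝ] E)‖ :=
        hcomp ▸ ContinuousMultilinearMap.norm_compContinuousLinearMap_le _ _
    _ ≤ ‖iteratedFDeriv ℝ n f (c • ξ)‖ * |c| ^ n := by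
        rw [Finset.prod_const, Finset.card_fin]
        gcongr
        exact le_rfl

theorem norm_iteratedFDeriv_comp_le_of_isOpen {E F G : Type*} [NormedAddCommGroup E]
    [NormedSpace ℝ E] [NormedAddCommGroup F] [NormedSpace ℝ F] [NormedAddCommGroup G]
    [NormedSpace ℝ G] {g : F → G} {f : E → F} {n : ℕ} {s : Set E} {ξ : E} {C D : ℝ}
    (hg : ContDiff ℝ n g) (hf : ContDiffOn ℝ n f s) (hs : IsOpen s) (hξ : ξ ∈ s)
    (hC : ∀ i ≤ n, ‖iteratedFDeriv ℝ i g (f ξ)‖ ≤ C)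
    (hD : ∀ i, 1 ≤ i → i ≤ n → ‖iteratedFDeriv ℝ i f ξ‖ ≤ D ^ i) :
    ‖iteratedFDeriv ℝ n (g ∘ f) ξ‖ ≤ n.factorial * C * D ^ n := by
  rw [← iteratedFDerivWithin_of_isOpen n hs hξ]
  refine norm_iteratedFDerivWithin_comp_le hg.contDiffOn hf le_rfl uniqueDiffOn_univ
    hs.uniqueDiffOn (mapsTo_univ _ _) hξ (fun i hi => ?_) fun i hi hin => ?_
  · simpa only [iteratedFDerivWithin_univ] using hC i hi
  · simpa only [iteratedFDerivWithin_of_isOpen i hs hξ] using hD i hi hin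

theorem exists_norm_iteratedFDeriv_le_of_homogeneous {E G : Type*} [NormedAddCommGroup E]
    [NormedSpace ℝ E] [ProperSpace E] [NormedAddCommGroup G] [NormedSpace ℝ G] {f : E → G}
    {d : ℝ} {n : ℕ} (hf : ∀ ξ ≠ 0, ContDiffAt ℝ n f ξ)
    (hhom : ∀ r : ℝ, 0 < r → ∀ ξ, f (r • ξ) = r ^ d • f ξ) :
    ∃ B : ℝ, ∀ ξ ≠ 0, ‖iteratedFDeriv ℝ n f ξ‖ ≤ B * ‖ξ‖ ^ (d - n) := by
  obtain ⟨B, hB⟩ := (isCompact_sphere (0 : E) 1).exists_bound_of_continuousOn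
    (f := iteratedFDeriv ℝ n f) fun ξ hξ =>
      ((hf ξ (ne_of_mem_sphere hξ one_ne_zero)).continuousAt_iteratedFDeriv
        le_rfl).continuousWithinAt
  refine ⟨B, fun ξ hξ => ?_⟩
  have hr : 0 < ‖ξ‖ := norm_pos_iff.2 hξ
  have hunit : ‖ξ‖⁻¹ • ξ ∈ sphere (0 : E) 1 := by
    rw [mem_sphere_zero_iff_norm, norm_smul, norm_inv, norm_norm, inv_mul_cancel₀ hr.ne']
  have hrescale : f = fun η => ‖ξ‖ ^ d • f (‖ξ‖⁻¹ • η) := by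
    ext η
    rw [← hhom _ hr, smul_inv_smul₀ hr.ne']
  have hsmooth : ContDiffAt ℝ n (fun η => f (‖ξ‖⁻¹ • η)) ξ :=
    ContDiffAt.comp ξ (hf _ (ne_of_mem_sphere hunit one_ne_zero)) (contDiffAt_id.const_smul _)
  rw [hrescale, iteratedFDeriv_const_smul_apply' hsmooth, norm_smul,
    Real.norm_of_nonneg (by positivity)]
  calc ‖ξ‖ ^ d * ‖iteratedFDeriv ℝ n (fun η => f (‖ξ‖⁻¹ • η)) ξ‖
      ≤ ‖ξ‖ ^ d * (B * |‖ξ‖⁻¹| ^ n) := by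
        gcongr
        refine (norm_iteratedFDeriv_comp_smul_le f (inv_ne_zero hr.ne') n ξ).trans ?_
        gcongr
        exact hB _ hunit
    _ = B * ‖ξ‖ ^ (d - n) := by
        rw [abs_of_pos (inv_pos.2 hr), Real.rpow_sub hr, Real.rpow_natCast, inv_pow,
          div_eq_mul_inv]
        ring

/-! ### The symbol of the fractional heat semigroup -/

/-- The Fourier symbol `e^{-t |ξ|^d}` of the fractional heat semigroup. -/
def symbol {E : Type*} [Norm E] (d t : ℝ) (ξ : E) : ℝ := Real.exp (-t * ‖ξ‖ ^ d)

theorem pow_mul_exp_neg_le_factorial_mul_rpow {l b : ℝ} {i n : ℕ} (hl : 0 < l) (hb : 0 ≤ b)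
    (hb1 : b ≤ 1) (hi : 1 ≤ i) (hin : i ≤ n) :
    l ^ i * Real.exp (-l) ≤ n.factorial * l ^ b := by
  have hfact : (1 : ℝ) ≤ n.factorial := by exact_mod_cast n.factorial_pos
  rcases le_total l 1 with hl1 | hl1
  · calc l ^ i * Real.exp (-l) ≤ l ^ b * 1 := by
          gcongr
          · rw [← Real.rpow_natCast]
            exact Real.rpow_le_rpow_of_exponent_ge hl hl1 (hb1.trans (by exact_mod_cast hi))
          · simpa using hl.le
      _ ≤ n.factorial * l ^ b := by rw [mul_comm]; gcongr
  · calc l ^ i * Real.exp (-l) ≤ l ^ n * Real.exp (-l) := by gcongr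
      _ ≤ n.factorial * Real.exp l * Real.exp (-l) := by
          gcongr
          rw [mul_comm, ← div_le_iff₀ (by positivity)]
          exact Real.pow_div_factorial_le_exp l hl.le n
      _ = n.factorial := by rw [mul_assoc, ← Real.exp_add, add_neg_cancel, Real.exp_zero, mul_one]
      _ ≤ n.factorial * l ^ b :=
          le_mul_of_one_le_right (by positivity) (Real.one_le_rpow hl1 hb)

theorem norm_iteratedFDeriv_exp_neg_mul_sub_le {l b : ℝ} {i n : ℕ} (hl : 0 < l) (hb : 0 ≤ b)
    (hb1 : b ≤ 1) (hin : i ≤ n) :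
    ‖iteratedFDeriv ℝ i (fun y : ℝ => -Real.exp (-l) + Real.exp (-l * y)) 1‖ ≤
      n.factorial * l ^ b := by
  rw [norm_iteratedFDeriv_eq_norm_iteratedDeriv]
  rcases Nat.eq_zero_or_pos i with rfl | hi
  · simpa using by positivity
  · rw [iteratedDeriv_const_add hi, iteratedDeriv_exp_const_mul]
    simpa [abs_of_pos hl] using pow_mul_exp_neg_le_factorial_mul_rpow hl hb hb1 hi hin

section Symbol

variable {E : Type*} [NormedAddCommGroup E] [InnerProductSpace ℝ E] {d ε : ℝ}

theorem contDiffAt_norm_rpow {ξ : E} (hξ : ξ ≠ 0) (d : ℝ) (n : ℕ) :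
    ContDiffAt ℝ n (fun ξ : E => ‖ξ‖ ^ d) ξ :=
  (contDiffAt_norm ℝ hξ).rpow_const_of_ne (norm_ne_zero_iff.2 hξ)

theorem contDiffAt_symbol {ξ : E} (hξ : ξ ≠ 0) (d t : ℝ) (n : ℕ) :
    ContDiffAt ℝ n (symbol d t) ξ :=
  (contDiffAt_const.mul (contDiffAt_norm_rpow hξ d n)).exp

theorem exists_norm_iteratedFDeriv_norm_rpow_le (E : Type*) [NormedAddCommGroup E]
    [InnerProductSpace ℝ E] [FiniteDimensional ℝ E] (d : ℝ) (n : ℕ) :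
    ∃ B : ℝ, 1 ≤ B ∧ ∀ i ≤ n, ∀ ξ : E, ξ ≠ 0 →
      ‖iteratedFDeriv ℝ i (fun ξ : E => ‖ξ‖ ^ d) ξ‖ ≤ B * ‖ξ‖ ^ (d - i) := by
  have hhom (i : ℕ) := exists_norm_iteratedFDeriv_le_of_homogeneous (E := E) (n := i)
    (f := fun ξ : E => ‖ξ‖ ^ d) (d := d) (fun ξ hξ => contDiffAt_norm_rpow hξ d i) fun r hr ξ => by
      rw [norm_smul, Real.norm_of_nonneg hr.le, Real.mul_rpow hr.le (norm_nonneg ξ), smul_eq_mul]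
  choose b hb using hhom
  obtain ⟨B, hB⟩ := ((Finset.range (n + 1)).image b).exists_le
  refine ⟨max 1 B, le_max_left _ _, fun i hi ξ hξ => (hb i ξ hξ).trans ?_⟩
  gcongr
  exact (hB _ (Finset.mem_image_of_mem b (Finset.mem_range.2 (by lia)))).trans (le_max_right _ _)

theorem exists_norm_iteratedFDeriv_normalized_norm_rpow_le (E : Type*) [NormedAddCommGroup E]
    [InnerProductSpace ℝ E] [FiniteDimensional ℝ E] (d : ℝ) (n : ℕ) :
    ∃ B : ℝ, 1 ≤ B ∧ ∀ ξ : E, ξ ≠ 0 → ∀ i, 1 ≤ i → i ≤ n →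
      ‖iteratedFDeriv ℝ i (fun η : E => (‖ξ‖ ^ d)⁻¹ • ‖η‖ ^ d) ξ‖ ≤ (B / ‖ξ‖) ^ i := by
  obtain ⟨B, hB1, hB⟩ := exists_norm_iteratedFDeriv_norm_rpow_le E d n
  refine ⟨B, hB1, fun ξ hξ i hi hin => ?_⟩
  have hr : 0 < ‖ξ‖ := norm_pos_iff.2 hξ
  rw [iteratedFDeriv_const_smul_apply' (contDiffAt_norm_rpow hξ d i), norm_smul,
    Real.norm_of_nonneg (by positivity), div_pow]
  calc (‖ξ‖ ^ d)⁻¹ * ‖iteratedFDeriv ℝ i (fun η : E => ‖η‖ ^ d) ξ‖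
      ≤ (‖ξ‖ ^ d)⁻¹ * (B * ‖ξ‖ ^ (d - i)) := by gcongr; exact hB i hin ξ hξ
    _ = B / ‖ξ‖ ^ i := by rw [Real.rpow_sub hr, Real.rpow_natCast]; field_simp
    _ ≤ B ^ i / ‖ξ‖ ^ i := by gcongr; exact le_self_pow₀ hB1 (by lia)

theorem exists_norm_iteratedFDeriv_symbol_le (E : Type*) [NormedAddCommGroup E]
    [InnerProductSpace ℝ E] [FiniteDimensional ℝ E] (hε : 0 ≤ ε) (hεd : ε ≤ d) (hd : 0 < d)
    {n : ℕ} (hn : 1 ≤ n) :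
    ∃ C : ℝ, 0 < C ∧ ∀ ξ : E, ξ ≠ 0 →
      ‖iteratedFDeriv ℝ n (symbol d 1) ξ‖ ≤ C * ‖ξ‖ ^ (ε - n) := by
  obtain ⟨B, hB1, hB⟩ := exists_norm_iteratedFDeriv_normalized_norm_rpow_le E d n
  refine ⟨n.factorial * n.factorial * B ^ n, by positivity, fun ξ hξ => ?_⟩
  have hr : 0 < ‖ξ‖ := norm_pos_iff.2 hξ
  set l := ‖ξ‖ ^ d with hl
  have hl0 : 0 < l := by positivity
  -- With `l = ‖ξ‖^d`, write `e^{-‖η‖^d} = e^{-l} + g (l⁻¹ ‖η‖^d)`, where `g` vanishes at `1`.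
  set g : ℝ → ℝ := fun y => -Real.exp (-l) + Real.exp (-l * y) with hg_def
  have hfactor : symbol d 1 = fun η : E => Real.exp (-l) + (g ∘ fun η => l⁻¹ • ‖η‖ ^ d) η := by
    ext η
    simp only [symbol, hg_def, Function.comp_apply, smul_eq_mul, neg_mul, one_mul,
      mul_inv_cancel_left₀ hl0.ne']
    ring
  have hsmooth (η : E) (hη : η ≠ 0) : ContDiffAt ℝ n (fun η : E => l⁻¹ • ‖η‖ ^ d) η :=
    (contDiffAt_norm_rpow hη d n).const_smul _
  have hg : ContDiff ℝ n g := by fun_prop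
  have houter : ∀ i ≤ n,
      ‖iteratedFDeriv ℝ i g (l⁻¹ • ‖ξ‖ ^ d)‖ ≤ n.factorial * l ^ (ε / d) := fun i hi => by
    rw [smul_eq_mul, inv_mul_cancel₀ hl0.ne']
    exact norm_iteratedFDeriv_exp_neg_mul_sub_le hl0 (by positivity) ((div_le_one hd).2 hεd) hi
  calc ‖iteratedFDeriv ℝ n (symbol d 1) ξ‖
      = ‖iteratedFDeriv ℝ n (g ∘ fun η : E => l⁻¹ • ‖η‖ ^ d) ξ‖ := by
        rw [hfactor, fun_iteratedFDeriv_add_apply contDiffAt_const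
          (hg.contDiffAt.comp ξ (hsmooth ξ hξ)), iteratedFDeriv_const_of_ne (by lia),
          Pi.zero_apply, zero_add]
    _ ≤ n.factorial * (n.factorial * l ^ (ε / d)) * (B / ‖ξ‖) ^ n :=
        norm_iteratedFDeriv_comp_le_of_isOpen hg
          (fun η hη => (hsmooth η hη).contDiffWithinAt) isOpen_compl_singleton hξ houter
          (hB ξ hξ)
    _ = n.factorial * n.factorial * B ^ n * ‖ξ‖ ^ (ε - n) := by
        rw [hl, ← Real.rpow_mul hr.le, mul_div_cancel₀ _ hd.ne', Real.rpow_sub hr,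
          Real.rpow_natCast]
        ring

theorem abs_exp_neg_rpow_sub_one_le {r : ℝ} (hr : 0 ≤ r) (hε : 0 < ε) (hεd : ε ≤ d) :
    |Real.exp (-r ^ d) - 1| ≤ r ^ ε := by
  have hexp : Real.exp (-r ^ d) ≤ 1 := by simpa using Real.rpow_nonneg hr d
  rw [abs_of_nonpos (by linarith)]
  rcases le_total r 1 with hr1 | hr1
  · have hpow : r ^ d ≤ r ^ ε :=
      Real.rpow_le_rpow_of_exponent_ge_of_imp hr hr1 hεd fun _ h => absurd h (by linarith)
    linarith [Real.add_one_le_exp (-r ^ d)]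
  · linarith [Real.one_le_rpow hr1 hε.le, Real.exp_pos (-r ^ d)]

theorem fwdDiff_iter_sub_const {A G : Type*} [AddCommMonoid A] [AddCommGroup G] (f : A → G)
    (c : G) (h : A) {n : ℕ} (hn : n ≠ 0) :
    (fwdDiff h)^[n] (fun ξ => f ξ - c) = (fwdDiff h)^[n] f := by
  obtain ⟨m, rfl⟩ := Nat.exists_eq_succ_of_ne_zero hn
  rw [Function.iterate_succ_apply, Function.iterate_succ_apply]
  congr 1
  ext ξ
  simp [fwdDiff]

theorem norm_fwdDiff_iter_symbol_le_of_norm_le (hε : 0 < ε) (hεd : ε ≤ d) {n : ℕ} (hn : n ≠ 0)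
    {ξ h : E} (hξ : ‖ξ‖ ≤ 2 * n * ‖h‖) :
    ‖(fwdDiff h)^[n] (symbol d 1) ξ‖ ≤ 2 ^ n * (3 * n * ‖h‖) ^ ε := by
  rw [← fwdDiff_iter_sub_const _ 1 h hn]
  refine norm_fwdDiff_iter_le_of_norm_le n ξ fun k hk => ?_
  rw [symbol, neg_one_mul]
  refine (abs_exp_neg_rpow_sub_one_le (norm_nonneg _) hε hεd).trans ?_
  gcongr
  calc ‖ξ + k • h‖ ≤ ‖ξ‖ + k * ‖h‖ := by
        simpa [← Nat.cast_smul_eq_nsmul ℝ, norm_smul] using norm_add_le ξ (k • h)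
    _ ≤ 2 * n * ‖h‖ + n * ‖h‖ := by gcongr
    _ = 3 * n * ‖h‖ := by ring

theorem half_norm_le_norm_add_smul {n s : ℝ} {ξ h : E} (hs : s ∈ Icc 0 n)
    (hξ : 2 * n * ‖h‖ ≤ ‖ξ‖) : ‖ξ‖ / 2 ≤ ‖ξ + s • h‖ := by
  have htri := norm_sub_norm_le ξ (-(s • h))
  rw [sub_neg_eq_add, norm_neg, norm_smul, Real.norm_of_nonneg hs.1] at htri
  linarith [mul_le_mul_of_nonneg_right hs.2 (norm_nonneg h)]

theorem exists_norm_fwdDiff_iter_symbol_le_of_le_norm (E : Type*) [NormedAddCommGroup E]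
    [InnerProductSpace ℝ E] [FiniteDimensional ℝ E] (hε : 0 ≤ ε) (hεd : ε ≤ d) (hd : 0 < d)
    {n : ℕ} (hn : 1 ≤ n) (hεn : ε ≤ n) :
    ∃ C : ℝ, 0 < C ∧ ∀ ξ h : E, ξ ≠ 0 → 2 * n * ‖h‖ ≤ ‖ξ‖ →
      ‖(fwdDiff h)^[n] (symbol d 1) ξ‖ ≤ C * ‖h‖ ^ n * ‖ξ‖ ^ (ε - n) := by
  obtain ⟨C, hC, hderiv⟩ := exists_norm_iteratedFDeriv_symbol_le E hε hεd hd hn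
  refine ⟨C * 2 ^ (n - ε), by positivity, fun ξ h hξ0 hξ => ?_⟩
  have hr : 0 < ‖ξ‖ := norm_pos_iff.2 hξ0
  have hseg (s : ℝ) (hs : s ∈ Icc (0 : ℝ) n) := half_norm_le_norm_add_smul hs hξ
  have hne (s : ℝ) (hs : s ∈ Icc (0 : ℝ) n) : ξ + s • h ≠ 0 :=
    norm_pos_iff.1 ((half_pos hr).trans_le (hseg s hs))
  calc ‖(fwdDiff h)^[n] (symbol d 1) ξ‖
      ≤ C * (‖ξ‖ / 2) ^ (ε - n) * ‖h‖ ^ n := by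
        refine norm_fwdDiff_iter_le_of_contDiffAt
          (fun s hs => contDiffAt_symbol (hne s hs) d 1 n) fun s hs => ?_
        exact (hderiv _ (hne s hs)).trans <| mul_le_mul_of_nonneg_left
          (Real.rpow_le_rpow_of_nonpos (half_pos hr) (hseg s hs) (sub_nonpos.2 hεn)) hC.le
    _ = C * 2 ^ (n - ε) * ‖h‖ ^ n * ‖ξ‖ ^ (ε - n) := by
        rw [Real.div_rpow hr.le zero_le_two, ← neg_sub (n : ℝ) ε, Real.rpow_neg zero_le_two]
        field_simp

theorem rpow_neg_le_of_le_mul {a b c m : ℝ} (ha : 0 < a) (hb : 0 < b) (hm : 0 ≤ m)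
    (h : b ≤ c * a) : a ^ (-m) ≤ c ^ m * b ^ (-m) := by
  have hc : 0 < c := pos_of_mul_pos_left (hb.trans_le h) ha.le
  rw [Real.rpow_neg ha.le, Real.rpow_neg hb.le, ← div_eq_mul_inv, le_div_iff₀ (by positivity),
    inv_mul_le_iff₀ (by positivity), mul_comm, ← Real.mul_rpow hc.le ha.le]
  gcongr

theorem exists_norm_fwdDiff_iter_symbol_le (E : Type*) [NormedAddCommGroup E]
    [InnerProductSpace ℝ E] [FiniteDimensional ℝ E] (hε : 0 < ε) (hεd : ε ≤ d)
    {n : ℕ} (hn : 1 ≤ n) (hεn : ε ≤ n) :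
    ∃ C : ℝ, 0 < C ∧ ∀ ξ h : E, h ≠ 0 →
      ‖(fwdDiff h)^[n] (symbol d 1) ξ‖ ≤ C * ‖h‖ ^ ε * (1 + ‖ξ‖ / ‖h‖) ^ (-(n - ε)) := by
  obtain ⟨C, hC, hfar⟩ :=
    exists_norm_fwdDiff_iter_symbol_le_of_le_norm E hε.le hεd (hε.trans_le hεd) hn hεn
  have hn1 : (1 : ℝ) ≤ n := by exact_mod_cast hn
  have hm : 0 ≤ n - ε := sub_nonneg.2 hεn
  set A : ℝ := 2 ^ n * (3 * n) ^ ε * (1 + 2 * n) ^ (n - ε)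
  refine ⟨max A (C * 2 ^ (n - ε)), by positivity, fun ξ h hh => ?_⟩
  have hh0 : 0 < ‖h‖ := norm_pos_iff.2 hh
  rcases le_total ‖ξ‖ (2 * n * ‖h‖) with hξ | hξ
  · have hratio : 1 ≤ (1 + 2 * n) ^ (n - ε) * (1 + ‖ξ‖ / ‖h‖) ^ (-(n - ε)) := by
      simpa using rpow_neg_le_of_le_mul (b := 1 + ‖ξ‖ / ‖h‖) (c := 1 + 2 * n) one_pos
        (by positivity) hm (by linarith [(div_le_iff₀ hh0).2 hξ])
    calc ‖(fwdDiff h)^[n] (symbol d 1) ξ‖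
        ≤ 2 ^ n * (3 * n * ‖h‖) ^ ε :=
          norm_fwdDiff_iter_symbol_le_of_norm_le hε hεd (by lia) hξ
      _ = 2 ^ n * (3 * n) ^ ε * ‖h‖ ^ ε * 1 := by
          rw [Real.mul_rpow (by positivity) hh0.le]; ring
      _ ≤ 2 ^ n * (3 * n) ^ ε * ‖h‖ ^ ε *
          ((1 + 2 * n) ^ (n - ε) * (1 + ‖ξ‖ / ‖h‖) ^ (-(n - ε))) := by gcongr
      _ = A * ‖h‖ ^ ε * (1 + ‖ξ‖ / ‖h‖) ^ (-(n - ε)) := by simp only [A]; ring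
      _ ≤ _ := by gcongr; exact le_max_left _ _
  · have hr : 0 < ‖ξ‖ := lt_of_lt_of_le (by positivity) hξ
    have hratio : (‖ξ‖ / ‖h‖) ^ (-(n - ε)) ≤ 2 ^ (n - ε) * (1 + ‖ξ‖ / ‖h‖) ^ (-(n - ε)) :=
      rpow_neg_le_of_le_mul (by positivity) (by positivity) hm
        (by linarith [(le_div_iff₀ hh0).2 hξ])
    calc ‖(fwdDiff h)^[n] (symbol d 1) ξ‖
        ≤ C * ‖h‖ ^ n * ‖ξ‖ ^ (ε - n) := hfar ξ h (norm_pos_iff.1 hr) hξ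
      _ = C * ‖h‖ ^ ε * (‖ξ‖ / ‖h‖) ^ (-(n - ε)) := by
          rw [Real.div_rpow hr.le hh0.le, neg_sub, Real.rpow_sub hh0, Real.rpow_natCast]
          field_simp
      _ ≤ C * ‖h‖ ^ ε * (2 ^ (n - ε) * (1 + ‖ξ‖ / ‖h‖) ^ (-(n - ε))) := by gcongr
      _ = C * 2 ^ (n - ε) * ‖h‖ ^ ε * (1 + ‖ξ‖ / ‖h‖) ^ (-(n - ε)) := by ring
      _ ≤ _ := by gcongr; exact le_max_right _ _

end Symbol

/-! ### Decay of the fundamental solution -/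

theorem continuous_norm_rpow {E : Type*} [SeminormedAddGroup E] {d : ℝ} (hd : 0 ≤ d) :
    Continuous fun ξ : E => ‖ξ‖ ^ d :=
  continuous_norm.rpow_const fun _ => Or.inr hd

theorem norm_exp_I_mul_inner {E : Type*} [SeminormedAddCommGroup E] [InnerProductSpace ℝ E]
    (x ξ : E) : ‖Complex.exp (Complex.I * (inner ℝ x ξ : ℝ))‖ = 1 := by
  rw [mul_comm, Complex.norm_exp_ofReal_mul_I]

section Fourier

variable {E : Type*} [NormedAddCommGroup E] [InnerProductSpace ℝ E] [MeasurableSpace E]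
  [BorelSpace E] [FiniteDimensional ℝ E] {f : E → ℝ} {x h : E} {d ε t : ℝ}

open Module (finrank)

theorem integrable_symbol (hd : 0 < d) (ht : 0 < t) : Integrable (symbol d t : E → ℝ) := by
  cases subsingleton_or_nontrivial E
  · exact ((continuous_norm_rpow hd.le).const_mul _).rexp.integrable_of_hasCompactSupport
      (.of_compactSpace _)
  · refine (integrable_fun_norm_addHaar volume (f := fun r => Real.exp (-t * r ^ d))).2 ?_
    simpa only [Real.rpow_natCast, smul_eq_mul] using integrableOn_rpow_mul_exp_neg_mul_rpow
      (s := ((finrank ℝ E - 1 : ℕ) : ℝ)) (neg_one_lt_zero.trans_le (Nat.cast_nonneg _)) hd ht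

/-- The inverse Fourier transform `∫ e^{i x·ξ} f(ξ) dξ`, without its normalising constant, in the
convention of `kernel`. -/
def invFourier (f : E → ℝ) (x : E) : ℂ :=
  ∫ ξ, Complex.exp (Complex.I * (inner ℝ x ξ : ℝ)) * f ξ

theorem integrable_exp_I_mul_inner_mul (hf : Integrable f) (x : E) :
    Integrable fun ξ => Complex.exp (Complex.I * (inner ℝ x ξ : ℝ)) * (f ξ : ℂ) :=
  hf.ofReal.bdd_mul (c := 1) (Continuous.aestronglyMeasurable (by fun_prop))
    (.of_forall fun ξ => (norm_exp_I_mul_inner x ξ).le)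

theorem norm_invFourier_le (f : E → ℝ) (x : E) : ‖invFourier f x‖ ≤ ∫ ξ, ‖f ξ‖ := by
  refine (norm_integral_le_integral_norm _).trans_eq (integral_congr_ae (.of_forall fun ξ => ?_))
  simp only [norm_mul, norm_exp_I_mul_inner, one_mul, Complex.norm_real]

theorem invFourier_comp_smul (f : E → ℝ) {R : ℝ} (hR : 0 < R) (x : E) :
    invFourier (fun ξ => f (R • ξ)) x = ((R ^ finrank ℝ E)⁻¹ : ℝ) • invFourier f (R⁻¹ • x) := by
  rw [← abs_of_pos (inv_pos.2 (pow_pos hR (finrank ℝ E))), invFourier, invFourier,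
    ← Measure.integral_comp_smul]
  simp only [real_inner_smul_left, real_inner_smul_right, mul_inv_cancel_left₀ hR.ne']

theorem invFourier_comp_add_right (hxh : inner ℝ x h = Real.pi) :
    invFourier (fun ξ => f (ξ + h)) x = -invFourier f x := by
  rw [invFourier, invFourier, ← integral_neg, ← integral_add_right_eq_self (fun ξ => -_) h]
  congr 1 with ξ
  rw [inner_add_right, hxh, Complex.ofReal_add, mul_add, Complex.exp_add,
    mul_comm Complex.I (Real.pi : ℂ), Complex.exp_pi_mul_I]
  ring

theorem invFourier_fwdDiff (hf : Integrable f) (hxh : inner ℝ x h = Real.pi) :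
    invFourier (fwdDiff h f) x = -2 * invFourier f x := by
  have hsub : invFourier (fwdDiff h f) x = invFourier (fun ξ => f (ξ + h)) x - invFourier f x := by
    simp only [invFourier, fwdDiff, Complex.ofReal_sub, mul_sub]
    exact integral_sub (integrable_exp_I_mul_inner_mul (hf.comp_add_right h) x)
      (integrable_exp_I_mul_inner_mul hf x)
  rw [hsub, invFourier_comp_add_right hxh]
  ring

theorem integrable_fwdDiff_iter (hf : Integrable f) (h : E) (n : ℕ) :
    Integrable ((fwdDiff h)^[n] f) := by
  induction n with
  | zero => exact hf
  | succ n ih =>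
    rw [Function.iterate_succ_apply']
    exact (ih.comp_add_right h).sub ih

theorem invFourier_fwdDiff_iter (hf : Integrable f) (hxh : inner ℝ x h = Real.pi) (n : ℕ) :
    invFourier ((fwdDiff h)^[n] f) x = (-2) ^ n * invFourier f x := by
  induction n with
  | zero => simp
  | succ n ih =>
    rw [Function.iterate_succ_apply', invFourier_fwdDiff (integrable_fwdDiff_iter hf h n) hxh, ih]
    ring

theorem norm_invFourier_le_integral_fwdDiff_iter (hf : Integrable f)
    (hxh : inner ℝ x h = Real.pi) (n : ℕ) :
    ‖invFourier f x‖ ≤ ∫ ξ, ‖(fwdDiff h)^[n] f ξ‖ :=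
  calc ‖invFourier f x‖ ≤ 2 ^ n * ‖invFourier f x‖ :=
        le_mul_of_one_le_left (norm_nonneg _) (one_le_pow₀ one_le_two)
    _ = ‖invFourier ((fwdDiff h)^[n] f) x‖ := by simp [invFourier_fwdDiff_iter hf hxh]
    _ ≤ ∫ ξ, ‖(fwdDiff h)^[n] f ξ‖ := norm_invFourier_le _ _

theorem integrable_one_add_norm_div {a m : ℝ} (ha : a ≠ 0) (hm : (finrank ℝ E : ℝ) < m) :
    Integrable fun ξ : E => (1 + ‖ξ‖ / |a|) ^ (-m) := by
  have hint := (integrable_one_add_norm (μ := (volume : Measure E)) hm).comp_smul (inv_ne_zero ha)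
  simpa only [norm_smul, norm_inv, Real.norm_eq_abs, ← div_eq_inv_mul] using hint

theorem integral_one_add_norm_div (a m : ℝ) :
    ∫ ξ : E, (1 + ‖ξ‖ / |a|) ^ (-m) = |a| ^ finrank ℝ E * ∫ ξ : E, (1 + ‖ξ‖) ^ (-m) := by
  have hscale := Measure.integral_comp_smul (volume : Measure E) (fun ξ => (1 + ‖ξ‖) ^ (-m)) a⁻¹
  simpa only [norm_smul, norm_inv, Real.norm_eq_abs, ← div_eq_inv_mul, smul_eq_mul, inv_pow,
    inv_inv, abs_pow] using hscale

theorem exists_norm_invFourier_symbol_le_rpow (E : Type*) [NormedAddCommGroup E]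
    [InnerProductSpace ℝ E] [MeasurableSpace E] [BorelSpace E] [FiniteDimensional ℝ E]
    (hε : 0 < ε) (hεd : ε ≤ d) (hε1 : ε < 1) :
    ∃ C : ℝ, 0 ≤ C ∧ ∀ x : E, x ≠ 0 →
      ‖invFourier (symbol d 1) x‖ ≤ C * ‖x‖ ^ (-(finrank ℝ E + ε)) := by
  set n := finrank ℝ E
  obtain ⟨C, hC, hdiff⟩ := exists_norm_fwdDiff_iter_symbol_le E hε hεd (n := n + 1) (by lia)
    (by push_cast; linarith [Nat.cast_nonneg (α := ℝ) n])
  set m : ℝ := ((n + 1 : ℕ) : ℝ) - ε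
  have hm : (n : ℝ) < m := by simp only [m]; push_cast; linarith
  set A := ∫ ξ : E, (1 + ‖ξ‖) ^ (-m)
  have : 0 ≤ A := integral_nonneg fun ξ => by positivity
  refine ⟨C * A * Real.pi ^ (n + ε), by positivity, fun x hx => ?_⟩
  have hx0 : 0 < ‖x‖ := norm_pos_iff.2 hx
  set h : E := (Real.pi / ‖x‖ ^ 2) • x with hh
  have hxh : inner ℝ x h = Real.pi := by
    rw [hh, real_inner_smul_right, real_inner_self_eq_norm_sq]; field_simp
  have hnorm : ‖h‖ = Real.pi / ‖x‖ := by
    rw [hh, norm_smul, Real.norm_of_nonneg (by positivity)]; field_simp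
  have hh0 : 0 < ‖h‖ := by rw [hnorm]; positivity
  have hint := integrable_one_add_norm_div (E := E) (norm_ne_zero_iff.2 (norm_pos_iff.1 hh0)) hm
  have hscale := integral_one_add_norm_div (E := E) ‖h‖ m
  rw [abs_norm] at hint hscale
  have hsymbol : Integrable (symbol d 1 : E → ℝ) := integrable_symbol (hε.trans_le hεd) one_pos
  calc ‖invFourier (symbol d 1) x‖
      ≤ ∫ ξ, ‖(fwdDiff h)^[n + 1] (symbol d 1) ξ‖ :=
        norm_invFourier_le_integral_fwdDiff_iter hsymbol hxh (n + 1)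
    _ ≤ ∫ ξ : E, C * ‖h‖ ^ ε * (1 + ‖ξ‖ / ‖h‖) ^ (-m) :=
        integral_mono (integrable_fwdDiff_iter hsymbol h _).norm (hint.const_mul _)
          fun ξ => hdiff ξ h (norm_pos_iff.1 hh0)
    _ = C * A * ‖h‖ ^ (n + ε) := by
        rw [integral_const_mul, hscale, Real.rpow_add hh0, Real.rpow_natCast]; ring
    _ = C * A * Real.pi ^ (n + ε) * ‖x‖ ^ (-(n + ε)) := by
        rw [hnorm, Real.div_rpow Real.pi_pos.le hx0.le, Real.rpow_neg hx0.le]; ring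

theorem exists_norm_invFourier_symbol_le (E : Type*) [NormedAddCommGroup E]
    [InnerProductSpace ℝ E] [MeasurableSpace E] [BorelSpace E] [FiniteDimensional ℝ E]
    (hε : 0 < ε) (hεd : ε ≤ d) (hε1 : ε < 1) :
    ∃ C : ℝ, 0 ≤ C ∧ ∀ x : E,
      ‖invFourier (symbol d 1) x‖ ≤ C * (1 + ‖x‖) ^ (-(finrank ℝ E + ε)) := by
  obtain ⟨C, _, hdecay⟩ := exists_norm_invFourier_symbol_le_rpow E hε hεd hε1
  set A := ∫ ξ : E, ‖symbol d 1 ξ‖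
  have : 0 ≤ A := integral_nonneg fun ξ => norm_nonneg _
  set m : ℝ := finrank ℝ E + ε
  have hm : 0 ≤ m := by positivity
  refine ⟨max A C * 2 ^ m, by positivity, fun x => ?_⟩
  rw [mul_assoc]
  rcases le_total ‖x‖ 1 with hx | hx
  · have hratio : 1 ≤ 2 ^ m * (1 + ‖x‖) ^ (-m) := by
      simpa using rpow_neg_le_of_le_mul one_pos (b := 1 + ‖x‖) (c := 2) (by positivity) hm
        (by linarith)
    calc ‖invFourier (symbol d 1) x‖ ≤ A * 1 := by
          rw [mul_one]; exact norm_invFourier_le _ _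
      _ ≤ max A C * (2 ^ m * (1 + ‖x‖) ^ (-m)) := by gcongr; exact le_max_left _ _
  · have hx0 : 0 < ‖x‖ := one_pos.trans_le hx
    calc ‖invFourier (symbol d 1) x‖ ≤ C * ‖x‖ ^ (-m) := hdecay x (norm_pos_iff.1 hx0)
      _ ≤ max A C * (2 ^ m * (1 + ‖x‖) ^ (-m)) := by
          gcongr
          · exact le_max_right _ _
          · exact rpow_neg_le_of_le_mul hx0 (by positivity) hm (by linarith)

end Fourier

section Kernel

variable {N : ℕ} {d ε t : ℝ}

/-- The kernel `a^ε (a + ‖x‖)^{-(N+ε)}`; with `a = t^{1/d}` it dominates the fundamental solution at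
time `t`. Its integral over `ℝ^N` does not depend on `a`. -/
def majorant (N : ℕ) (ε a : ℝ) (x : Space N) : ℝ := a ^ ε * (a + ‖x‖) ^ (-((N : ℝ) + ε))

theorem majorant_eq {a : ℝ} (ha : 0 < a) (ε : ℝ) (x : Space N) :
    majorant N ε a x = (a ^ N)⁻¹ * (1 + ‖a⁻¹ • x‖) ^ (-((N : ℝ) + ε)) := by
  rw [majorant, norm_smul, norm_inv, Real.norm_of_nonneg ha.le,
    show 1 + a⁻¹ * ‖x‖ = (a + ‖x‖) / a by field_simp, Real.div_rpow (by positivity) ha.le,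
    Real.rpow_neg ha.le, Real.rpow_add ha, Real.rpow_natCast]
  field_simp

theorem kernel_eq (x : Space N) (t : ℝ) :
    kernel N d x t = ((2 * Real.pi) ^ N)⁻¹ * (invFourier (symbol d t) x).re := rfl

theorem symbol_one_smul (hd : d ≠ 0) (ht : 0 < t) (ξ : Space N) :
    symbol d 1 (t ^ (1 / d) • ξ) = symbol d t ξ := by
  rw [symbol, symbol, norm_smul, Real.norm_of_nonneg (by positivity),
    Real.mul_rpow (by positivity) (norm_nonneg _), ← Real.rpow_mul ht.le,
    one_div_mul_cancel hd, Real.rpow_one]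
  ring_nf

theorem kernel_scaling (hd : d ≠ 0) (ht : 0 < t) (x : Space N) :
    kernel N d x t = ((t ^ (1 / d)) ^ N)⁻¹ * kernel N d ((t ^ (1 / d))⁻¹ • x) 1 := by
  have hscale := invFourier_comp_smul (symbol d 1) (R := t ^ (1 / d)) (by positivity) x
  simp only [symbol_one_smul hd ht, finrank_euclideanSpace_fin] at hscale
  rw [kernel_eq, kernel_eq, hscale, Complex.real_smul, Complex.re_ofReal_mul]
  ring

theorem exists_abs_kernel_le (N : ℕ) (hε : 0 < ε) (hεd : ε ≤ d) (hε1 : ε < 1) :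
    ∃ C : ℝ, 1 ≤ C ∧ ∀ (x : Space N) (t : ℝ), 0 < t →
      |kernel N d x t| ≤ C * majorant N ε (t ^ (1 / d)) x := by
  obtain ⟨C, _, hdecay⟩ := exists_norm_invFourier_symbol_le (Space N) hε hεd hε1
  rw [finrank_euclideanSpace_fin] at hdecay
  set b := ((2 * Real.pi) ^ N)⁻¹
  have hb0 : 0 ≤ b := by positivity
  have hone (x : Space N) : |kernel N d x 1| ≤ b * C * (1 + ‖x‖) ^ (-((N : ℝ) + ε)) := by
    rw [kernel_eq, abs_mul, abs_of_nonneg hb0, mul_assoc]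
    gcongr
    exact (Complex.abs_re_le_norm _).trans (hdecay x)
  refine ⟨max 1 (b * C), le_max_left _ _, fun x t ht => ?_⟩
  have ha : 0 < t ^ (1 / d) := by positivity
  rw [kernel_scaling (hε.trans_le hεd).ne' ht, abs_mul, abs_of_pos (by positivity),
    majorant_eq ha, mul_left_comm]
  gcongr
  refine (hone _).trans ?_
  gcongr
  exact le_max_right _ _

theorem continuousAt_kernel (hd : 0 < d) (x : Space N) (ht : 0 < t) :
    ContinuousAt (fun z : Space N × ℝ => kernel N d z.1 z.2) (x, t) := by
  have hrpow : Continuous fun ξ : Space N => ‖ξ‖ ^ d := continuous_norm_rpow hd.le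
  have htime : ∀ᶠ z : Space N × ℝ in nhds (x, t), t / 2 < z.2 :=
    continuous_snd.continuousAt.eventually (lt_mem_nhds (half_lt_self ht))
  refine continuousAt_const.mul (Complex.continuous_re.continuousAt.comp ?_)
  refine continuousAt_of_dominated (bound := symbol d (t / 2))
    (.of_forall fun z => Continuous.aestronglyMeasurable (by fun_prop)) ?_
    (integrable_symbol hd (by positivity))
    (.of_forall fun ξ => Continuous.continuousAt (by fun_prop))
  filter_upwards [htime] with z hz
  refine .of_forall fun ξ => ?_
  rw [norm_mul, norm_exp_I_mul_inner, one_mul, Complex.norm_real, Real.norm_eq_abs, Real.abs_exp,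
    symbol]
  gcongr

theorem measurable_kernel (N : ℕ) (d : ℝ) :
    Measurable fun z : Space N × ℝ => kernel N d z.1 z.2 := by
  unfold kernel
  refine (Complex.measurable_re.comp ?_).const_mul _
  refine (StronglyMeasurable.integral_prod_right ?_).measurable
  exact Measurable.stronglyMeasurable (by fun_prop)

end Kernel

/-! ### Potentials of the majorant kernel -/

section Majorant

variable {N : ℕ} {d ε : ℝ}

theorem majorant_pos {a : ℝ} (ha : 0 < a) (x : Space N) : 0 < majorant N ε a x := by
  unfold majorant; positivity

theorem majorant_nonneg {a : ℝ} (ha : 0 ≤ a) (x : Space N) : 0 ≤ majorant N ε a x := by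
  unfold majorant; positivity

theorem measurable_ofReal_majorant {α : Type*} [MeasurableSpace α] (ε d : ℝ) {f : α → ℝ}
    {g : α → Space N} (hf : Measurable f) (hg : Measurable g) :
    Measurable fun z => ENNReal.ofReal (majorant N ε (f z ^ (1 / d)) (g z)) := by
  unfold majorant
  fun_prop

theorem majorant_le_majorant {a b c k : ℝ} (hε : 0 ≤ ε) (ha : 0 < a) (hb : 0 < b)
    (hab : a ≤ k * b) {x y : Space N} (h : b + ‖y‖ ≤ c * (a + ‖x‖)) :
    majorant N ε a x ≤ k ^ ε * c ^ ((N : ℝ) + ε) * majorant N ε b y := by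
  have hk : 0 < k := pos_of_mul_pos_left (ha.trans_le hab) hb.le
  calc majorant N ε a x
      ≤ (k * b) ^ ε * (c ^ ((N : ℝ) + ε) * (b + ‖y‖) ^ (-((N : ℝ) + ε))) := by
        unfold majorant
        gcongr
        exact rpow_neg_le_of_le_mul (by positivity) (by positivity) (by positivity) h
    _ = k ^ ε * c ^ ((N : ℝ) + ε) * majorant N ε b y := by
        rw [majorant, Real.mul_rpow hk.le hb.le]
        ring

theorem majorant_mul_majorant_le {a b c τ : ℝ} (hε : 0 ≤ ε) (ha : 0 < a) (hb : 0 < b)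
    (haτ : a ≤ τ) (hbτ : b ≤ τ) (hc : 1 ≤ c) (hτ : τ ≤ c * max a b) (u v : Space N) :
    majorant N ε a u * majorant N ε b v ≤
      (2 * c) ^ ((N : ℝ) + ε) * majorant N ε τ (u + v) *
        (majorant N ε a u + majorant N ε b v) := by
  have hτ0 : 0 < τ := ha.trans_le haτ
  have hu := majorant_pos (ε := ε) ha u
  have hv := majorant_pos (ε := ε) hb v
  have hsum : 0 < (2 * c) ^ ((N : ℝ) + ε) * majorant N ε τ (u + v) := by
    have := majorant_pos (ε := ε) hτ0 (u + v)
    positivity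
  have hmax : τ + ‖u + v‖ ≤ 2 * c * max (a + ‖u‖) (b + ‖v‖) := by
    have := norm_add_le u v
    have hu' := le_max_left (a + ‖u‖) (b + ‖v‖)
    have hv' := le_max_right (a + ‖u‖) (b + ‖v‖)
    rcases max_cases a b with ⟨hm, -⟩ | ⟨hm, -⟩ <;> rw [hm] at hτ <;>
      nlinarith [norm_nonneg u, norm_nonneg v]
  rcases max_cases (a + ‖u‖) (b + ‖v‖) with ⟨hm, -⟩ | ⟨hm, -⟩ <;> rw [hm] at hmax
  · have hle := majorant_le_majorant (k := 1) hε ha hτ0 (by linarith) hmax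
    rw [Real.one_rpow, one_mul] at hle
    nlinarith [mul_le_mul_of_nonneg_right hle hv.le, mul_pos hsum hu]
  · have hle := majorant_le_majorant (k := 1) hε hb hτ0 (by linarith) hmax
    rw [Real.one_rpow, one_mul] at hle
    nlinarith [mul_le_mul_of_nonneg_left hle hu.le, mul_pos hsum hv]

theorem majorant_rpow_mul_majorant_rpow_le (hε : 0 ≤ ε) (hd : 0 ≤ d) {r s : ℝ} (hr : 0 < r)
    (hs : 0 < s) (u v : Space N) :
    majorant N ε (r ^ (1 / d)) u * majorant N ε (s ^ (1 / d)) v ≤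
      (2 * 2 ^ (1 / d)) ^ ((N : ℝ) + ε) * majorant N ε ((r + s) ^ (1 / d)) (u + v) *
        (majorant N ε (r ^ (1 / d)) u + majorant N ε (s ^ (1 / d)) v) := by
  have hd' : 0 ≤ 1 / d := by positivity
  have hquasi : (r + s) ^ (1 / d) ≤ 2 ^ (1 / d) * max (r ^ (1 / d)) (s ^ (1 / d)) := by
    rw [← (Real.monotoneOn_rpow_Ici_of_exponent_nonneg hd').map_max hr.le hs.le,
      ← Real.mul_rpow zero_le_two (by positivity)]
    gcongr
    linarith [le_max_left r s, le_max_right r s]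
  exact majorant_mul_majorant_le hε (by positivity) (by positivity) (by gcongr; linarith)
    (by gcongr; linarith) (Real.one_le_rpow one_le_two hd') hquasi u v

theorem majorant_shift_le (hε : 0 ≤ ε) (hd : 0 ≤ d) {r r' : ℝ} (hr : 0 < r)
    (hr₁ : r / 2 ≤ r') (hr₂ : r' ≤ 2 * r) {x x₀ : Space N} (hx : ‖x - x₀‖ ≤ r ^ (1 / d))
    (y : Space N) :
    majorant N ε (r' ^ (1 / d)) (x - y) ≤
      (2 ^ (1 / d)) ^ ε * (2 * 2 ^ (1 / d)) ^ ((N : ℝ) + ε) *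
        majorant N ε (r ^ (1 / d)) (x₀ - y) := by
  have hd' : 0 ≤ 1 / d := by positivity
  have hr' : 0 < r' := by linarith
  have hone : (1 : ℝ) ≤ 2 ^ (1 / d) := Real.one_le_rpow one_le_two hd'
  have hle : r' ^ (1 / d) ≤ 2 ^ (1 / d) * r ^ (1 / d) := by
    rw [← Real.mul_rpow zero_le_two hr.le]; gcongr
  have hge : r ^ (1 / d) ≤ 2 ^ (1 / d) * r' ^ (1 / d) := by
    rw [← Real.mul_rpow zero_le_two hr'.le]; gcongr; linarith
  refine majorant_le_majorant hε (by positivity) (by positivity) hle ?_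
  have htri : ‖x₀ - y‖ ≤ ‖x - x₀‖ + ‖x - y‖ := by
    simpa only [norm_sub_rev x₀ x] using norm_sub_le_norm_sub_add_norm_sub x₀ x y
  nlinarith [norm_nonneg (x - y)]

/-- The integral of `majorant N ε a` over `ℝ^N`, for every `a > 0`. -/
def majorantMass (N : ℕ) (ε : ℝ) : ℝ := ∫ x : Space N, (1 + ‖x‖) ^ (-((N : ℝ) + ε))

theorem integrable_one_add_norm_rpow (N : ℕ) (hε : 0 < ε) :
    Integrable fun x : Space N => (1 + ‖x‖) ^ (-((N : ℝ) + ε)) :=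
  integrable_one_add_norm (by simpa using hε)

theorem majorantMass_pos (N : ℕ) (hε : 0 < ε) : 0 < majorantMass N ε := by
  rw [majorantMass, integral_pos_iff_support_of_nonneg (fun x => by positivity)
    (integrable_one_add_norm_rpow N hε)]
  have hsupp : (Function.support fun x : Space N => (1 + ‖x‖) ^ (-((N : ℝ) + ε))) = univ :=
    eq_univ_of_forall fun x => (by positivity : (0 : ℝ) < (1 + ‖x‖) ^ (-((N : ℝ) + ε))).ne'
  rw [hsupp]
  exact isOpen_univ.measure_pos volume univ_nonempty

theorem lintegral_majorant (hε : 0 < ε) {a : ℝ} (ha : 0 < a) :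
    ∫⁻ x : Space N, ENNReal.ofReal (majorant N ε a x) = ENNReal.ofReal (majorantMass N ε) := by
  have hint : Integrable (majorant N ε a) := by
    simp_rw [funext (majorant_eq ha ε)]
    exact ((integrable_one_add_norm_rpow N hε).comp_smul (inv_ne_zero ha.ne')).const_mul _
  rw [← ofReal_integral_eq_lintegral_ofReal hint (.of_forall (majorant_nonneg ha.le))]
  simp_rw [majorant_eq ha]
  rw [integral_const_mul, Measure.integral_comp_smul (volume : Measure (Space N))
    fun ξ => (1 + ‖ξ‖) ^ (-((N : ℝ) + ε)), finrank_euclideanSpace_fin, smul_eq_mul, inv_pow,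
    inv_inv, abs_of_pos (by positivity), inv_mul_cancel_left₀ (by positivity), majorantMass]

theorem lintegral_majorant_sub_left (hε : 0 < ε) {a : ℝ} (ha : 0 < a) (x : Space N) :
    ∫⁻ y, ENNReal.ofReal (majorant N ε a (x - y)) = ENNReal.ofReal (majorantMass N ε) :=
  (lintegral_sub_left_eq_self (fun y => ENNReal.ofReal (majorant N ε a y)) x).trans
    (lintegral_majorant hε ha)

theorem lintegral_majorant_mul_majorant_le (hε : 0 < ε) (hd : 0 ≤ d) {r s : ℝ} (hr : 0 < r)
    (hs : 0 < s) (x z : Space N) :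
    ∫⁻ y, ENNReal.ofReal (majorant N ε (r ^ (1 / d)) (x - y)) *
        ENNReal.ofReal (majorant N ε (s ^ (1 / d)) (y - z)) ≤
      ENNReal.ofReal ((2 * 2 ^ (1 / d)) ^ ((N : ℝ) + ε) * (2 * majorantMass N ε)) *
        ENNReal.ofReal (majorant N ε ((r + s) ^ (1 / d)) (x - z)) := by
  set P : ℝ := (2 * 2 ^ (1 / d)) ^ ((N : ℝ) + ε)
  set K : ℝ → Space N → ℝ := fun t => majorant N ε (t ^ (1 / d))
  have hK {t : ℝ} (ht : 0 < t) (u : Space N) : 0 ≤ K t u := majorant_nonneg (by positivity) u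
  have hmass := majorantMass_pos N hε
  have hpt (y : Space N) : ENNReal.ofReal (K r (x - y)) * ENNReal.ofReal (K s (y - z)) ≤
      ENNReal.ofReal (P * K (r + s) (x - z)) *
        (ENNReal.ofReal (K r (x - y)) + ENNReal.ofReal (K s (y - z))) := by
    have hP : 0 ≤ P * K (r + s) (x - z) := mul_nonneg (by positivity) (hK (by positivity) _)
    rw [← ENNReal.ofReal_mul (hK hr _), ← ENNReal.ofReal_add (hK hr _) (hK hs _),
      ← ENNReal.ofReal_mul hP]
    have := majorant_rpow_mul_majorant_rpow_le hε.le hd hr hs (x - y) (y - z)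
    rw [sub_add_sub_cancel] at this
    exact ENNReal.ofReal_le_ofReal this
  calc ∫⁻ y, ENNReal.ofReal (K r (x - y)) * ENNReal.ofReal (K s (y - z))
      ≤ ∫⁻ y, ENNReal.ofReal (P * K (r + s) (x - z)) *
          (ENNReal.ofReal (K r (x - y)) + ENNReal.ofReal (K s (y - z))) := lintegral_mono hpt
    _ = ENNReal.ofReal (P * K (r + s) (x - z)) *
          (ENNReal.ofReal (majorantMass N ε) + ENNReal.ofReal (majorantMass N ε)) := by
        rw [lintegral_const_mul' _ _ ENNReal.ofReal_ne_top, lintegral_add_left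
          (measurable_ofReal_majorant ε d measurable_const (by fun_prop)),
          lintegral_majorant_sub_left hε (by positivity),
          lintegral_sub_right_eq_self fun y => ENNReal.ofReal (K s y),
          lintegral_majorant hε (by positivity)]
    _ = ENNReal.ofReal (P * (2 * majorantMass N ε)) * ENNReal.ofReal (K (r + s) (x - z)) := by
        rw [← ENNReal.ofReal_add hmass.le hmass.le, ← two_mul,
          ← ENNReal.ofReal_mul' (by positivity), ← ENNReal.ofReal_mul (by positivity)]
        ring_nf

/-- The potential `∫ K(x - y, t) μ(y) dy`, where `K(·, t)` is the majorant of the fundamental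
solution at time `t`. -/
def potential (N : ℕ) (d ε : ℝ) (μ : Space N → ℝ≥0∞) (x : Space N) (t : ℝ) : ℝ≥0∞ :=
  ∫⁻ y, ENNReal.ofReal (majorant N ε (t ^ (1 / d)) (x - y)) * μ y

theorem potential_congr {μ ν : Space N → ℝ≥0∞} (h : μ =ᵐ[volume] ν) :
    potential N d ε μ = potential N d ε ν := by
  ext x t
  exact lintegral_congr_ae (h.mono fun y hy => by simp only [hy])

theorem potential_mono {μ ν : Space N → ℝ≥0∞} (h : ∀ y, μ y ≤ ν y) (x : Space N) (t : ℝ) :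
    potential N d ε μ x t ≤ potential N d ε ν x t :=
  lintegral_mono fun y => mul_le_mul_right (h y) _

theorem potential_ofReal_mul {b : ℝ} (μ : Space N → ℝ≥0∞) (x : Space N) (t : ℝ) :
    potential N d ε (fun y => ENNReal.ofReal b * μ y) x t =
      ENNReal.ofReal b * potential N d ε μ x t := by
  simp_rw [potential, mul_left_comm _ (ENNReal.ofReal b)]
  rw [lintegral_const_mul' _ _ ENNReal.ofReal_ne_top]

theorem potential_const (hε : 0 < ε) (M : ℝ) (x : Space N) {t : ℝ} (ht : 0 < t) :
    potential N d ε (fun _ => ENNReal.ofReal M) x t = ENNReal.ofReal (majorantMass N ε * M) := by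
  rw [potential, lintegral_mul_const' _ _ ENNReal.ofReal_ne_top,
    lintegral_majorant_sub_left hε (by positivity),
    ENNReal.ofReal_mul (majorantMass_pos N hε).le]

theorem measurable_potential {μ : Space N → ℝ≥0∞} (hμ : AEMeasurable μ) :
    Measurable fun z : Space N × ℝ => potential N d ε μ z.1 z.2 := by
  rw [potential_congr hμ.ae_eq_mk]
  refine Measurable.lintegral_prod_right'
    (f := fun z : (Space N × ℝ) × Space N =>
      ENNReal.ofReal (majorant N ε (z.1.2 ^ (1 / d)) (z.1.1 - z.2)) * hμ.mk μ z.2) ?_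
  exact (measurable_ofReal_majorant ε d (by fun_prop) (by fun_prop)).mul
    (hμ.measurable_mk.comp measurable_snd)

/-- The loss in the approximate semigroup property `potential_potential_le` of the majorant. -/
def semigroupConst (N : ℕ) (d ε : ℝ) : ℝ :=
  (2 * 2 ^ (1 / d)) ^ ((N : ℝ) + ε) * (2 * majorantMass N ε)

theorem semigroupConst_pos (N : ℕ) (d : ℝ) (hε : 0 < ε) : 0 < semigroupConst N d ε := by
  have := majorantMass_pos N hε
  unfold semigroupConst
  positivity

theorem potential_potential_le (hd : 0 ≤ d) (hε : 0 < ε) {μ : Space N → ℝ≥0∞}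
    (hμ : AEMeasurable μ) (x : Space N) {r s : ℝ} (hr : 0 < r) (hs : 0 < s) :
    potential N d ε (fun y => potential N d ε μ y s) x r ≤
      ENNReal.ofReal (semigroupConst N d ε) * potential N d ε μ x (r + s) := by
  rw [potential_congr hμ.ae_eq_mk]
  set ν := hμ.mk μ
  have hν : Measurable ν := hμ.measurable_mk
  set K : ℝ → Space N → ℝ≥0∞ := fun t u => ENNReal.ofReal (majorant N ε (t ^ (1 / d)) u)
  have hK {α : Type} [MeasurableSpace α] (t : ℝ) {g : α → Space N} (hg : Measurable g) :
      Measurable fun z => K t (g z) := measurable_ofReal_majorant ε d measurable_const hg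
  calc ∫⁻ y, K r (x - y) * ∫⁻ z, K s (y - z) * ν z
      = ∫⁻ y, ∫⁻ z, K r (x - y) * (K s (y - z) * ν z) := by
        exact lintegral_congr fun y => (lintegral_const_mul' _ _ ENNReal.ofReal_ne_top).symm
    _ = ∫⁻ z, ∫⁻ y, K r (x - y) * K s (y - z) * ν z := by
        simp_rw [← mul_assoc]
        refine lintegral_lintegral_swap (Measurable.aemeasurable ?_)
        exact ((hK r (by fun_prop)).mul (hK s (by fun_prop))).mul (hν.comp measurable_snd)
    _ = ∫⁻ z, (∫⁻ y, K r (x - y) * K s (y - z)) * ν z :=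
        lintegral_congr fun z => lintegral_mul_const _
          ((hK r (by fun_prop)).mul (hK s (by fun_prop)))
    _ ≤ ∫⁻ z, ENNReal.ofReal (semigroupConst N d ε) * (K (r + s) (x - z) * ν z) := by
        refine lintegral_mono fun z => ?_
        rw [← mul_assoc]
        exact mul_le_mul_left (lintegral_majorant_mul_majorant_le hε hd hr hs x z) _
    _ = ENNReal.ofReal (semigroupConst N d ε) * ∫⁻ z, K (r + s) (x - z) * ν z :=
        lintegral_const_mul' _ _ ENNReal.ofReal_ne_top

theorem lintegral_setLIntegral_ball_swap {E : Type*} [PseudoMetricSpace E] [MeasurableSpace E]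
    [OpensMeasurableSpace E] [SecondCountableTopology E] {μ : Measure E} [SFinite μ]
    {F : E → E → ℝ≥0∞} (hF : Measurable (Function.uncurry F)) (a : ℝ) :
    ∫⁻ y, ∫⁻ z in ball y a, F y z ∂μ ∂μ = ∫⁻ z, ∫⁻ y in ball z a, F y z ∂μ ∂μ := by
  have hset : MeasurableSet {p : E × E | dist p.2 p.1 < a} :=
    measurableSet_lt (by fun_prop) measurable_const
  simp_rw [← lintegral_indicator measurableSet_ball]
  calc ∫⁻ y, ∫⁻ z, (ball y a).indicator (F y) z ∂μ ∂μ
      = ∫⁻ z, ∫⁻ y, (ball y a).indicator (F y) z ∂μ ∂μ :=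
        lintegral_lintegral_swap (hF.indicator hset).aemeasurable
    _ = ∫⁻ z, ∫⁻ y, (ball z a).indicator (fun y => F y z) y ∂μ ∂μ := by
        simp only [indicator, mem_ball, dist_comm]

-- Moving the pole within a ball of radius `a` changes the majorant at scale `a` by a constant only,
-- so the majorant may be averaged over such balls before Tonelli's theorem is applied.
theorem volume_ball_mul_lintegral_majorant_mul_le (hε : 0 < ε) {ν : Space N → ℝ≥0∞}
    (hν : Measurable ν) {a : ℝ} (ha : 0 < a) {S : ℝ≥0∞} (hS : ∀ z, ∫⁻ y in ball z a, ν y ≤ S)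
    (x : Space N) :
    volume (ball (0 : Space N) a) * ∫⁻ y, ENNReal.ofReal (majorant N ε a (x - y)) * ν y ≤
      ENNReal.ofReal (2 ^ ((N : ℝ) + ε) * majorantMass N ε) * S := by
  set P : ℝ := 2 ^ ((N : ℝ) + ε)
  set K : Space N → ℝ≥0∞ := fun u => ENNReal.ofReal (majorant N ε a u)
  have hK : Measurable K := by
    simpa using measurable_ofReal_majorant ε 1 (measurable_const (a := a)) measurable_id
  have hshift (y z : Space N) (hz : z ∈ ball y a) : K (x - y) ≤ ENNReal.ofReal P * K (x - z) := by
    rw [← ENNReal.ofReal_mul (by positivity)]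
    refine ENNReal.ofReal_le_ofReal ?_
    simpa using majorant_le_majorant (k := 1) (c := 2) hε.le ha ha (by linarith) (x := x - y)
      (y := x - z) (by
        have := norm_sub_le_norm_sub_add_norm_sub x y z
        rw [← dist_eq_norm y z, dist_comm] at this
        linarith [norm_nonneg (x - y), mem_ball.1 hz])
  calc volume (ball (0 : Space N) a) * ∫⁻ y, K (x - y) * ν y
      = ∫⁻ y, K (x - y) * ν y * volume (ball y a) := by
        rw [mul_comm, ← lintegral_mul_const' _ _ measure_ball_lt_top.ne]
        exact lintegral_congr fun y => by rw [Measure.addHaar_ball_center volume y]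
    _ ≤ ∫⁻ y, ∫⁻ z in ball y a, ENNReal.ofReal P * K (x - z) * ν y := by
        refine lintegral_mono fun y => ?_
        rw [← setLIntegral_const]
        exact setLIntegral_mono' measurableSet_ball fun z hz => mul_le_mul_left (hshift y z hz) _
    _ = ∫⁻ z, ENNReal.ofReal P * K (x - z) * ∫⁻ y in ball z a, ν y := by
        rw [lintegral_setLIntegral_ball_swap (by fun_prop)]
        exact lintegral_congr fun z => lintegral_const_mul _ hν
    _ ≤ ∫⁻ z, ENNReal.ofReal P * K (x - z) * S :=
        lintegral_mono fun z => mul_le_mul_right (hS z) _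
    _ = ENNReal.ofReal (P * majorantMass N ε) * S := by
        rw [lintegral_mul_const _ (by fun_prop), lintegral_const_mul _ (by fun_prop),
          lintegral_majorant_sub_left hε ha, ENNReal.ofReal_mul (by positivity)]

/-- The constant in `potential_le_of_lintegral_ball_le`, which passes from the masses of balls of
radius `t^{1/d}` to potentials at time `t`. -/
def ballConst (N : ℕ) (ε : ℝ) : ℝ :=
  2 ^ ((N : ℝ) + ε) * majorantMass N ε / volume.real (ball (0 : Space N) 1)

theorem volume_real_unitBall_pos (N : ℕ) : 0 < volume.real (ball (0 : Space N) 1) :=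
  ENNReal.toReal_pos (measure_ball_pos _ _ one_pos).ne' measure_ball_lt_top.ne

theorem ballConst_pos (N : ℕ) (hε : 0 < ε) : 0 < ballConst N ε := by
  have := majorantMass_pos N hε
  have := volume_real_unitBall_pos N
  unfold ballConst
  positivity

theorem potential_le_of_lintegral_ball_le (d : ℝ) (hε : 0 < ε) {μ : Space N → ℝ≥0∞}
    (hμ : AEMeasurable μ) {t : ℝ} (ht : 0 < t) {S : ℝ≥0∞}
    (hS : ∀ z, ∫⁻ y in ball z (t ^ (1 / d)), μ y ≤ S) (x : Space N) :
    ENNReal.ofReal (t ^ ((N : ℝ) / d)) * potential N d ε μ x t ≤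
      ENNReal.ofReal (ballConst N ε) * S := by
  set ω := volume (ball (0 : Space N) 1)
  have hω0 : ω ≠ 0 := (measure_ball_pos _ _ one_pos).ne'
  have hω1 : ω ≠ ∞ := measure_ball_lt_top.ne
  have hS' (z : Space N) : ∫⁻ y in ball z (t ^ (1 / d)), hμ.mk μ y ≤ S :=
    (lintegral_congr_ae (ae_restrict_of_ae hμ.ae_eq_mk.symm)).trans_le (hS z)
  have hball :
      volume (ball (0 : Space N) (t ^ (1 / d))) = ENNReal.ofReal (t ^ ((N : ℝ) / d)) * ω := by
    rw [Measure.addHaar_ball_of_pos _ _ (by positivity), finrank_euclideanSpace_fin,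
      ← Real.rpow_natCast, ← Real.rpow_mul ht.le, one_div_mul_eq_div]
  have hvol := volume_ball_mul_lintegral_majorant_mul_le hε hμ.measurable_mk (by positivity) hS' x
  rw [hball] at hvol
  rw [potential_congr hμ.ae_eq_mk, ballConst, ENNReal.ofReal_div_of_pos
    (volume_real_unitBall_pos N), ofReal_measureReal hω1,
    ← ENNReal.mul_div_right_comm, ENNReal.le_div_iff_mul_le (.inl hω0) (.inl hω1), mul_right_comm]
  exact hvol

end Majorant

/-! ### The linear part and the Duhamel part -/

section Duhamel

variable {N : ℕ} {d ε c : ℝ} {φ : Space N → ℝ} {f : Space N → ℝ → ℝ} {x x₀ : Space N}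
  {t t₀ : ℝ} {I : Set ℝ}

/-- The fundamental solution is dominated by `c` times its majorant. -/
def KernelBound (N : ℕ) (d ε c : ℝ) : Prop :=
  ∀ (x : Space N) (t : ℝ), 0 < t → |kernel N d x t| ≤ c * majorant N ε (t ^ (1 / d)) x

/-- The solution `∫ G_d(x - y, t) φ(y) dy` of the linear problem. -/
def linearPart (N : ℕ) (d : ℝ) (φ : Space N → ℝ) (x : Space N) (t : ℝ) : ℝ :=
  ∫ y : Space N, kernel N d (x - y) t * φ y

/-- The integrand of the Duhamel integral at `(x, t)` with source `f`, as a function of time and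
space jointly. -/
def duhamelIntegrand (N : ℕ) (d : ℝ) (f : Space N → ℝ → ℝ) (x : Space N) (t : ℝ)
    (z : ℝ × Space N) : ℝ :=
  kernel N d (x - z.2) (t - z.1) * f z.2 z.1

/-- The Duhamel integral `∫_0^t ∫ G_d(x - y, t - s) f(y, s) dy ds`. -/
def duhamel (N : ℕ) (d : ℝ) (f : Space N → ℝ → ℝ) (x : Space N) (t : ℝ) : ℝ :=
  ∫ s in Ioo 0 t, ∫ y : Space N, duhamelIntegrand N d f x t (s, y)

theorem KernelBound.nonneg (h : KernelBound N d ε c) : 0 ≤ c :=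
  nonneg_of_mul_nonneg_left ((abs_nonneg _).trans (h 0 1 one_pos)) (majorant_pos (by simp) 0)

theorem KernelBound.enorm_kernel_le (h : KernelBound N d ε c) (x : Space N) (ht : 0 < t) :
    ‖kernel N d x t‖ₑ ≤ ENNReal.ofReal c * ENNReal.ofReal (majorant N ε (t ^ (1 / d)) x) := by
  rw [← ENNReal.ofReal_mul h.nonneg, Real.enorm_eq_ofReal_abs]
  exact ENNReal.ofReal_le_ofReal (h x t ht)

theorem KernelBound.lintegral_kernel_mul_le (h : KernelBound N d ε c) (φ : Space N → ℝ)
    (x : Space N) (ht : 0 < t) :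
    ∫⁻ y, ‖kernel N d (x - y) t * φ y‖ₑ ≤
      ENNReal.ofReal c * potential N d ε (fun y => ‖φ y‖ₑ) x t := by
  rw [potential, ← lintegral_const_mul' _ _ ENNReal.ofReal_ne_top]
  refine lintegral_mono fun y => ?_
  rw [enorm_mul, ← mul_assoc]
  gcongr
  exact h.enorm_kernel_le _ ht

theorem measurable_kernel_comp {α : Type*} [MeasurableSpace α] (d : ℝ) {y : α → Space N}
    {s : α → ℝ} (hy : Measurable y) (hs : Measurable s) :
    Measurable fun a => kernel N d (y a) (s a) :=
  (measurable_kernel N d).comp (f := fun a => (y a, s a)) (hy.prodMk hs)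

theorem KernelBound.integrable_kernel_mul (h : KernelBound N d ε c)
    (hφ : AEStronglyMeasurable φ) (ht : 0 < t)
    (hfin : potential N d ε (fun y => ‖φ y‖ₑ) x t < ∞) :
    Integrable fun y => kernel N d (x - y) t * φ y := by
  refine ⟨AEStronglyMeasurable.mul ?_ hφ, ?_⟩
  · exact (measurable_kernel_comp d (by fun_prop) measurable_const).aestronglyMeasurable
  · exact (h.lintegral_kernel_mul_le φ x ht).trans_lt
      (ENNReal.mul_lt_top ENNReal.ofReal_lt_top hfin)

theorem measurable_linearPart (hφ : AEStronglyMeasurable φ) (d : ℝ) :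
    Measurable fun z : Space N × ℝ => linearPart N d φ z.1 z.2 := by
  have hmk (z : Space N × ℝ) :
      linearPart N d φ z.1 z.2 = ∫ y, kernel N d (z.1 - y) z.2 * hφ.mk φ y :=
    integral_congr_ae (hφ.ae_eq_mk.mono fun y hy => by simp only [hy])
  simp_rw [hmk]
  refine (StronglyMeasurable.integral_prod_right ?_).measurable
  refine (Measurable.mul ?_ ?_).stronglyMeasurable
  · exact measurable_kernel_comp d (by fun_prop) (by fun_prop)
  · exact hφ.stronglyMeasurable_mk.measurable.comp measurable_snd

theorem KernelBound.continuousAt_integral {α : Type*} [MeasurableSpace α] {ν : Measure α}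
    (h : KernelBound N d ε c) (hd : 0 < d) (hε : 0 ≤ ε) {y : α → Space N} {s g : α → ℝ}
    (hy : Measurable y) (hs : Measurable s) (hg : AEStronglyMeasurable g ν) {η : ℝ} (hη : 0 < η)
    (hsη : ∀ᵐ a ∂ν, s a ≤ t₀ - η)
    (hfin : ∫⁻ a, ENNReal.ofReal (majorant N ε ((t₀ - s a) ^ (1 / d)) (x₀ - y a)) * ‖g a‖ₑ ∂ν < ∞) :
    ContinuousAt (fun z : Space N × ℝ => ∫ a, kernel N d (z.1 - y a) (z.2 - s a) * g a ∂ν)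
      (x₀, t₀) := by
  set P : ℝ := (2 ^ (1 / d)) ^ ε * (2 * 2 ^ (1 / d)) ^ ((N : ℝ) + ε)
  set K : α → ℝ := fun a => majorant N ε ((t₀ - s a) ^ (1 / d)) (x₀ - y a)
  have hc := h.nonneg
  have hKpos : ∀ᵐ a ∂ν, 0 ≤ K a := hsη.mono fun a ha =>
    majorant_nonneg (Real.rpow_nonneg (by linarith) _) _
  have hspace : ∀ᶠ z : Space N × ℝ in nhds (x₀, t₀), ‖z.1 - x₀‖ ≤ η ^ (1 / d) := by
    have hcont : ContinuousAt (fun z : Space N × ℝ => ‖z.1 - x₀‖) (x₀, t₀) := by fun_prop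
    have hpos : ‖x₀ - x₀‖ < η ^ (1 / d) := by rw [sub_self, norm_zero]; positivity
    exact (hcont.eventually_lt continuousAt_const hpos).mono fun _ => le_of_lt
  have htime : ∀ᶠ z : Space N × ℝ in nhds (x₀, t₀), z.2 ∈ Icc (t₀ - η / 2) (t₀ + η / 2) :=
    continuous_snd.continuousAt.eventually (Icc_mem_nhds (by linarith) (by linarith))
  refine continuousAt_of_dominated (bound := fun a => c * P * (K a * ‖g a‖))
    (.of_forall fun z => ?_) ?_ ?_ ?_
  · exact (measurable_kernel_comp d (by fun_prop) (by fun_prop)).aestronglyMeasurable.mul hg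
  · filter_upwards [hspace, htime] with z hz ⟨hz₁, hz₂⟩
    filter_upwards [hsη] with a ha
    rw [norm_mul, ← mul_assoc, mul_assoc c]
    gcongr
    refine (h _ _ (by linarith)).trans ?_
    gcongr
    refine majorant_shift_le hε hd.le (by linarith) (by linarith) (by linarith)
      (hz.trans ?_) (y a)
    gcongr
    linarith
  · refine Integrable.const_mul ⟨?_, ?_⟩ _
    · refine AEStronglyMeasurable.mul ?_ hg.norm
      unfold K majorant
      exact Measurable.aestronglyMeasurable (by fun_prop)
    · refine (lintegral_congr_ae (hKpos.mono fun a ha => ?_)).trans_lt hfin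
      rw [enorm_mul, enorm_norm, Real.enorm_of_nonneg ha]
  · filter_upwards [hsη] with a ha
    have hcont := continuousAt_kernel hd (x₀ - y a) (show 0 < t₀ - s a by linarith)
    exact (hcont.comp (f := fun z : Space N × ℝ => (z.1 - y a, z.2 - s a)) (x := (x₀, t₀))
      (by fun_prop)).mul continuousAt_const

theorem KernelBound.continuousAt_linearPart (h : KernelBound N d ε c) (hd : 0 < d) (hε : 0 ≤ ε)
    (hφ : AEStronglyMeasurable φ) (ht₀ : 0 < t₀)
    (hfin : potential N d ε (fun y => ‖φ y‖ₑ) x₀ t₀ < ∞) :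
    ContinuousAt (fun z : Space N × ℝ => linearPart N d φ z.1 z.2) (x₀, t₀) := by
  have hcont := h.continuousAt_integral (t₀ := t₀) hd hε measurable_id measurable_const hφ ht₀
    (.of_forall fun _ => (sub_self t₀).ge) (x₀ := x₀)
  simp only [sub_zero, id] at hcont
  exact hcont hfin

theorem measurable_duhamelIntegrand (d : ℝ) (hf : Measurable fun z : Space N × ℝ => f z.1 z.2) :
    Measurable fun q : (Space N × ℝ) × (ℝ × Space N) =>
      duhamelIntegrand N d f q.1.1 q.1.2 q.2 :=
  (measurable_kernel_comp d (by fun_prop) (by fun_prop)).mul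
    (hf.comp (f := fun q : (Space N × ℝ) × (ℝ × Space N) => (q.2.2, q.2.1)) (by fun_prop))

theorem measurable_duhamelIntegrand_right (d : ℝ)
    (hf : Measurable fun z : Space N × ℝ => f z.1 z.2) (x : Space N) (t : ℝ) :
    Measurable (duhamelIntegrand N d f x t) :=
  (measurable_duhamelIntegrand d hf).comp (f := fun z => ((x, t), z)) (by fun_prop)

theorem volume_restrict_prod_univ (I : Set ℝ) :
    (volume : Measure (ℝ × Space N)).restrict (I ×ˢ univ) =
      ((volume : Measure ℝ).restrict I).prod volume := by
  rw [Measure.volume_eq_prod, ← Measure.prod_restrict, Measure.restrict_univ]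

theorem setLIntegral_potential_eq (hf : Measurable fun z : Space N × ℝ => f z.1 z.2) (I : Set ℝ)
    (x : Space N) (t : ℝ) :
    ∫⁻ s in I, potential N d ε (fun y => ‖f y s‖ₑ) x (t - s) =
      ∫⁻ z in I ×ˢ univ, ENNReal.ofReal (majorant N ε ((t - z.1) ^ (1 / d)) (x - z.2)) *
        ‖f z.2 z.1‖ₑ := by
  rw [volume_restrict_prod_univ, lintegral_prod _ (Measurable.aemeasurable ?_)]
  · rfl
  · exact (measurable_ofReal_majorant ε d (by fun_prop) (by fun_prop)).mul
      (hf.comp (f := fun z : ℝ × Space N => (z.2, z.1)) (by fun_prop)).enorm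

theorem KernelBound.lintegral_duhamelIntegrand_le (h : KernelBound N d ε c)
    (hf : Measurable fun z : Space N × ℝ => f z.1 z.2) (hI : MeasurableSet I) (hIt : I ⊆ Iio t)
    (x : Space N) :
    ∫⁻ z in I ×ˢ univ, ‖duhamelIntegrand N d f x t z‖ₑ ≤
      ENNReal.ofReal c * ∫⁻ s in I, potential N d ε (fun y => ‖f y s‖ₑ) x (t - s) := by
  rw [setLIntegral_potential_eq hf, ← lintegral_const_mul' _ _ ENNReal.ofReal_ne_top]
  refine setLIntegral_mono' (hI.prod MeasurableSet.univ) fun z hz => ?_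
  rw [duhamelIntegrand, enorm_mul, ← mul_assoc]
  gcongr
  exact h.enorm_kernel_le _ (sub_pos.2 (hIt hz.1))

theorem KernelBound.integrableOn_duhamelIntegrand (h : KernelBound N d ε c)
    (hf : Measurable fun z : Space N × ℝ => f z.1 z.2) (hI : MeasurableSet I) (hIt : I ⊆ Iio t)
    (hfin : ∫⁻ s in I, potential N d ε (fun y => ‖f y s‖ₑ) x (t - s) < ∞) :
    IntegrableOn (duhamelIntegrand N d f x t) (I ×ˢ univ) :=
  ⟨(measurable_duhamelIntegrand_right d hf x t).aestronglyMeasurable,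
    (h.lintegral_duhamelIntegrand_le hf hI hIt x).trans_lt
      (ENNReal.mul_lt_top ENNReal.ofReal_lt_top hfin)⟩

theorem abs_integral_le_of_lintegral_enorm_le {α : Type*} [MeasurableSpace α] {ν : Measure α}
    {g : α → ℝ} {R : ℝ} {L : ℝ≥0∞} (hc : 0 ≤ c) (hR : 0 ≤ R)
    (hg : ∫⁻ a, ‖g a‖ₑ ∂ν ≤ ENNReal.ofReal c * L) (hL : L ≤ ENNReal.ofReal R) :
    |∫ a, g a ∂ν| ≤ c * R := by
  rw [← ENNReal.ofReal_le_ofReal_iff (by positivity), ← Real.enorm_eq_ofReal_abs,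
    ENNReal.ofReal_mul hc]
  exact (enorm_integral_le_lintegral_enorm g).trans (hg.trans (mul_le_mul_right hL _))

theorem duhamel_eq_setIntegral
    (h : IntegrableOn (duhamelIntegrand N d f x t) (Ioo 0 t ×ˢ univ)) :
    duhamel N d f x t = ∫ z in Ioo 0 t ×ˢ univ, duhamelIntegrand N d f x t z := by
  rw [IntegrableOn, volume_restrict_prod_univ] at h
  rw [volume_restrict_prod_univ, integral_prod _ h, duhamel]

theorem measurable_duhamel (d : ℝ) (hf : Measurable fun z : Space N × ℝ => f z.1 z.2) :
    Measurable fun z : Space N × ℝ => duhamel N d f z.1 z.2 := by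
  have hinner : StronglyMeasurable fun q : (Space N × ℝ) × ℝ =>
      ∫ y, duhamelIntegrand N d f q.1.1 q.1.2 (q.2, y) := by
    refine StronglyMeasurable.integral_prod_right (Measurable.stronglyMeasurable ?_)
    exact (measurable_duhamelIntegrand d hf).comp
      (f := fun q : ((Space N × ℝ) × ℝ) × Space N => (q.1.1, (q.1.2, q.2))) (by fun_prop)
  have hset : MeasurableSet {q : (Space N × ℝ) × ℝ | q.2 ∈ Ioo 0 q.1.2} :=
    (measurableSet_lt measurable_const measurable_snd).inter
      (measurableSet_lt measurable_snd measurable_fst.snd)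
  simp_rw [duhamel, ← integral_indicator measurableSet_Ioo]
  exact (hinner.indicator hset).integral_prod_right'.measurable

theorem duhamel_sub_setIntegral {a : ℝ} (ha : 0 < a) (hat : a ≤ t)
    (h : IntegrableOn (duhamelIntegrand N d f x t) (Ioo 0 t ×ˢ univ)) :
    duhamel N d f x t - ∫ z in Ioo 0 a ×ˢ univ, duhamelIntegrand N d f x t z =
      ∫ z in Ico a t ×ˢ univ, duhamelIntegrand N d f x t z := by
  have hunion : (Ioo 0 t ×ˢ univ : Set (ℝ × Space N)) = (Ioo 0 a ×ˢ univ) ∪ (Ico a t ×ˢ univ) := by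
    rw [← union_prod, Ioo_union_Ico_eq_Ioo ha hat]
  have hdisj : Disjoint (Ioo 0 a ×ˢ univ : Set (ℝ × Space N)) (Ico a t ×ˢ univ) :=
    Disjoint.set_prod_left (disjoint_left.2 fun s hs hs' => (hs.2.trans_le hs'.1).false) _ _
  rw [duhamel_eq_setIntegral h, hunion,
    setIntegral_union hdisj (measurableSet_Ico.prod MeasurableSet.univ)
      (h.mono_set (hunion ▸ subset_union_left)) (h.mono_set (hunion ▸ subset_union_right)),
    add_sub_cancel_left]

theorem KernelBound.abs_setIntegral_duhamelIntegrand_le_of_abs_le (h : KernelBound N d ε c)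
    (hε : 0 < ε) (hf : Measurable fun z : Space N × ℝ => f z.1 z.2) {a M : ℝ} (hM0 : 0 ≤ M)
    (hat : a ≤ t) (hM : ∀ y, ∀ s ∈ Ico a t, |f y s| ≤ M) (x : Space N) :
    |∫ z in Ico a t ×ˢ univ, duhamelIntegrand N d f x t z| ≤
      c * (majorantMass N ε * M * (t - a)) := by
  have hmass := majorantMass_pos N hε
  refine abs_integral_le_of_lintegral_enorm_le h.nonneg
    (mul_nonneg (by positivity) (sub_nonneg.2 hat))
    (h.lintegral_duhamelIntegrand_le hf measurableSet_Ico (fun s hs => hs.2) x) ?_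
  calc ∫⁻ s in Ico a t, potential N d ε (fun y => ‖f y s‖ₑ) x (t - s)
      ≤ ∫⁻ _ in Ico a t, ENNReal.ofReal (majorantMass N ε * M) := by
        refine setLIntegral_mono' measurableSet_Ico fun s hs => ?_
        rw [← potential_const hε M x (sub_pos.2 hs.2)]
        refine potential_mono (fun y => ?_) x _
        rw [Real.enorm_eq_ofReal_abs]
        exact ENNReal.ofReal_le_ofReal (hM y s hs)
    _ = ENNReal.ofReal (majorantMass N ε * M * (t - a)) := by
        rw [setLIntegral_const, Real.volume_Ico, ← ENNReal.ofReal_mul (by positivity)]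

/-- The interval `(0, T)`, where `0 < T ≤ ∞`. -/
def times (T : ℝ≥0∞) : Set ℝ := {t | 0 < t ∧ ENNReal.ofReal t < T}

theorem isOpen_times (T : ℝ≥0∞) : IsOpen (times T) :=
  isOpen_Ioi.inter (isOpen_Iio.preimage ENNReal.continuous_ofReal)

theorem mem_times_of_mem_Ioo {T : ℝ≥0∞} (ht : t ∈ times T) {s : ℝ} (hs : s ∈ Ioo 0 t) :
    s ∈ times T :=
  ⟨hs.1, (ENNReal.ofReal_le_ofReal hs.2.le).trans_lt ht.2⟩

-- Near the singularity of the kernel the integral is uniformly small because the source is bounded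
-- there; the remaining part is continuous by domination.
theorem KernelBound.continuousAt_duhamel (h : KernelBound N d ε c) (hd : 0 < d) (hε : 0 < ε)
    (hf : Measurable fun z : Space N × ℝ => f z.1 z.2) {T : ℝ≥0∞} {τ M : ℝ} (hτ : 0 ≤ τ)
    (hτt : τ < t₀) (ht₀ : t₀ ∈ times T) (hM : ∀ y, ∀ s ∈ times T, τ < s → |f y s| ≤ M)
    (hfin : ∀ x, ∀ t ∈ times T,
      ∫⁻ s in Ioo 0 t, potential N d ε (fun y => ‖f y s‖ₑ) x (t - s) < ∞) (x₀ : Space N) :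
    ContinuousAt (fun z : Space N × ℝ => duhamel N d f z.1 z.2) (x₀, t₀) := by
  have hM0 : 0 ≤ M := (abs_nonneg _).trans (hM 0 t₀ ht₀ hτt)
  have hc := h.nonneg
  have hmass := majorantMass_pos N hε
  refine continuousAt_of_locally_uniform_approx_of_continuousAt fun V hV => ?_
  obtain ⟨e, he, heV⟩ := Metric.mem_uniformity_dist.1 hV
  obtain ⟨η, ⟨hηe, hητ⟩, hη⟩ : ∃ η : ℝ,
      (c * (majorantMass N ε * M * (2 * η)) < e ∧ η < t₀ - τ) ∧ 0 < η := by
    have hsmall : ∀ᶠ η : ℝ in nhds 0, c * (majorantMass N ε * M * (2 * η)) < e :=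
      ContinuousAt.eventually_lt (by fun_prop) continuousAt_const (by simpa using he)
    exact ((hsmall.and (gt_mem_nhds (sub_pos.2 hτt))).filter_mono nhdsWithin_le_nhds |>.and
      (self_mem_nhdsWithin (s := Ioi 0))).exists
  have hhead : ContinuousAt (fun z : Space N × ℝ =>
      ∫ q in Ioo 0 (t₀ - η) ×ˢ univ, duhamelIntegrand N d f z.1 z.2 q) (x₀, t₀) := by
    refine h.continuousAt_integral hd hε.le measurable_snd measurable_fst
      (hf.comp (f := fun q : ℝ × Space N => (q.2, q.1)) (by fun_prop)).aestronglyMeasurable hη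
      (ae_restrict_of_forall_mem (measurableSet_Ioo.prod MeasurableSet.univ)
        fun q hq => hq.1.2.le) ?_
    rw [← setLIntegral_potential_eq hf]
    exact (lintegral_mono_set (Ioo_subset_Ioo_right (by linarith))).trans_lt (hfin x₀ t₀ ht₀)
  refine ⟨{z | z.2 ∈ Ioo (t₀ - η) (t₀ + η) ∩ times T}, ?_, _, hhead, fun ⟨x, t⟩ ⟨ht, htT⟩ => ?_⟩
  · exact continuous_snd.continuousAt.eventually
      (Filter.inter_mem (Ioo_mem_nhds (by linarith) (by linarith)) ((isOpen_times T).mem_nhds ht₀))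
  · have hint := h.integrableOn_duhamelIntegrand hf measurableSet_Ioo (fun s hs => hs.2)
      (hfin x t htT)
    apply heV
    rw [dist_eq_norm, duhamel_sub_setIntegral (by linarith) ht.1.le hint]
    refine (h.abs_setIntegral_duhamelIntegrand_le_of_abs_le hε hf hM0 ht.1.le
      (fun y s hs => hM y s ?_ ?_) x).trans_lt (hηe.trans_le' ?_)
    · exact mem_times_of_mem_Ioo htT ⟨by linarith [hs.1], hs.2⟩
    · linarith [hs.1]
    · gcongr
      linarith [ht.2]

end Duhamel

/-! ### Existence below a supersolution of the majorant problem -/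

theorem abs_rpow_sub_rpow_le {p R a b : ℝ} (hp : 1 ≤ p) (ha : 0 ≤ a) (haR : a ≤ R) (hb : 0 ≤ b)
    (hbR : b ≤ R) : |a ^ p - b ^ p| ≤ p * R ^ (p - 1) * |a - b| := by
  refine (convex_Icc 0 R).norm_image_sub_le_of_norm_hasDerivWithin_le (f := fun x : ℝ => x ^ p)
    (f' := fun x => p * x ^ (p - 1))
    (fun x _ => (Real.hasDerivAt_rpow_const (Or.inr hp)).hasDerivWithinAt)
    (fun x hx => ?_) ⟨hb, hbR⟩ ⟨ha, haR⟩
  rw [Real.norm_of_nonneg (mul_nonneg (by linarith) (Real.rpow_nonneg hx.1 _))]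
  have hpow := Real.rpow_le_rpow hx.1 hx.2 (show 0 ≤ p - 1 by linarith)
  gcongr

theorem rpow_sub_one_mul_self {a p : ℝ} (ha : 0 ≤ a) (hp : p ≠ 0) : a ^ (p - 1) * a = a ^ p := by
  rw [← Real.rpow_add_one' ha (by rwa [sub_add_cancel]), sub_add_cancel]

/-- `W` dominates the linear part, and its own Duhamel integral with the factor `δ`; both are
computed with the majorant kernel in place of the fundamental solution. -/
structure IsBarrier (N : ℕ) (d p ε δ : ℝ) (φ : Space N → ℝ) (T : ℝ≥0∞)
    (W : Space N → ℝ → ℝ) : Prop where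
  measurable : Measurable fun z : Space N × ℝ => W z.1 z.2
  nonneg : ∀ x t, 0 ≤ W x t
  linear_le : ∀ x, ∀ t ∈ times T,
    potential N d ε (fun y => ‖φ y‖ₑ) x t ≤ ENNReal.ofReal (W x t)
  duhamel_le : ∀ x, ∀ t ∈ times T,
    ∫⁻ s in Ioo 0 t, potential N d ε (fun y => ENNReal.ofReal (W y s ^ p)) x (t - s) ≤
      ENNReal.ofReal (δ * W x t)
  bounded : ∀ τ : ℝ, 0 < τ → ∃ M : ℝ, ∀ x, ∀ t ∈ times T, τ < t → W x t ≤ M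

/-- `u` is measurable and `|u| ≤ B W` on `ℝ^N × (0, T)`. -/
structure IsDominated {N : ℕ} (T : ℝ≥0∞) (W : Space N → ℝ → ℝ) (B : ℝ)
    (u : Space N → ℝ → ℝ) : Prop where
  measurable : Measurable fun z : Space N × ℝ => u z.1 z.2
  abs_le : ∀ x, ∀ t ∈ times T, |u x t| ≤ B * W x t

/-- The Picard iterates of the integral equation. -/
def picard (N : ℕ) (d p : ℝ) (φ : Space N → ℝ) : ℕ → Space N → ℝ → ℝ
  | 0 => fun _ _ => 0
  | n + 1 => fun x t =>
    linearPart N d φ x t + duhamel N d (fun y s => |picard N d p φ n y s| ^ p) x t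

section Barrier

variable {N : ℕ} {d p ε δ c B k b : ℝ} {φ : Space N → ℝ} {T : ℝ≥0∞} {W u v f g : Space N → ℝ → ℝ}
  {x : Space N} {t : ℝ}

theorem IsDominated.abs_rpow (hu : IsDominated T W B u) (hW : ∀ x t, 0 ≤ W x t) (hB : 0 ≤ B)
    (hp : 0 ≤ p) :
    IsDominated T (fun y s => W y s ^ p) (B ^ p) (fun y s => |u y s| ^ p) where
  measurable := (measurable_norm.comp hu.measurable).pow_const p
  abs_le x t ht := by
    rw [abs_of_nonneg (by positivity), ← Real.mul_rpow hB (hW x t)]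
    exact Real.rpow_le_rpow (abs_nonneg _) (hu.abs_le x t ht) hp

theorem IsDominated.abs_rpow_sub_abs_rpow (hu : IsDominated T W B u) (hv : IsDominated T W B v)
    (huv : IsDominated T W k (fun y s => u y s - v y s)) (hW : ∀ x t, 0 ≤ W x t) (hB : 0 ≤ B)
    (hp : 1 ≤ p) :
    IsDominated T (fun y s => W y s ^ p) (p * B ^ (p - 1) * k)
      (fun y s => |u y s| ^ p - |v y s| ^ p) where
  measurable := (hu.abs_rpow hW hB (by linarith)).measurable.sub
    (hv.abs_rpow hW hB (by linarith)).measurable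
  abs_le x t ht := by
    have hw := hW x t
    calc |(|u x t| ^ p - |v x t| ^ p)|
        ≤ p * (B * W x t) ^ (p - 1) * |(|u x t| - |v x t|)| :=
          abs_rpow_sub_rpow_le hp (abs_nonneg _) (hu.abs_le x t ht) (abs_nonneg _)
            (hv.abs_le x t ht)
      _ ≤ p * (B * W x t) ^ (p - 1) * (k * W x t) := by
          gcongr
          exact (abs_abs_sub_abs_le _ _).trans (huv.abs_le x t ht)
      _ = p * B ^ (p - 1) * k * (W x t ^ (p - 1) * W x t) := by rw [Real.mul_rpow hB hw]; ring
      _ = p * B ^ (p - 1) * k * W x t ^ p := by rw [rpow_sub_one_mul_self hw (by linarith)]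

theorem IsBarrier.potential_lt_top (hW : IsBarrier N d p ε δ φ T W) (x : Space N)
    (ht : t ∈ times T) : potential N d ε (fun y => ‖φ y‖ₑ) x t < ∞ :=
  (hW.linear_le x t ht).trans_lt ENNReal.ofReal_lt_top

theorem IsBarrier.abs_linearPart_le (hW : IsBarrier N d p ε δ φ T W) (hK : KernelBound N d ε c)
    (x : Space N) (ht : t ∈ times T) : |linearPart N d φ x t| ≤ c * W x t :=
  abs_integral_le_of_lintegral_enorm_le hK.nonneg (hW.nonneg x t)
    (hK.lintegral_kernel_mul_le φ x ht.1) (hW.linear_le x t ht)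

theorem IsBarrier.lintegral_source_le (hW : IsBarrier N d p ε δ φ T W) (hb : 0 ≤ b)
    (hf : IsDominated T (fun y s => W y s ^ p) b f) (x : Space N) (ht : t ∈ times T) :
    ∫⁻ s in Ioo 0 t, potential N d ε (fun y => ‖f y s‖ₑ) x (t - s) ≤
      ENNReal.ofReal (b * (δ * W x t)) := by
  calc ∫⁻ s in Ioo 0 t, potential N d ε (fun y => ‖f y s‖ₑ) x (t - s)
      ≤ ∫⁻ s in Ioo 0 t,
          ENNReal.ofReal b * potential N d ε (fun y => ENNReal.ofReal (W y s ^ p)) x (t - s) := by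
        refine setLIntegral_mono' measurableSet_Ioo fun s hs => ?_
        rw [← potential_ofReal_mul]
        refine potential_mono (fun y => ?_) x _
        rw [← ENNReal.ofReal_mul hb, Real.enorm_eq_ofReal_abs]
        exact ENNReal.ofReal_le_ofReal (hf.abs_le y s (mem_times_of_mem_Ioo ht hs))
    _ ≤ ENNReal.ofReal (b * (δ * W x t)) := by
        rw [lintegral_const_mul' _ _ ENNReal.ofReal_ne_top, ENNReal.ofReal_mul hb]
        gcongr
        exact hW.duhamel_le x t ht

theorem IsBarrier.integrableOn_source (hW : IsBarrier N d p ε δ φ T W) (hK : KernelBound N d ε c)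
    (hb : 0 ≤ b) (hf : IsDominated T (fun y s => W y s ^ p) b f) (x : Space N)
    (ht : t ∈ times T) : IntegrableOn (duhamelIntegrand N d f x t) (Ioo 0 t ×ˢ univ) :=
  hK.integrableOn_duhamelIntegrand hf.measurable measurableSet_Ioo (fun _ hs => hs.2)
    ((hW.lintegral_source_le hb hf x ht).trans_lt ENNReal.ofReal_lt_top)

theorem IsBarrier.abs_duhamel_le (hW : IsBarrier N d p ε δ φ T W) (hδ : 0 ≤ δ)
    (hK : KernelBound N d ε c) (hb : 0 ≤ b) (hf : IsDominated T (fun y s => W y s ^ p) b f)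
    (x : Space N) (ht : t ∈ times T) : |duhamel N d f x t| ≤ c * (b * (δ * W x t)) := by
  have := hW.nonneg x t
  rw [duhamel_eq_setIntegral (hW.integrableOn_source hK hb hf x ht)]
  exact abs_integral_le_of_lintegral_enorm_le hK.nonneg (by positivity)
    (hK.lintegral_duhamelIntegrand_le hf.measurable measurableSet_Ioo (fun _ hs => hs.2) x)
    (hW.lintegral_source_le hb hf x ht)

theorem duhamel_sub (hf : IntegrableOn (duhamelIntegrand N d f x t) (Ioo 0 t ×ˢ univ))
    (hg : IntegrableOn (duhamelIntegrand N d g x t) (Ioo 0 t ×ˢ univ)) :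
    duhamel N d (fun y s => f y s - g y s) x t = duhamel N d f x t - duhamel N d g x t := by
  have hsub : duhamelIntegrand N d (fun y s => f y s - g y s) x t =
      duhamelIntegrand N d f x t - duhamelIntegrand N d g x t :=
    funext fun z => mul_sub _ _ _
  rw [duhamel_eq_setIntegral hf, duhamel_eq_setIntegral hg,
    duhamel_eq_setIntegral (hsub ▸ hf.sub hg), hsub]
  exact integral_sub hf hg

theorem IsBarrier.abs_duhamel_sub_le (hW : IsBarrier N d p ε δ φ T W) (hδ : 0 ≤ δ) (hp : 1 ≤ p)
    (hδc : p * (2 * c) ^ p * δ ≤ 1) (hK : KernelBound N d ε c) (hk : 0 ≤ k)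
    (hu : IsDominated T W (2 * c) u) (hv : IsDominated T W (2 * c) v)
    (huv : IsDominated T W k (fun y s => u y s - v y s)) (x : Space N) (ht : t ∈ times T) :
    |duhamel N d (fun y s => |u y s| ^ p) x t - duhamel N d (fun y s => |v y s| ^ p) x t| ≤
      k / 2 * W x t := by
  have hc := hK.nonneg
  have hw := hW.nonneg x t
  have hsource {u : Space N → ℝ → ℝ} (hu : IsDominated T W (2 * c) u) :
      IntegrableOn (duhamelIntegrand N d (fun y s => |u y s| ^ p) x t) (Ioo 0 t ×ˢ univ) :=
    hW.integrableOn_source hK (by positivity)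
      (hu.abs_rpow hW.nonneg (by positivity) (by linarith)) x ht
  rw [← duhamel_sub (hsource hu) (hsource hv)]
  calc |duhamel N d (fun y s => |u y s| ^ p - |v y s| ^ p) x t|
      ≤ c * (p * (2 * c) ^ (p - 1) * k * (δ * W x t)) :=
        hW.abs_duhamel_le hδ hK (by positivity)
          (hu.abs_rpow_sub_abs_rpow hv huv hW.nonneg (by positivity) hp) x ht
    _ = p * ((2 * c) ^ (p - 1) * (2 * c)) * δ * (k / 2 * W x t) := by ring
    _ = p * (2 * c) ^ p * δ * (k / 2 * W x t) := by
        rw [rpow_sub_one_mul_self (by positivity) (by linarith)]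
    _ ≤ k / 2 * W x t := mul_le_of_le_one_left (by positivity) hδc

theorem measurable_picard (hφ : AEStronglyMeasurable φ) (n : ℕ) :
    Measurable fun z : Space N × ℝ => picard N d p φ n z.1 z.2 := by
  induction n with
  | zero => exact measurable_const
  | succ n ih =>
    exact (measurable_linearPart hφ d).add
      (measurable_duhamel d ((measurable_norm.comp ih).pow_const p))

theorem IsBarrier.isDominated_picard (hW : IsBarrier N d p ε δ φ T W)
    (hφ : AEStronglyMeasurable φ) (hδ : 0 ≤ δ) (hp : 1 ≤ p) (hδc : p * (2 * c) ^ p * δ ≤ 1)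
    (hK : KernelBound N d ε c) (n : ℕ) : IsDominated T W (2 * c) (picard N d p φ n) := by
  have hc := hK.nonneg
  refine ⟨measurable_picard hφ n, ?_⟩
  induction n with
  | zero =>
    intro x t _
    have := hW.nonneg x t
    simp only [picard, abs_zero]
    positivity
  | succ n ih =>
    intro x t ht
    have hw := hW.nonneg x t
    have hδc' : (2 * c) ^ p * δ ≤ 1 := by
      refine le_trans (mul_le_mul_of_nonneg_right ?_ hδ) hδc
      exact le_mul_of_one_le_left (by positivity) hp
    have hduhamel : |duhamel N d (fun y s => |picard N d p φ n y s| ^ p) x t| ≤ c * W x t := by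
      refine (hW.abs_duhamel_le hδ hK (by positivity) (IsDominated.abs_rpow
        ⟨measurable_picard hφ n, ih⟩ hW.nonneg (by positivity) (by linarith)) x ht).trans ?_
      rw [← mul_assoc ((2 * c) ^ p)]
      gcongr
      exact mul_le_of_le_one_left hw hδc'
    calc |picard N d p φ (n + 1) x t| ≤ c * W x t + c * W x t :=
          (abs_add_le _ _).trans (add_le_add (hW.abs_linearPart_le hK x ht) hduhamel)
      _ = 2 * c * W x t := by ring

theorem IsBarrier.isDominated_picard_sub (hW : IsBarrier N d p ε δ φ T W)
    (hφ : AEStronglyMeasurable φ) (hδ : 0 ≤ δ) (hp : 1 ≤ p) (hδc : p * (2 * c) ^ p * δ ≤ 1)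
    (hK : KernelBound N d ε c) (n : ℕ) :
    IsDominated T W (c / 2 ^ n)
      (fun x t => picard N d p φ n x t - picard N d p φ (n + 1) x t) := by
  have hc := hK.nonneg
  have hmeas (n : ℕ) := measurable_picard (d := d) (p := p) hφ n
  have hdom := hW.isDominated_picard hφ hδ hp hδc hK
  refine ⟨(hmeas n).sub (hmeas (n + 1)), ?_⟩
  induction n with
  | zero =>
    intro x t ht
    have hzero : duhamel N d (fun _ _ => |(0 : ℝ)| ^ p) x t = 0 := by
      simp [duhamel, duhamelIntegrand, Real.zero_rpow (show p ≠ 0 by linarith)]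
    simp only [picard, hzero, add_zero, zero_sub, abs_neg, pow_zero, div_one]
    exact hW.abs_linearPart_le hK x ht
  | succ n ih =>
    intro x t ht
    rw [picard, picard, add_sub_add_left_eq_sub, pow_succ, ← div_div]
    exact hW.abs_duhamel_sub_le hδ hp hδc hK (by positivity) (hdom n) (hdom (n + 1))
      ⟨(hmeas n).sub (hmeas (n + 1)), ih⟩ x ht

theorem IsBarrier.exists_picard_limit (hW : IsBarrier N d p ε δ φ T W)
    (hφ : AEStronglyMeasurable φ) (hδ : 0 ≤ δ) (hp : 1 ≤ p) (hδc : p * (2 * c) ^ p * δ ≤ 1)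
    (hK : KernelBound N d ε c) :
    ∃ u, IsDominated T W (2 * c) u ∧
      ∀ n, IsDominated T W (2 * c / 2 ^ n) (fun x t => u x t - picard N d p φ n x t) := by
  set u : Space N → ℝ → ℝ := fun x t => Filter.atTop.limUnder fun n => picard N d p φ n x t
  have hdist (x : Space N) {t : ℝ} (ht : t ∈ times T) (n : ℕ) :
      dist (picard N d p φ n x t) (picard N d p φ (n + 1) x t) ≤ 2 * c * W x t / 2 / 2 ^ n :=
    ((hW.isDominated_picard_sub hφ hδ hp hδc hK n).abs_le x t ht).trans_eq (by ring)
  have hlim (x : Space N) {t : ℝ} (ht : t ∈ times T) :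
      Filter.Tendsto (fun n => picard N d p φ n x t) Filter.atTop (nhds (u x t)) :=
    (cauchySeq_of_le_geometric_two (hdist x ht)).tendsto_limUnder
  have hu : Measurable fun z : Space N × ℝ => u z.1 z.2 :=
    (StronglyMeasurable.limUnder fun n => (measurable_picard hφ n).stronglyMeasurable).measurable
  refine ⟨u, ⟨hu, fun x t ht => ?_⟩, fun n => ⟨hu.sub (measurable_picard hφ n), fun x t ht => ?_⟩⟩
  · exact le_of_tendsto' (hlim x ht).abs fun n =>
      (hW.isDominated_picard hφ hδ hp hδc hK n).abs_le x t ht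
  · rw [← Real.dist_eq, dist_comm, div_mul_eq_mul_div]
    exact dist_le_of_le_geometric_two_of_tendsto (hdist x ht) (hlim x ht) n

theorem IsBarrier.eq_linearPart_add_duhamel (hW : IsBarrier N d p ε δ φ T W)
    (hφ : AEStronglyMeasurable φ) (hδ : 0 ≤ δ) (hp : 1 ≤ p) (hδc : p * (2 * c) ^ p * δ ≤ 1)
    (hK : KernelBound N d ε c) (hu : IsDominated T W (2 * c) u)
    (hlim : ∀ n, IsDominated T W (2 * c / 2 ^ n) (fun x t => u x t - picard N d p φ n x t))
    (x : Space N) (ht : t ∈ times T) :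
    u x t = linearPart N d φ x t + duhamel N d (fun y s => |u y s| ^ p) x t := by
  have hbound (n : ℕ) : |u x t - (linearPart N d φ x t + duhamel N d (fun y s => |u y s| ^ p) x t)|
      ≤ 2 * c * W x t / 2 ^ n := by
    have hc := hK.nonneg
    have hnext := (hlim (n + 1)).abs_le x t ht
    have hpicard := hW.abs_duhamel_sub_le hδ hp hδc hK (by positivity) hu
      (hW.isDominated_picard hφ hδ hp hδc hK n) (hlim n) x ht
    rw [abs_sub_comm] at hpicard
    calc |u x t - (linearPart N d φ x t + duhamel N d (fun y s => |u y s| ^ p) x t)|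
        ≤ |u x t - picard N d p φ (n + 1) x t| +
          |picard N d p φ (n + 1) x t -
            (linearPart N d φ x t + duhamel N d (fun y s => |u y s| ^ p) x t)| :=
          abs_sub_le _ _ _
      _ ≤ 2 * c / 2 ^ (n + 1) * W x t + 2 * c / 2 ^ n / 2 * W x t := by
          refine add_le_add hnext ?_
          rwa [picard, add_sub_add_left_eq_sub]
      _ = 2 * c * W x t / 2 ^ n := by rw [pow_succ]; ring
  have hzero : Filter.Tendsto (fun n : ℕ => 2 * c * W x t / 2 ^ n) Filter.atTop (nhds 0) :=
    tendsto_const_nhds.div_atTop (tendsto_pow_atTop_atTop_of_one_lt one_lt_two)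
  exact sub_eq_zero.1 (abs_nonpos_iff.1 (ge_of_tendsto' hzero hbound))

theorem IsBarrier.continuousAt_of_eq (hW : IsBarrier N d p ε δ φ T W) (hd : 0 < d) (hε : 0 < ε)
    (hp : 0 ≤ p) (hφ : AEStronglyMeasurable φ) (hK : KernelBound N d ε c) (hB : 0 ≤ B)
    (hu : IsDominated T W B u)
    (heq : ∀ x, ∀ t ∈ times T,
      u x t = linearPart N d φ x t + duhamel N d (fun y s => |u y s| ^ p) x t)
    (x : Space N) (ht : t ∈ times T) :
    ContinuousAt (fun z : Space N × ℝ => u z.1 z.2) (x, t) := by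
  have hsource := hu.abs_rpow hW.nonneg hB hp
  obtain ⟨M, hM⟩ := hW.bounded (t / 2) (half_pos ht.1)
  have hlinear := hK.continuousAt_linearPart hd hε.le hφ ht.1 (hW.potential_lt_top x ht)
  have hduhamel := hK.continuousAt_duhamel hd hε hsource.measurable (half_pos ht.1).le
    (half_lt_self ht.1) ht (M := B ^ p * M ^ p)
    (fun y s hs hts => (hsource.abs_le y s hs).trans <| mul_le_mul_of_nonneg_left
      (Real.rpow_le_rpow (hW.nonneg y s) (hM y s hs hts) hp) (by positivity))
    (fun x t ht => (hW.lintegral_source_le (by positivity) hsource x ht).trans_lt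
      ENNReal.ofReal_lt_top) x
  have htimes : ∀ᶠ z : Space N × ℝ in nhds (x, t), z.2 ∈ times T :=
    continuous_snd.continuousAt.eventually ((isOpen_times T).mem_nhds ht)
  exact (hlinear.add hduhamel).congr (htimes.mono fun z hz => (heq z.1 z.2 hz).symm)

theorem IsBarrier.isSolution (hW : IsBarrier N d p ε δ φ T W) (hd : 0 < d) (hε : 0 < ε)
    (hp : 0 ≤ p) (hφ : AEStronglyMeasurable φ) (hK : KernelBound N d ε c) (hB : 0 ≤ B)
    (hu : IsDominated T W B u)
    (heq : ∀ x, ∀ t ∈ times T,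
      u x t = linearPart N d φ x t + duhamel N d (fun y s => |u y s| ^ p) x t) :
    IsSolution N d p φ T u where
  continuousOn τ hτ := fun ⟨x, _⟩ ht =>
    (hW.continuousAt_of_eq hd hε hp hφ hK hB hu heq x
      ⟨hτ.trans ht.1, ht.2⟩).continuousWithinAt
  bounded τ hτ := by
    obtain ⟨M, hM⟩ := hW.bounded τ hτ
    refine ⟨B * M, fun x t ht htT => ?_⟩
    have ht' : t ∈ times T := ⟨hτ.trans ht, htT⟩
    exact (hu.abs_le x t ht').trans (mul_le_mul_of_nonneg_left (hM x t ht' ht) hB)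
  integrable_initial x t ht htT :=
    hK.integrable_kernel_mul hφ ht (hW.potential_lt_top x ⟨ht, htT⟩)
  integrable_duhamel x t ht htT :=
    hW.integrableOn_source hK (by positivity) (hu.abs_rpow hW.nonneg hB hp) x ⟨ht, htT⟩
  integral_eq x t ht htT := heq x t ⟨ht, htT⟩

end Barrier

theorem exists_solution_of_isBarrier (N : ℕ) {d p ε : ℝ} (hp : 1 ≤ p) (hε : 0 < ε)
    (hεd : ε ≤ d) (hε1 : ε < 1) :
    ∃ δ : ℝ, 0 < δ ∧ ∃ A : ℝ, 0 < A ∧ ∀ (φ : Space N → ℝ) (T : ℝ≥0∞) (W : Space N → ℝ → ℝ),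
      AEStronglyMeasurable φ → IsBarrier N d p ε δ φ T W →
      ∃ u : Space N → ℝ → ℝ, IsSolution N d p φ T u ∧
        ∀ x, ∀ t ∈ times T, |u x t| ≤ A * W x t := by
  obtain ⟨c, hc1, hK⟩ := exists_abs_kernel_le N hε hεd hε1
  have : 0 < c := by linarith
  set δ : ℝ := (p * (2 * c) ^ p)⁻¹
  have hδ : 0 < δ := by positivity
  have hδc : p * (2 * c) ^ p * δ ≤ 1 := mul_inv_le_one
  refine ⟨δ, hδ, 2 * c, by positivity, fun φ T W hφ hW => ?_⟩
  obtain ⟨u, hu, hlim⟩ := hW.exists_picard_limit hφ hδ.le hp hδc hK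
  exact ⟨u, hW.isSolution (hε.trans_le hεd) hε (by linarith) hφ hK (by positivity) hu
    fun x t => hW.eq_linearPart_add_duhamel hφ hδ.le hp hδc hK hu hlim x, hu.abs_le⟩

/-! ### Barriers from weighted averages of the initial function -/

theorem measurable_comp_max {h : ℝ → ℝ} (hh : MonotoneOn h (Ici 0)) :
    Measurable fun y => h (max y 0) :=
  Monotone.measurable fun _ _ hab =>
    hh (mem_Ici.2 (le_max_right _ _)) (mem_Ici.2 (le_max_right _ _)) (max_le_max_right 0 hab)

/-- `s ↦ s h(s)` is a gauge on `[0,∞)` with `h` nondecreasing, and `g` is its inverse. -/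
structure IsGauge (h g : ℝ → ℝ) : Prop where
  mono : MonotoneOn h (Ici 0)
  pos : ∀ s, 0 < s → 0 < h s
  inv_mono : MonotoneOn g (Ici 0)
  inv_nonneg : ∀ y, 0 ≤ y → 0 ≤ g y
  inv_mul_eq : ∀ y, 0 ≤ y → g y * h (g y) = y

/-- The gauge of `θ |φ|`, whose averages over balls measure the size of the initial function. -/
def gaugeDensity {N : ℕ} (h : ℝ → ℝ) (θ : ℝ) (φ : Space N → ℝ) (y : Space N) : ℝ≥0∞ :=
  ENNReal.ofReal (θ * |φ y| * h (θ * |φ y|))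

/-- The inverse gauge of the potential of `gaugeDensity`; its multiples are the barriers. -/
def gaugePotential {N : ℕ} (d ε : ℝ) (h g : ℝ → ℝ) (θ : ℝ) (φ : Space N → ℝ) (x : Space N)
    (t : ℝ) : ℝ :=
  g (potential N d ε (gaugeDensity h θ φ) x t).toReal

/-- At every time `t` the averages of the gauge of `θ |φ|` over balls of radius `t^{1/d}` are
controlled by the gauge of `κ(t)`, and `m` is a weight against which `v^{p-1}` is controlled by
`h(v)` as long as `v ≤ κ(t)`. -/
structure GaugeControl (N : ℕ) (d p ε δ : ℝ) (h : ℝ → ℝ) (θ : ℝ) (φ : Space N → ℝ) (T : ℝ≥0∞)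
    (κ m : ℝ → ℝ) : Prop where
  pos : ∀ t ∈ times T, 0 < κ t
  bounded : ∀ τ : ℝ, 0 < τ → ∃ M, ∀ t ∈ times T, τ < t → κ t ≤ M
  lintegral_ball_le : ∀ t ∈ times T, ∀ z : Space N,
    ∫⁻ y in ball z (t ^ (1 / d)), gaugeDensity h θ φ y ≤
      ENNReal.ofReal (t ^ ((N : ℝ) / d) * (κ t * h (κ t)) / ballConst N ε)
  rpow_le : ∀ t ∈ times T, ∀ v, 0 < v → v ≤ κ t → v ^ (p - 1) ≤ m t * h v
  lintegral_weight_le : ∀ t ∈ times T,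
    ENNReal.ofReal (h (κ t)) * ∫⁻ s in Ioo 0 t, ENNReal.ofReal (m s) ≤
      ENNReal.ofReal (δ * θ ^ (p - 1))

section Gauge

variable {N : ℕ} {d p ε δ θ k : ℝ} {h g κ m : ℝ → ℝ} {φ : Space N → ℝ} {T : ℝ≥0∞} {x : Space N}
  {s t v V : ℝ}

theorem IsGauge.mul_nonneg (G : IsGauge h g) (hs : 0 ≤ s) : 0 ≤ s * h s := by
  rcases hs.eq_or_lt with rfl | hs
  · rw [zero_mul]
  · exact (mul_pos hs (G.pos s hs)).le

theorem IsGauge.mul_le_mul (G : IsGauge h g) (hs : 0 ≤ s) (hv : 0 < v) (hsv : s ≤ v) :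
    s * h s ≤ v * h v :=
  (mul_le_mul_of_nonneg_left (G.mono hs hv.le hsv) hs).trans
    (mul_le_mul_of_nonneg_right hsv (G.pos v hv).le)

theorem IsGauge.le_of_mul_le_mul (G : IsGauge h g) (hv : 0 < v) (hle : s * h s ≤ v * h v) :
    s ≤ v := by
  by_contra! hlt
  have hmono : h v ≤ h s := G.mono hv.le (hv.trans hlt).le hlt.le
  have hpos := G.pos v hv
  nlinarith

theorem IsGauge.le_add_mul_div (G : IsGauge h g) (hs : 0 ≤ s) (hv : 0 < v) :
    s ≤ v + s * h s / h v := by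
  have hhv := G.pos v hv
  rcases le_total s v with hle | hle
  · have := G.mul_nonneg hs
    exact hle.trans (le_add_of_nonneg_right (by positivity))
  · refine le_trans ?_ (le_add_of_nonneg_left hv.le)
    rw [le_div_iff₀ hhv]
    exact mul_le_mul_of_nonneg_left (G.mono hv.le hs hle) hs

theorem IsGauge.aemeasurable_gaugeDensity (G : IsGauge h g) (hθ : 0 ≤ θ)
    (hφ : AEStronglyMeasurable φ) : AEMeasurable (gaugeDensity h θ φ) := by
  have hθφ : AEMeasurable fun y => θ * |φ y| := hφ.norm.aemeasurable.const_mul θ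
  have hmax (y : Space N) : max (θ * |φ y|) 0 = θ * |φ y| := max_eq_left (by positivity)
  have hcomp := (measurable_comp_max G.mono).comp_aemeasurable hθφ
  simp only [Function.comp_def, hmax] at hcomp
  exact (hθφ.mul hcomp).ennreal_ofReal

theorem IsGauge.measurable_gaugePotential (G : IsGauge h g) (hθ : 0 ≤ θ)
    (hφ : AEStronglyMeasurable φ) :
    Measurable fun z : Space N × ℝ => gaugePotential d ε h g θ φ z.1 z.2 := by
  have hcomp := (measurable_comp_max G.inv_mono).comp
    (measurable_potential (d := d) (ε := ε) (G.aemeasurable_gaugeDensity hθ hφ)).ennreal_toReal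
  simpa only [Function.comp_def, gaugePotential, max_eq_left ENNReal.toReal_nonneg] using hcomp

theorem IsGauge.gaugePotential_nonneg (G : IsGauge h g) (x : Space N) (t : ℝ) :
    0 ≤ gaugePotential d ε h g θ φ x t :=
  G.inv_nonneg _ ENNReal.toReal_nonneg

theorem IsGauge.enorm_le (G : IsGauge h g) (hθ : 0 < θ) (hv : 0 < v) (y : Space N) :
    ‖φ y‖ₑ ≤ ENNReal.ofReal (v / θ) +
      ENNReal.ofReal (1 / (θ * h v)) * gaugeDensity h θ φ y := by
  have hhv := G.pos v hv
  have hgauge := G.mul_nonneg (s := θ * |φ y|) (by positivity)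
  rw [gaugeDensity, ← ENNReal.ofReal_mul (by positivity),
    ← ENNReal.ofReal_add (by positivity) (by positivity), Real.enorm_eq_ofReal_abs]
  refine ENNReal.ofReal_le_ofReal ?_
  calc |φ y| = θ * |φ y| / θ := by field_simp
    _ ≤ (v + θ * |φ y| * h (θ * |φ y|) / h v) / θ := by
        gcongr
        exact G.le_add_mul_div (by positivity) hv
    _ = v / θ + 1 / (θ * h v) * (θ * |φ y| * h (θ * |φ y|)) := by field_simp

theorem IsGauge.potential_enorm_le_of_lt (G : IsGauge h g) (hε : 0 < ε) (hθ : 0 < θ) (ht : 0 < t)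
    (hV : 0 ≤ V) (hF : potential N d ε (gaugeDensity h θ φ) x t ≤ ENNReal.ofReal (V * h V))
    (hVv : V < v) :
    potential N d ε (fun y => ‖φ y‖ₑ) x t ≤ ENNReal.ofReal ((majorantMass N ε + 1) / θ * v) := by
  have hv : 0 < v := hV.trans_lt hVv
  have hhv := G.pos v hv
  have hmass := majorantMass_pos N hε
  calc potential N d ε (fun y => ‖φ y‖ₑ) x t
      ≤ potential N d ε (fun y => ENNReal.ofReal (v / θ) +
          ENNReal.ofReal (1 / (θ * h v)) * gaugeDensity h θ φ y) x t :=
        potential_mono (G.enorm_le hθ hv) x t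
    _ = potential N d ε (fun _ => ENNReal.ofReal (v / θ)) x t +
          ENNReal.ofReal (1 / (θ * h v)) * potential N d ε (gaugeDensity h θ φ) x t := by
        rw [← potential_ofReal_mul]
        simp_rw [potential, mul_add]
        exact lintegral_add_left
          ((measurable_ofReal_majorant ε d measurable_const (by fun_prop)).mul_const _) _
    _ ≤ ENNReal.ofReal (majorantMass N ε * (v / θ)) +
          ENNReal.ofReal (1 / (θ * h v)) * ENNReal.ofReal (v * h v) := by
        rw [potential_const hε _ x ht]
        gcongr
        exact hF.trans (ENNReal.ofReal_le_ofReal (G.mul_le_mul hV hv hVv.le))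
    _ = ENNReal.ofReal ((majorantMass N ε + 1) / θ * v) := by
        rw [← ENNReal.ofReal_mul (by positivity),
          ← ENNReal.ofReal_add (by positivity) (by positivity)]
        congr 1
        field_simp

theorem IsGauge.potential_enorm_le (G : IsGauge h g) (hε : 0 < ε) (hθ : 0 < θ) (ht : 0 < t)
    (hV : 0 ≤ V) (hF : potential N d ε (gaugeDensity h θ φ) x t ≤ ENNReal.ofReal (V * h V)) :
    potential N d ε (fun y => ‖φ y‖ₑ) x t ≤ ENNReal.ofReal ((majorantMass N ε + 1) / θ * V) := by
  have hcont : Continuous fun v => ENNReal.ofReal ((majorantMass N ε + 1) / θ * v) :=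
    ENNReal.continuous_ofReal.comp (by fun_prop)
  exact ge_of_tendsto ((hcont.tendsto V).mono_left (nhdsWithin_le_nhds (s := Ioi V)))
    (eventually_mem_nhdsWithin.mono fun v hv => G.potential_enorm_le_of_lt hε hθ ht hV hF hv)

theorem GaugeControl.potential_le (H : GaugeControl N d p ε δ h θ φ T κ m) (G : IsGauge h g)
    (hε : 0 < ε) (hθ : 0 ≤ θ) (hφ : AEStronglyMeasurable φ) (x : Space N) (ht : t ∈ times T) :
    potential N d ε (gaugeDensity h θ φ) x t ≤ ENNReal.ofReal (κ t * h (κ t)) := by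
  have hC := ballConst_pos N hε
  have htpos : 0 < t ^ ((N : ℝ) / d) := Real.rpow_pos_of_pos ht.1 _
  have hball := potential_le_of_lintegral_ball_le d hε (G.aemeasurable_gaugeDensity hθ hφ) ht.1
    (H.lintegral_ball_le t ht) x
  rw [← ENNReal.ofReal_mul hC.le, mul_div_cancel₀ _ hC.ne', ENNReal.ofReal_mul htpos.le] at hball
  exact (ENNReal.mul_le_mul_iff_right (ENNReal.ofReal_pos.2 htpos).ne'
    ENNReal.ofReal_ne_top).1 hball

theorem GaugeControl.potential_eq (H : GaugeControl N d p ε δ h θ φ T κ m) (G : IsGauge h g)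
    (hε : 0 < ε) (hθ : 0 ≤ θ) (hφ : AEStronglyMeasurable φ) (x : Space N) (ht : t ∈ times T) :
    potential N d ε (gaugeDensity h θ φ) x t =
      ENNReal.ofReal (gaugePotential d ε h g θ φ x t * h (gaugePotential d ε h g θ φ x t)) := by
  rw [gaugePotential, G.inv_mul_eq _ ENNReal.toReal_nonneg, ENNReal.ofReal_toReal
    ((H.potential_le G hε hθ hφ x ht).trans_lt ENNReal.ofReal_lt_top).ne]

theorem GaugeControl.gaugePotential_le (H : GaugeControl N d p ε δ h θ φ T κ m)
    (G : IsGauge h g) (hε : 0 < ε) (hθ : 0 ≤ θ) (hφ : AEStronglyMeasurable φ) (x : Space N)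
    (ht : t ∈ times T) : gaugePotential d ε h g θ φ x t ≤ κ t := by
  have hκ := H.pos t ht
  have hle := H.potential_le G hε hθ hφ x ht
  rw [H.potential_eq G hε hθ hφ x ht,
    ENNReal.ofReal_le_ofReal_iff (G.mul_nonneg hκ.le)] at hle
  exact G.le_of_mul_le_mul hκ hle

theorem GaugeControl.gaugePotential_rpow_le (H : GaugeControl N d p ε δ h θ φ T κ m)
    (G : IsGauge h g) (hε : 0 < ε) (hθ : 0 ≤ θ) (hp : 0 < p) (hφ : AEStronglyMeasurable φ)
    (x : Space N) (ht : t ∈ times T) :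
    ENNReal.ofReal (gaugePotential d ε h g θ φ x t ^ p) ≤
      ENNReal.ofReal (m t) * potential N d ε (gaugeDensity h θ φ) x t := by
  have hV := G.gaugePotential_nonneg (d := d) (ε := ε) (θ := θ) (φ := φ) x t
  have hVκ := H.gaugePotential_le G hε hθ hφ x ht
  rw [H.potential_eq G hε hθ hφ x ht]
  set V := gaugePotential d ε h g θ φ x t
  rcases hV.eq_or_lt with hzero | hpos
  · rw [← hzero, Real.zero_rpow hp.ne', ENNReal.ofReal_zero]
    exact zero_le
  · rw [← ENNReal.ofReal_mul' (G.mul_nonneg hV)]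
    refine ENNReal.ofReal_le_ofReal ?_
    calc V ^ p = V ^ (p - 1) * V := (rpow_sub_one_mul_self hV hp.ne').symm
      _ ≤ m t * h V * V := by gcongr; exact H.rpow_le t ht V hpos hVκ
      _ = m t * (V * h V) := by ring

theorem GaugeControl.potential_gaugePotential_rpow_le (H : GaugeControl N d p ε δ h θ φ T κ m)
    (G : IsGauge h g) (hd : 0 ≤ d) (hε : 0 < ε) (hθ : 0 ≤ θ) (hp : 0 < p)
    (hφ : AEStronglyMeasurable φ) (x : Space N) (ht : t ∈ times T) (hs : s ∈ Ioo 0 t) :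
    potential N d ε (fun y => ENNReal.ofReal (gaugePotential d ε h g θ φ y s ^ p)) x (t - s) ≤
      ENNReal.ofReal (m s) * (ENNReal.ofReal (semigroupConst N d ε) *
        potential N d ε (gaugeDensity h θ φ) x t) := by
  refine (potential_mono (fun y => H.gaugePotential_rpow_le G hε hθ hp hφ y
    (mem_times_of_mem_Ioo ht hs)) x _).trans ?_
  rw [potential_ofReal_mul]
  gcongr
  simpa only [sub_add_cancel] using potential_potential_le hd hε
    (G.aemeasurable_gaugeDensity hθ hφ) x (sub_pos.2 hs.2) hs.1

theorem GaugeControl.lintegral_potential_gaugePotential_rpow_le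
    (H : GaugeControl N d p ε δ h θ φ T κ m) (G : IsGauge h g) (hd : 0 ≤ d) (hε : 0 < ε)
    (hθ : 0 ≤ θ) (hp : 0 < p) (hφ : AEStronglyMeasurable φ) (x : Space N) (ht : t ∈ times T) :
    ∫⁻ s in Ioo 0 t,
        potential N d ε (fun y => ENNReal.ofReal (gaugePotential d ε h g θ φ y s ^ p)) x (t - s) ≤
      ENNReal.ofReal (semigroupConst N d ε * gaugePotential d ε h g θ φ x t *
        (δ * θ ^ (p - 1))) := by
  have hC := semigroupConst_pos N d hε
  have hV := G.gaugePotential_nonneg (d := d) (ε := ε) (θ := θ) (φ := φ) x t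
  have hVκ := H.gaugePotential_le G hε hθ hφ x ht
  have hF := H.potential_eq G hε hθ hφ x ht
  set V := gaugePotential d ε h g θ φ x t
  set F := potential N d ε (gaugeDensity h θ φ) x t
  set C := semigroupConst N d ε
  have hFκ : F ≤ ENNReal.ofReal V * ENNReal.ofReal (h (κ t)) := by
    rw [hF, ← ENNReal.ofReal_mul hV]
    refine ENNReal.ofReal_le_ofReal ?_
    gcongr
    exact G.mono hV (H.pos t ht).le hVκ
  calc ∫⁻ s in Ioo 0 t,
        potential N d ε (fun y => ENNReal.ofReal (gaugePotential d ε h g θ φ y s ^ p)) x (t - s)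
      ≤ ∫⁻ s in Ioo 0 t, ENNReal.ofReal (m s) * (ENNReal.ofReal C * F) :=
        setLIntegral_mono' measurableSet_Ioo fun s hs =>
          H.potential_gaugePotential_rpow_le G hd hε hθ hp hφ x ht hs
    _ = (∫⁻ s in Ioo 0 t, ENNReal.ofReal (m s)) * (ENNReal.ofReal C * F) :=
        lintegral_mul_const' _ _
          (ENNReal.mul_ne_top ENNReal.ofReal_ne_top (hF ▸ ENNReal.ofReal_ne_top))
    _ ≤ (∫⁻ s in Ioo 0 t, ENNReal.ofReal (m s)) *
          (ENNReal.ofReal C * (ENNReal.ofReal V * ENNReal.ofReal (h (κ t)))) := by gcongr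
    _ = ENNReal.ofReal (C * V) *
          (ENNReal.ofReal (h (κ t)) * ∫⁻ s in Ioo 0 t, ENNReal.ofReal (m s)) := by
        rw [ENNReal.ofReal_mul hC.le]; ring
    _ ≤ ENNReal.ofReal (C * V * (δ * θ ^ (p - 1))) := by
        rw [ENNReal.ofReal_mul (p := C * V) (by positivity)]
        gcongr
        exact H.lintegral_weight_le t ht

theorem GaugeControl.isBarrier (H : GaugeControl N d p ε δ h θ φ T κ m) (G : IsGauge h g)
    (hd : 0 ≤ d) (hε : 0 < ε) (hθ : 0 < θ) (hp : 0 < p) (hφ : AEStronglyMeasurable φ) :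
    IsBarrier N d p ε (semigroupConst N d ε * (majorantMass N ε + 1) ^ (p - 1) * δ) φ T
      (fun x t => (majorantMass N ε + 1) / θ * gaugePotential d ε h g θ φ x t) := by
  have hmass := majorantMass_pos N hε
  set a := majorantMass N ε + 1
  have ha : 0 < a := by positivity
  refine ⟨(G.measurable_gaugePotential hθ.le hφ).const_mul _,
    fun x t => mul_nonneg (by positivity) (G.gaugePotential_nonneg x t), fun x t ht => ?_,
    fun x t ht => ?_, fun τ hτ => ?_⟩
  · exact G.potential_enorm_le hε hθ ht.1 (G.gaugePotential_nonneg x t)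
      (H.potential_eq G hε hθ.le hφ x ht).le
  · simp_rw [Real.mul_rpow (div_pos ha hθ).le (G.gaugePotential_nonneg _ _),
      ENNReal.ofReal_mul (Real.rpow_nonneg (div_pos ha hθ).le p), potential_ofReal_mul]
    rw [lintegral_const_mul' _ _ ENNReal.ofReal_ne_top]
    refine (mul_le_mul_right (H.lintegral_potential_gaugePotential_rpow_le G hd hε hθ.le hp hφ x
      ht) _).trans_eq ?_
    rw [← ENNReal.ofReal_mul (by positivity), ← rpow_sub_one_mul_self (div_pos ha hθ).le hp.ne',
      Real.div_rpow ha.le hθ.le]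
    congr 1
    field_simp
  · obtain ⟨M, hM⟩ := H.bounded τ hτ
    refine ⟨a / θ * M, fun x t ht hτt => ?_⟩
    gcongr
    exact (H.gaugePotential_le G hε hθ.le hφ x ht).trans (hM t ht hτt)

theorem exists_solution_of_gaugeControl (N : ℕ) (hp : 1 ≤ p) (hε : 0 < ε) (hεd : ε ≤ d)
    (hε1 : ε < 1) :
    ∃ δ : ℝ, 0 < δ ∧ ∃ A : ℝ, 0 < A ∧ ∀ (h g : ℝ → ℝ), IsGauge h g →
      ∀ (θ : ℝ) (φ : Space N → ℝ) (T : ℝ≥0∞) (κ m : ℝ → ℝ), 0 < θ → AEStronglyMeasurable φ →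
        GaugeControl N d p ε δ h θ φ T κ m →
        ∃ u : Space N → ℝ → ℝ, IsSolution N d p φ T u ∧
          ∀ x, ∀ t ∈ times T, |u x t| ≤ A / θ * κ t := by
  obtain ⟨δ, hδ, A, hA, hexist⟩ := exists_solution_of_isBarrier N hp hε hεd hε1
  have hmass := majorantMass_pos N hε
  have hC := semigroupConst_pos N d hε
  set a := majorantMass N ε + 1
  set b := semigroupConst N d ε * a ^ (p - 1)
  have hb : 0 < b := by positivity
  refine ⟨δ / b, by positivity, A * a, by positivity, fun h g G θ φ T κ m hθ hφ H => ?_⟩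
  have hbarrier := H.isBarrier G (hε.trans_le hεd).le hε hθ (by linarith) hφ
  rw [mul_div_cancel₀ δ hb.ne'] at hbarrier
  obtain ⟨u, hu, hle⟩ := hexist φ T _ hφ hbarrier
  refine ⟨u, hu, fun x t ht => (hle x t ht).trans ?_⟩
  calc A * (a / θ * gaugePotential d ε h g θ φ x t) ≤ A * (a / θ * κ t) := by
        gcongr
        exact H.gaugePotential_le G hε hθ.le hφ x ht
    _ = A * a / θ * κ t := by ring

end Gauge

theorem exists_decay_exponent {d : ℝ} (hd : 0 < d) : ∃ ε : ℝ, 0 < ε ∧ ε ≤ d ∧ ε < 1 :=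
  ⟨min d (1 / 2), by positivity, min_le_left _ _, (min_le_right _ _).trans_lt one_half_lt_one⟩

theorem mem_times_ofReal {t T : ℝ} (hT : 0 < T) : t ∈ times (ENNReal.ofReal T) ↔ 0 < t ∧ t < T :=
  and_congr_right' (ENNReal.ofReal_lt_ofReal_iff hT)

section Averages

variable {N : ℕ} {d t : ℝ} {z : Space N}

theorem volume_real_ball {a : ℝ} (ha : 0 < a) (z : Space N) :
    volume.real (ball z a) = a ^ N * volume.real (ball (0 : Space N) 1) := by
  rw [measureReal_def, Measure.addHaar_ball_of_pos _ _ ha, ENNReal.toReal_mul,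
    ENNReal.toReal_ofReal (by positivity), finrank_euclideanSpace_fin, measureReal_def]

theorem lintegral_ball_le_of_average_le {f : Space N → ℝ} {a R : ℝ} (ha : 0 < a)
    (hf0 : ∀ y, 0 ≤ f y) (hf : IntegrableOn f (ball z a)) (hR : ⨍ y in ball z a, f y ≤ R) :
    ∫⁻ y in ball z a, ENNReal.ofReal (f y) ≤
      ENNReal.ofReal (a ^ N * (volume.real (ball (0 : Space N) 1) * R)) := by
  have hω := volume_real_unitBall_pos N
  rw [setAverage_eq, volume_real_ball ha, smul_eq_mul, inv_mul_le_iff₀ (by positivity)] at hR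
  rw [← ofReal_integral_eq_lintegral_ofReal hf (.of_forall hf0), ← mul_assoc]
  exact ENNReal.ofReal_le_ofReal hR

theorem rpow_one_div_pow (ht : 0 ≤ t) : (t ^ (1 / d)) ^ N = t ^ ((N : ℝ) / d) := by
  rw [← Real.rpow_mul_natCast ht, one_div_mul_eq_div]

theorem rpow_neg_le_rpow_neg {s t a : ℝ} (hs : 0 < s) (hst : s ≤ t) (ha : 0 ≤ a) :
    t ^ (-a) ≤ s ^ (-a) :=
  Real.rpow_le_rpow_of_nonpos hs hst (neg_nonpos.2 ha)

theorem lintegral_rpow_neg {K a : ℝ} (hK : 0 ≤ K) (ha : a < 1) (ht : 0 < t) :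
    ∫⁻ s in Ioo 0 t, ENNReal.ofReal (K * s ^ (-a)) =
      ENNReal.ofReal (K * (t ^ (1 - a) / (1 - a))) := by
  have hint : IntegrableOn (fun s : ℝ => K * s ^ (-a)) (Ioo 0 t) :=
    (intervalIntegrable_iff_integrableOn_Ioo_of_le ht.le).1
      ((intervalIntegral.intervalIntegrable_rpow' (by linarith)).const_mul K)
  have hnonneg : ∀ᵐ s ∂volume.restrict (Ioo 0 t), 0 ≤ K * s ^ (-a) :=
    (ae_restrict_iff' measurableSet_Ioo).2
      (.of_forall fun s hs => mul_nonneg hK (Real.rpow_nonneg hs.1.le _))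
  rw [← ofReal_integral_eq_lintegral_ofReal hint hnonneg, ← integral_Ioc_eq_integral_Ioo,
    ← intervalIntegral.integral_of_le ht.le, intervalIntegral.integral_const_mul,
    integral_rpow (.inl (by linarith)), Real.zero_rpow (by linarith), sub_zero, neg_add_eq_sub]

end Averages

/-! ### Initial functions of uniformly small mass -/

section SmallMass

variable {N : ℕ} {d p : ℝ} {φ : Space N → ℝ}

theorem r0_eq (N : ℕ) (d p : ℝ) : r0 N d p = N / d * (p - 1) := by
  rw [r0, mul_div_right_comm]

theorem r0_pos (hN : 1 ≤ N) (hd : 0 < d) (hp : 1 < p) : 0 < r0 N d p := by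
  have : 0 < p - 1 := sub_pos.2 hp
  rw [r0]
  positivity

theorem isGauge_one : IsGauge (fun _ => 1) id where
  mono := monotoneOn_const
  pos _ _ := one_pos
  inv_mono := monotone_id.monotoneOn _
  inv_nonneg _ hy := hy
  inv_mul_eq y _ := mul_one y

theorem gaugeControl_of_small_mass {ε δ M T : ℝ} (hd : 0 < d) (hε : 0 < ε) (hp : 1 ≤ p)
    (hr : r0 N d p < 1) (hT : 0 < T) (hM : 0 < M)
    (hball : ∀ z, ∫⁻ y in ball z (T ^ (1 / d)), ENNReal.ofReal |φ y| ≤ ENNReal.ofReal M)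
    (hsmall : (ballConst N ε * M) ^ (p - 1) * (T ^ (1 - r0 N d p) / (1 - r0 N d p)) ≤ δ) :
    GaugeControl N d p ε δ (fun _ => 1) 1 φ (ENNReal.ofReal T)
      (fun t => ballConst N ε * M * t ^ (-((N : ℝ) / d)))
      (fun s => (ballConst N ε * M) ^ (p - 1) * s ^ (-r0 N d p)) := by
  have hC := ballConst_pos N hε
  have : 0 < 1 - r0 N d p := sub_pos.2 hr
  refine ⟨fun t ht => ?_, fun τ hτ => ?_, fun t ht z => ?_, fun t ht v hv hvκ => ?_,
    fun t ht => ?_⟩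
  · have := Real.rpow_pos_of_pos ht.1 (-((N : ℝ) / d))
    positivity
  · refine ⟨ballConst N ε * M * τ ^ (-((N : ℝ) / d)), fun t _ hτt => ?_⟩
    have := rpow_neg_le_rpow_neg hτ hτt.le (a := N / d) (by positivity)
    gcongr
  · obtain ⟨ht0, htT⟩ := (mem_times_ofReal hT).1 ht
    have hradius : t ^ (1 / d) ≤ T ^ (1 / d) := by gcongr
    have hmass := (lintegral_mono_set (ball_subset_ball hradius)).trans (hball z)
    have hcancel : t ^ ((N : ℝ) / d) * (ballConst N ε * M * t ^ (-((N : ℝ) / d))) /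
        ballConst N ε = M := by
      rw [Real.rpow_neg ht0.le]
      field_simp
    simpa only [gaugeDensity, one_mul, mul_one, hcancel] using hmass
  · refine (Real.rpow_le_rpow hv.le hvκ (by linarith)).trans_eq ?_
    rw [mul_one, Real.mul_rpow (by positivity) (Real.rpow_nonneg ht.1.le _),
      ← Real.rpow_mul ht.1.le, r0_eq, neg_mul]
  · obtain ⟨ht0, htT⟩ := (mem_times_ofReal hT).1 ht
    rw [ENNReal.ofReal_one, one_mul, Real.one_rpow, mul_one,
      lintegral_rpow_neg (by positivity) hr ht0]
    refine ENNReal.ofReal_le_ofReal (le_trans ?_ hsmall)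
    gcongr

theorem exists_solution_of_small_mass (N : ℕ) (hd : 0 < d) (hp : 1 ≤ p) (hr : r0 N d p < 1) :
    ∃ δ : ℝ, 0 < δ ∧ ∃ A : ℝ, 0 < A ∧ ∀ (φ : Space N → ℝ) (T M : ℝ),
      AEStronglyMeasurable φ → 0 < T → 0 < M →
      (∀ z, ∫⁻ y in ball z (T ^ (1 / d)), ENNReal.ofReal |φ y| ≤ ENNReal.ofReal M) →
      M ^ (p - 1) * T ^ (1 - r0 N d p) ≤ δ →
      ∃ u : Space N → ℝ → ℝ, IsSolution N d p φ (ENNReal.ofReal T) u ∧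
        ∀ x t, 0 < t → t < T → |u x t| ≤ A * M * t ^ (-((N : ℝ) / d)) := by
  obtain ⟨ε, hε, hεd, hε1⟩ := exists_decay_exponent hd
  obtain ⟨δ, hδ, A, hA, hexist⟩ := exists_solution_of_gaugeControl N hp hε hεd hε1
  have hC := ballConst_pos N hε
  set C := ballConst N ε
  have hr1 : 0 < 1 - r0 N d p := sub_pos.2 hr
  refine ⟨δ * (1 - r0 N d p) / C ^ (p - 1), by positivity, A * C, by positivity,
    fun φ T M hφ hT hM hball hsmall => ?_⟩
  have hweight : (C * M) ^ (p - 1) * (T ^ (1 - r0 N d p) / (1 - r0 N d p)) ≤ δ := by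
    rw [le_div_iff₀ (by positivity)] at hsmall
    rw [← mul_div_assoc, div_le_iff₀ hr1, Real.mul_rpow hC.le hM.le]
    linarith
  obtain ⟨u, hu, hle⟩ := hexist _ _ isGauge_one 1 φ _ _ _ one_pos hφ
    (gaugeControl_of_small_mass hd hε hp hr hT hM hball hweight)
  refine ⟨u, hu, fun x t ht htT => (hle x t ((mem_times_ofReal hT).2 ⟨ht, htT⟩)).trans_eq ?_⟩
  ring

end SmallMass

section Subcritical

variable {N : ℕ} {d p γ S T : ℝ} {φ : Space N → ℝ}

/-- The smallness condition of the case `r₀ < 1` at time scale `T`, with constant `γ`. -/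
def HasSmallAverages (N : ℕ) (d p γ : ℝ) (φ : Space N → ℝ) (T : ℝ) : Prop :=
  ∀ x : Space N,
    (⨍ y in ball x (T ^ (1 / d)), |φ y|) ≤ γ * T ^ (-((N : ℝ) / (d * r0 N d p)))

/-- The positive exponent `N/d (1/r₀ - 1)` governing the size of the solution when `r₀ < 1`. -/
def subcriticalExponent (N : ℕ) (d p : ℝ) : ℝ :=
  (N : ℝ) / d * (1 / r0 N d p - 1)

theorem subcriticalExponent_nonneg (hd : 0 ≤ d) (hr0 : 0 < r0 N d p) (hr : r0 N d p ≤ 1) :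
    0 ≤ subcriticalExponent N d p :=
  mul_nonneg (by positivity) (sub_nonneg.2 (one_le_one_div hr0 hr))

theorem subcriticalExponent_mul (hr0 : r0 N d p ≠ 0) :
    subcriticalExponent N d p * (p - 1) = 1 - r0 N d p := by
  rw [subcriticalExponent, mul_right_comm, ← r0_eq]
  field_simp

theorem HasSmallAverages.lintegral_ball_le (hφ : LocallyIntegrable φ) (hT : 0 < T)
    (h : HasSmallAverages N d p γ φ T) (z : Space N) :
    ∫⁻ y in ball z (T ^ (1 / d)), ENNReal.ofReal |φ y| ≤
      ENNReal.ofReal (volume.real (ball (0 : Space N) 1) * γ *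
        T ^ (-subcriticalExponent N d p)) := by
  have hint : IntegrableOn (fun y => |φ y|) (ball z (T ^ (1 / d))) :=
    ((hφ.integrableOn_isCompact (isCompact_closedBall z _)).mono_set ball_subset_closedBall).abs
  have hexp : -subcriticalExponent N d p = (N : ℝ) / d + -((N : ℝ) / (d * r0 N d p)) := by
    rw [subcriticalExponent, div_mul_eq_div_mul_one_div]
    ring
  refine (lintegral_ball_le_of_average_le (Real.rpow_pos_of_pos hT _) (fun y => abs_nonneg _) hint
    (h z)).trans_eq ?_
  rw [rpow_one_div_pow hT.le, hexp, Real.rpow_add hT]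
  congr 1
  ring

theorem HasSmallAverages.exists_mass_bound (hd : 0 ≤ d) (hr0 : 0 < r0 N d p)
    (hr : r0 N d p ≤ 1) (hγ : 0 < γ) (hφ : LocallyIntegrable φ) (hS : 0 < S)
    (hsmallS : HasSmallAverages N d p γ φ S) (hT : 0 < T)
    (hsmallT : HasSmallAverages N d p γ φ T) :
    ∃ M : ℝ, 0 < M ∧
      M ≤ volume.real (ball (0 : Space N) 1) * γ * T ^ (-subcriticalExponent N d p) ∧
      M ≤ volume.real (ball (0 : Space N) 1) * γ * S ^ (-subcriticalExponent N d p) ∧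
      ∀ z, ∫⁻ y in ball z (T ^ (1 / d)), ENNReal.ofReal |φ y| ≤ ENNReal.ofReal M := by
  have hω := volume_real_unitBall_pos N
  have hmassT := hsmallT.lintegral_ball_le hφ hT
  refine ⟨_, lt_min (by positivity) (by positivity), min_le_left _ _, min_le_right _ _,
    fun z => ?_⟩
  rw [ENNReal.ofReal_min]
  refine le_min (hmassT z) ?_
  rcases le_total T S with hTS | hST
  · have hradius : T ^ (1 / d) ≤ S ^ (1 / d) := by gcongr
    exact (lintegral_mono_set (ball_subset_ball hradius)).trans
      (hsmallS.lintegral_ball_le hφ hS z)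
  · refine (hmassT z).trans (ENNReal.ofReal_le_ofReal ?_)
    have := rpow_neg_le_rpow_neg hS hST (subcriticalExponent_nonneg hd hr0 hr)
    gcongr

theorem exists_solution_of_r0_lt_one (hN : 1 ≤ N) (hd : 0 < d) (hp : 1 < p)
    (hr : r0 N d p < 1) :
    ∃ γ : ℝ, 0 < γ ∧ ∃ C : ℝ, 0 < C ∧
      ∀ φ : Space N → ℝ, LocallyIntegrable φ → ∃ C' : ℝ, 0 < C' ∧
      ∀ T : ℝ, 0 < T → HasSmallAverages N d p γ φ T →
      ∃ u : Space N → ℝ → ℝ, IsSolution N d p φ (ENNReal.ofReal T) u ∧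
        ∀ (x : Space N) (t : ℝ), 0 < t → t < T →
          |u x t| ≤ C * T ^ (-subcriticalExponent N d p) * t ^ (-((N : ℝ) / d)) ∧
          |u x t| ≤ C' * t ^ (-((N : ℝ) / d)) := by
  obtain ⟨δ, hδ, A, hA, hexist⟩ := exists_solution_of_small_mass N hd hp.le hr
  have hp1 : 0 < p - 1 := sub_pos.2 hp
  have hr0 := r0_pos hN hd hp
  have hω := volume_real_unitBall_pos N
  set b := subcriticalExponent N d p
  set G := δ ^ (p - 1)⁻¹
  have hG : 0 < G := by positivity
  have hsmall (T M : ℝ) (hT : 0 < T) (hM : 0 < M) (hMG : M ≤ G * T ^ (-b)) :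
      M ^ (p - 1) * T ^ (1 - r0 N d p) ≤ δ := by
    calc M ^ (p - 1) * T ^ (1 - r0 N d p) ≤ (G * T ^ (-b)) ^ (p - 1) * T ^ (1 - r0 N d p) := by
          gcongr
      _ = δ * (T ^ (-(1 - r0 N d p)) * T ^ (1 - r0 N d p)) := by
          rw [Real.mul_rpow hG.le (by positivity), Real.rpow_inv_rpow hδ.le hp1.ne',
            ← Real.rpow_mul hT.le, neg_mul, subcriticalExponent_mul hr0.ne', mul_assoc]
      _ = δ := by rw [← Real.rpow_add hT, neg_add_cancel, Real.rpow_zero, mul_one]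
  refine ⟨G / volume.real (ball (0 : Space N) 1), by positivity, A * G, by positivity,
    fun φ hφ => ?_⟩
  by_cases hS : ∃ S : ℝ, 0 < S ∧
    HasSmallAverages N d p (G / volume.real (ball (0 : Space N) 1)) φ S
  · obtain ⟨S, hS, hsmallS⟩ := hS
    refine ⟨A * (G * S ^ (-b)), by positivity, fun T hT hsmallT => ?_⟩
    obtain ⟨M, hM, hMT, hMS, hball⟩ := hsmallS.exists_mass_bound hd.le hr0 hr.le (by positivity)
      hφ hS hT hsmallT
    rw [mul_div_cancel₀ _ hω.ne'] at hMT hMS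
    obtain ⟨u, hu, hle⟩ := hexist φ T M hφ.aestronglyMeasurable hT hM hball (hsmall T M hT hM hMT)
    refine ⟨u, hu, fun x t ht htT => ⟨(hle x t ht htT).trans ?_, (hle x t ht htT).trans ?_⟩⟩
    · rw [mul_assoc A G]
      gcongr
    · gcongr
  · exact ⟨1, one_pos, fun T hT hsmallT => absurd ⟨T, hT, hsmallT⟩ hS⟩

end Subcritical

/-! ### Initial functions with small Morrey norm -/

section Morrey

variable {N : ℕ} {d p q : ℝ} {φ : Space N → ℝ}

theorem rpow_le_add_rpow {l q₀ a : ℝ} (hl : 0 < l) (hq : 0 ≤ q) (hqq : q ≤ q₀) (ha : 0 ≤ a) :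
    a ^ q ≤ l ^ q + l ^ (q - q₀) * a ^ q₀ := by
  rcases le_or_gt a l with hal | hla
  · have hle := Real.rpow_le_rpow ha hal hq
    exact hle.trans (le_add_of_nonneg_right (by positivity))
  · have hdecay : a ^ (q - q₀) ≤ l ^ (q - q₀) :=
      Real.rpow_le_rpow_of_nonpos hl hla.le (sub_nonpos.2 hqq)
    calc a ^ q = a ^ (q - q₀) * a ^ q₀ := by
          rw [← Real.rpow_add (hl.trans hla), sub_add_cancel]
      _ ≤ l ^ (q - q₀) * a ^ q₀ := by gcongr
      _ ≤ l ^ q + l ^ (q - q₀) * a ^ q₀ := le_add_of_nonneg_left (by positivity)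

theorem lintegral_ball_rpow_le {z : Space N} {a l q₀ : ℝ} (ha : 0 < a) (hl : 0 < l) (hq : 0 ≤ q)
    (hqq : q ≤ q₀) (hint : IntegrableOn (fun y => |φ y| ^ q₀) (ball z a))
    (havg : ⨍ y in ball z a, |φ y| ^ q₀ ≤ l ^ q₀) :
    ∫⁻ y in ball z a, ENNReal.ofReal (|φ y| ^ q) ≤
      ENNReal.ofReal (a ^ N * (2 * volume.real (ball (0 : Space N) 1) * l ^ q)) := by
  have hω := volume_real_unitBall_pos N
  have hvol : volume (ball z a) =
      ENNReal.ofReal (a ^ N * volume.real (ball (0 : Space N) 1)) := by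
    rw [← volume_real_ball ha z, measureReal_def, ENNReal.ofReal_toReal measure_ball_lt_top.ne]
  set ω := volume.real (ball (0 : Space N) 1)
  calc ∫⁻ y in ball z a, ENNReal.ofReal (|φ y| ^ q)
      ≤ ∫⁻ y in ball z a, (ENNReal.ofReal (l ^ q) +
          ENNReal.ofReal (l ^ (q - q₀)) * ENNReal.ofReal (|φ y| ^ q₀)) := by
        refine lintegral_mono fun y => ?_
        rw [← ENNReal.ofReal_mul (by positivity),
          ← ENNReal.ofReal_add (by positivity) (by positivity)]
        exact ENNReal.ofReal_le_ofReal (rpow_le_add_rpow hl hq hqq (abs_nonneg _))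
    _ = ENNReal.ofReal (l ^ q) * volume (ball z a) +
          ENNReal.ofReal (l ^ (q - q₀)) * ∫⁻ y in ball z a, ENNReal.ofReal (|φ y| ^ q₀) := by
        rw [lintegral_add_left measurable_const, setLIntegral_const,
          lintegral_const_mul' _ _ ENNReal.ofReal_ne_top]
    _ ≤ ENNReal.ofReal (l ^ q) * ENNReal.ofReal (a ^ N * ω) +
          ENNReal.ofReal (l ^ (q - q₀)) * ENNReal.ofReal (a ^ N * (ω * l ^ q₀)) := by
        rw [hvol]
        gcongr
        exact lintegral_ball_le_of_average_le ha (fun y => by positivity) hint havg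
    _ = ENNReal.ofReal (a ^ N * (2 * ω * l ^ q)) := by
        have hsplit : l ^ q = l ^ (q - q₀) * l ^ q₀ := by
          rw [← Real.rpow_add hl, sub_add_cancel]
        rw [← ENNReal.ofReal_mul (by positivity), ← ENNReal.ofReal_mul (by positivity),
          ← ENNReal.ofReal_add (by positivity) (by positivity), hsplit]
        ring_nf

theorem setAverage_nonneg {f : Space N → ℝ} (hf : ∀ y, 0 ≤ f y) (s : Set (Space N)) :
    0 ≤ ⨍ y in s, f y := by
  rw [setAverage_eq]
  exact smul_nonneg (by positivity) (integral_nonneg hf)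

theorem lintegral_ball_rpow_le_of_morrey {z : Space N} {σ a γ q₀ : ℝ} (hσ : 0 < σ) (hγ : 0 < γ)
    (hq : 0 ≤ q) (hqq : q ≤ q₀) (hq₀ : 0 < q₀)
    (hint : IntegrableOn (fun y => |φ y| ^ q₀) (ball z σ))
    (hmorrey : σ ^ a * (⨍ y in ball z σ, |φ y| ^ q₀) ^ (1 / q₀) ≤ γ) :
    ∫⁻ y in ball z σ, ENNReal.ofReal (|φ y| ^ q) ≤ ENNReal.ofReal
      (σ ^ N * (2 * volume.real (ball (0 : Space N) 1) * (γ * σ ^ (-a)) ^ q)) := by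
  refine lintegral_ball_rpow_le hσ (by positivity) hq hqq hint ?_
  rw [← Real.rpow_inv_le_iff_of_pos (setAverage_nonneg (fun y => by positivity) _)
    (by positivity) hq₀, ← one_div, Real.rpow_neg hσ.le, ← div_eq_mul_inv,
    le_div_iff₀' (by positivity)]
  exact hmorrey

theorem lintegral_ball_rpow_le_of_critical_morrey {z : Space N} {t q₀ G C : ℝ} (hN : 1 ≤ N)
    (hd : 0 < d) (hp : 1 < p) (hq : 0 < q) (hqq : q ≤ q₀) (hG : 0 < G) (hC : 0 < C) (ht : 0 < t)
    (hint : IntegrableOn (fun y => |φ y| ^ q₀) (ball z (t ^ (1 / d))))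
    (hmorrey : (t ^ (1 / d)) ^ ((N : ℝ) / r0 N d p) *
      (⨍ y in ball z (t ^ (1 / d)), |φ y| ^ q₀) ^ (1 / q₀) ≤
        G / (2 * volume.real (ball (0 : Space N) 1) * C) ^ q⁻¹) :
    ∫⁻ y in ball z (t ^ (1 / d)), ENNReal.ofReal (|φ y| ^ q) ≤
      ENNReal.ofReal (t ^ ((N : ℝ) / d) * (G * t ^ (-(1 / (p - 1)))) ^ q / C) := by
  have hp1 : 0 < p - 1 := sub_pos.2 hp
  have hω := volume_real_unitBall_pos N
  have hexp : 1 / d * -((N : ℝ) / r0 N d p) = -(1 / (p - 1)) := by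
    rw [r0]
    field_simp
  have hσ : 0 < t ^ (1 / d) := Real.rpow_pos_of_pos ht _
  have := Real.rpow_pos_of_pos ht (-(1 / (p - 1)))
  refine (lintegral_ball_rpow_le_of_morrey hσ (by positivity) hq.le hqq (hq.trans_le hqq) hint
    hmorrey).trans_eq ?_
  rw [rpow_one_div_pow ht.le, ← Real.rpow_mul ht.le, hexp, div_mul_eq_mul_div,
    Real.div_rpow (by positivity) (by positivity), Real.rpow_inv_rpow (by positivity) hq.ne']
  congr 1
  field_simp

theorem mul_rpow_sub_one {v : ℝ} (hv : 0 ≤ v) (hq : q ≠ 0) : v * v ^ (q - 1) = v ^ q := by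
  rw [mul_comm, rpow_sub_one_mul_self hv hq]

theorem isGauge_rpow (hq : 1 ≤ q) : IsGauge (fun s => s ^ (q - 1)) (fun y => y ^ q⁻¹) where
  mono _ ha _ _ hab := Real.rpow_le_rpow ha hab (sub_nonneg.2 hq)
  pos _ hs := Real.rpow_pos_of_pos hs _
  inv_mono _ ha _ _ hab := Real.rpow_le_rpow ha hab (by positivity)
  inv_nonneg _ hy := Real.rpow_nonneg hy _
  inv_mul_eq y hy := by
    have hq0 : q ≠ 0 := by positivity
    rw [mul_rpow_sub_one (Real.rpow_nonneg hy _) hq0, Real.rpow_inv_rpow hy hq0]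

theorem gaugeControl_of_lintegral_rpow_le {ε δ G : ℝ} {T : ℝ≥0∞} (hp : 1 < p) (hq : 1 < q)
    (hqp : q ≤ p) (hG : 0 < G) (hδ : G ^ (p - 1) ≤ δ * ((q - 1) / (p - 1)))
    (hball : ∀ t ∈ times T, ∀ z, ∫⁻ y in ball z (t ^ (1 / d)), ENNReal.ofReal (|φ y| ^ q) ≤
      ENNReal.ofReal (t ^ ((N : ℝ) / d) * (G * t ^ (-(1 / (p - 1)))) ^ q / ballConst N ε)) :
    GaugeControl N d p ε δ (fun s => s ^ (q - 1)) 1 φ T (fun t => G * t ^ (-(1 / (p - 1))))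
      (fun s => G ^ (p - q) * s ^ (-((p - q) / (p - 1)))) := by
  have hp1 : 0 < p - 1 := sub_pos.2 hp
  have hq1 : 0 < q - 1 := sub_pos.2 hq
  have hq0 : q ≠ 0 := by positivity
  have hexp : 1 - (p - q) / (p - 1) = (q - 1) / (p - 1) := by
    field_simp
    ring
  have hκ {t : ℝ} (ht : t ∈ times T) : 0 < G * t ^ (-(1 / (p - 1))) :=
    mul_pos hG (Real.rpow_pos_of_pos ht.1 _)
  refine ⟨fun t ht => hκ ht, fun τ hτ => ?_, fun t ht z => ?_, fun t ht v hv hvκ => ?_,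
    fun t ht => ?_⟩
  · refine ⟨G * τ ^ (-(1 / (p - 1))), fun t _ hτt => ?_⟩
    have := rpow_neg_le_rpow_neg hτ hτt.le (one_div_nonneg.2 hp1.le)
    gcongr
  · simp_rw [gaugeDensity, one_mul, mul_rpow_sub_one (abs_nonneg _) hq0,
      mul_rpow_sub_one (hκ ht).le hq0]
    exact hball t ht z
  · have hweight : v ^ (p - q) ≤ G ^ (p - q) * t ^ (-((p - q) / (p - 1))) := by
      refine (Real.rpow_le_rpow hv.le hvκ (sub_nonneg.2 hqp)).trans_eq ?_
      rw [Real.mul_rpow hG.le (Real.rpow_nonneg ht.1.le _), ← Real.rpow_mul ht.1.le, neg_mul,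
        one_div_mul_eq_div]
    calc v ^ (p - 1) = v ^ (p - q) * v ^ (q - 1) := by
          rw [← Real.rpow_add hv, sub_add_sub_cancel]
      _ ≤ G ^ (p - q) * t ^ (-((p - q) / (p - 1))) * v ^ (q - 1) := by gcongr
  · rw [lintegral_rpow_neg (by positivity) (by rw [div_lt_one hp1]; linarith) ht.1, hexp,
      ← ENNReal.ofReal_mul (Real.rpow_nonneg (hκ ht).le _), Real.one_rpow, mul_one,
      Real.mul_rpow hG.le (Real.rpow_nonneg ht.1.le _), ← Real.rpow_mul ht.1.le, neg_mul,
      one_div_mul_eq_div, Real.rpow_neg ht.1.le]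
    have htpos : 0 < t ^ ((q - 1) / (p - 1)) := Real.rpow_pos_of_pos ht.1 _
    have hsplit : G ^ (q - 1) * G ^ (p - q) = G ^ (p - 1) := by
      rw [← Real.rpow_add hG, sub_add_sub_cancel']
    refine ENNReal.ofReal_le_ofReal ?_
    calc G ^ (q - 1) * (t ^ ((q - 1) / (p - 1)))⁻¹ *
          (G ^ (p - q) * (t ^ ((q - 1) / (p - 1)) / ((q - 1) / (p - 1))))
        = G ^ (q - 1) * G ^ (p - q) / ((q - 1) / (p - 1)) := by field_simp
      _ ≤ δ := by rwa [hsplit, div_le_iff₀ (by positivity)]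

theorem ofReal_rpow_lt_rpow {T : ℝ≥0∞} {t : ℝ} (hd : 0 < d) (ht : t ∈ times T) :
    ENNReal.ofReal (t ^ (1 / d)) < T ^ (1 / d) := by
  rw [← ENNReal.ofReal_rpow_of_pos ht.1]
  exact ENNReal.rpow_lt_rpow ht.2 (by positivity)

theorem exists_solution_of_morrey (hN : 1 ≤ N) (hd : 0 < d) (hp : 1 < p) {q₀ : ℝ}
    (hq₀ : 1 < q₀) :
    ∃ γ : ℝ, 0 < γ ∧ ∃ C : ℝ, 0 < C ∧
      ∀ φ : Space N → ℝ, AEStronglyMeasurable φ → ∀ T : ℝ≥0∞,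
      (∀ (x : Space N) (σ : ℝ), 0 < σ → ENNReal.ofReal σ < T ^ (1 / d) →
        IntegrableOn (fun y => |φ y| ^ q₀) (ball x σ) ∧
        σ ^ ((N : ℝ) / r0 N d p) * (⨍ y in ball x σ, |φ y| ^ q₀) ^ (1 / q₀) ≤ γ) →
      ∃ u : Space N → ℝ → ℝ, IsSolution N d p φ T u ∧
        ∀ (x : Space N) (t : ℝ), 0 < t → ENNReal.ofReal t < T →
          |u x t| ≤ C * t ^ (-((N : ℝ) / (d * r0 N d p))) := by
  obtain ⟨ε, hε, hεd, hε1⟩ := exists_decay_exponent hd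
  obtain ⟨δ, hδ, A, hA, hexist⟩ := exists_solution_of_gaugeControl N hp.le hε hεd hε1
  obtain ⟨q, hq, hqq, hqp⟩ : ∃ q : ℝ, 1 < q ∧ q ≤ q₀ ∧ q ≤ p :=
    ⟨min q₀ p, lt_min hq₀ hp, min_le_left _ _, min_le_right _ _⟩
  have hp1 : 0 < p - 1 := sub_pos.2 hp
  have : 0 < q - 1 := sub_pos.2 hq
  have hω := volume_real_unitBall_pos N
  have hC := ballConst_pos N hε
  have hexp : (N : ℝ) / (d * r0 N d p) = 1 / (p - 1) := by
    rw [r0]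
    field_simp
  set G := (δ * ((q - 1) / (p - 1))) ^ (p - 1)⁻¹
  have hG : 0 < G := by positivity
  refine ⟨G / (2 * volume.real (ball (0 : Space N) 1) * ballConst N ε) ^ q⁻¹, by positivity,
    A * G, by positivity, fun φ hφ T hmorrey => ?_⟩
  have hball : ∀ t ∈ times T, ∀ z, ∫⁻ y in ball z (t ^ (1 / d)), ENNReal.ofReal (|φ y| ^ q) ≤
      ENNReal.ofReal (t ^ ((N : ℝ) / d) * (G * t ^ (-(1 / (p - 1)))) ^ q / ballConst N ε) := by
    intro t ht z
    obtain ⟨hint, hnorm⟩ := hmorrey z _ (Real.rpow_pos_of_pos ht.1 _) (ofReal_rpow_lt_rpow hd ht)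
    exact lintegral_ball_rpow_le_of_critical_morrey hN hd hp (one_pos.trans hq) hqq hG hC ht.1
      hint hnorm
  obtain ⟨u, hu, hle⟩ := hexist _ _ (isGauge_rpow hq.le) 1 φ T _ _ one_pos hφ
    (gaugeControl_of_lintegral_rpow_le hp hq hqp hG
      (Real.rpow_inv_rpow (by positivity) hp1.ne').le hball)
  refine ⟨u, hu, fun x t ht htT => ?_⟩
  simpa only [div_one, hexp, mul_assoc] using hle x t ⟨ht, htT⟩

end Morrey

/-! ### The critical case -/

section LogGauge

variable {a β s v U : ℝ}

theorem log_exp_add_pos (hs : 0 ≤ s) : 0 < Real.log (Real.exp 1 + s) :=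
  one_pos.trans_le (one_le_log_exp_add hs)

theorem log_exp_add_rpow_monotoneOn (hβ : 0 ≤ β) :
    MonotoneOn (fun s => Real.log (Real.exp 1 + s) ^ β) (Ici 0) := fun x hx y _ hxy => by
  have hx0 : 0 ≤ x := hx
  have := (log_exp_add_pos hx0).le
  dsimp only
  gcongr

theorem Phi_strictMonoOn (hβ : 0 ≤ β) : StrictMonoOn (Phi β) (Ici 0) := fun _ hx _ hy hxy =>
  mul_lt_mul hxy (log_exp_add_rpow_monotoneOn hβ hx hy hxy.le)
    (Real.rpow_pos_of_pos (log_exp_add_pos hx) _) hy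

theorem mul_Phi_le {c B w : ℝ} (hβ : 0 ≤ β) (hw : 0 ≤ w) (hB : 1 ≤ B) (hcB : c ≤ B) :
    c * Phi β w ≤ Phi β (B * w) := by
  have hwB : w ≤ B * w := le_mul_of_one_le_left hw hB
  have hmono := log_exp_add_rpow_monotoneOn hβ hw (hw.trans hwB) hwB
  have hlog : 0 ≤ Real.log (Real.exp 1 + w) ^ β := Real.rpow_nonneg (log_exp_add_pos hw).le _
  calc c * Phi β w ≤ B * Phi β w := mul_le_mul_of_nonneg_right hcB (mul_nonneg hw hlog)
    _ = B * w * Real.log (Real.exp 1 + w) ^ β := (mul_assoc _ _ _).symm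
    _ ≤ Phi β (B * w) := mul_le_mul_of_nonneg_left hmono (hw.trans hwB)

theorem PhiInv_nonneg (hβ : 0 < β) {y : ℝ} (hy : 0 ≤ y) : 0 ≤ PhiInv β y :=
  (Phi_bijOn hβ).surjOn.mapsTo_invFunOn hy

theorem Phi_PhiInv (hβ : 0 < β) {y : ℝ} (hy : 0 ≤ y) : Phi β (PhiInv β y) = y :=
  (Phi_bijOn hβ).surjOn.rightInvOn_invFunOn hy

theorem PhiInv_le_iff (hβ : 0 < β) {y w : ℝ} (hy : 0 ≤ y) (hw : 0 ≤ w) :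
    PhiInv β y ≤ w ↔ y ≤ Phi β w := by
  rw [← (Phi_strictMonoOn hβ.le).le_iff_le (PhiInv_nonneg hβ hy) hw, Phi_PhiInv hβ hy]

theorem isGauge_log (hβ : 0 < β) :
    IsGauge (fun s => Real.log (Real.exp 1 + s) ^ β) (PhiInv β) where
  mono := log_exp_add_rpow_monotoneOn hβ.le
  pos _ hs := Real.rpow_pos_of_pos (log_exp_add_pos hs.le) _
  inv_mono x hx y hy hxy := by
    rwa [PhiInv_le_iff hβ hx (PhiInv_nonneg hβ hy), Phi_PhiInv hβ hy]
  inv_nonneg _ hy := PhiInv_nonneg hβ hy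
  inv_mul_eq _ hy := Phi_PhiInv hβ hy

theorem log_exp_add_le (ha : 0 < a) (hv : 0 < v) (hvU : v ≤ U) :
    Real.log (Real.exp 1 + U) ≤ (1 + 1 / a) * (U / v) ^ a * Real.log (Real.exp 1 + v) := by
  have hU : 0 < U := hv.trans_le hvU
  have hl : 1 ≤ U / v := (one_le_div hv).2 hvU
  have hlv : U / v * v = U := div_mul_cancel₀ U hv.ne'
  have hLv := one_le_log_exp_add hv.le
  have hlog : 0 ≤ Real.log (U / v) := Real.log_nonneg hl
  calc Real.log (Real.exp 1 + U) ≤ Real.log (U / v * (Real.exp 1 + v)) := by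
        refine Real.log_le_log (by positivity) ?_
        rw [mul_add, hlv]
        exact add_le_add_left (le_mul_of_one_le_left (Real.exp_pos 1).le hl) U
    _ = Real.log (U / v) + Real.log (Real.exp 1 + v) :=
        Real.log_mul (by positivity) (by positivity)
    _ ≤ (1 + Real.log (U / v)) * Real.log (Real.exp 1 + v) := by nlinarith
    _ ≤ ((U / v) ^ a + (U / v) ^ a / a) * Real.log (Real.exp 1 + v) := by
        gcongr
        · exact Real.one_le_rpow hl ha.le
        · exact Real.log_le_rpow_div (by positivity) ha
    _ = (1 + 1 / a) * (U / v) ^ a * Real.log (Real.exp 1 + v) := by ring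

theorem rpow_mul_log_le {η : ℝ} (hη : 0 < η) (hβ : 0 < β) (hv : 0 < v) (hvU : v ≤ U) :
    v ^ η * Real.log (Real.exp 1 + U) ^ β ≤
      (1 + β / η) ^ β * U ^ η * Real.log (Real.exp 1 + v) ^ β := by
  have hU : 0 < U := hv.trans_le hvU
  have hLv := log_exp_add_pos hv.le
  have hLU := log_exp_add_pos hU.le
  have hle := Real.rpow_le_rpow hLU.le (log_exp_add_le (div_pos hη hβ) hv hvU) hβ.le
  rw [Real.mul_rpow (by positivity) hLv.le, Real.mul_rpow (by positivity) (by positivity),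
    ← Real.rpow_mul (by positivity), div_mul_cancel₀ _ hβ.ne', Real.div_rpow hU.le hv.le,
    one_div_div] at hle
  calc v ^ η * Real.log (Real.exp 1 + U) ^ β
      ≤ v ^ η * ((1 + β / η) ^ β * (U ^ η / v ^ η) * Real.log (Real.exp 1 + v) ^ β) := by gcongr
    _ = (1 + β / η) ^ β * U ^ η * Real.log (Real.exp 1 + v) ^ β := by field_simp

end LogGauge

section CriticalProfile

variable {b d R : ℝ}

/-- At `b = N/d` and `R = T/t`, the size at time `t` of the solutions in the case `r₀ = 1`, in the
units in which the initial function is multiplied by `T^{N/d}`. -/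
def criticalProfile (b R : ℝ) : ℝ :=
  (R / Real.log (2 * R)) ^ b

theorem one_half_lt_log_two_mul (hR : 1 < R) : 1 / 2 < Real.log (2 * R) := by
  have hlog := Real.log_lt_log two_pos (show 2 < 2 * R by linarith)
  linarith [Real.log_two_gt_d9]

theorem log_two_mul_pos (hR : 1 < R) : 0 < Real.log (2 * R) :=
  one_half_pos.trans (one_half_lt_log_two_mul hR)

theorem criticalProfile_pos (b : ℝ) (hR : 1 < R) : 0 < criticalProfile b R :=
  Real.rpow_pos_of_pos (div_pos (one_pos.trans hR) (log_two_mul_pos hR)) b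

theorem criticalProfile_rpow_inv (hb : b ≠ 0) (hR : 1 < R) :
    criticalProfile b R ^ b⁻¹ = R / Real.log (2 * R) :=
  Real.rpow_rpow_inv (div_pos (one_pos.trans hR) (log_two_mul_pos hR)).le hb

theorem mul_log_le_log_exp_add_rpow (hR : 0 < R) (b : ℝ) :
    b * Real.log R ≤ Real.log (Real.exp 1 + R ^ b) := by
  rw [← Real.log_rpow hR]
  exact Real.log_le_log (by positivity) (le_add_of_nonneg_left (Real.exp_pos 1).le)

theorem log_two_mul_le_log_exp_add (hd : 0 < d) (hR : 0 < R) :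
    Real.log (2 * R) ≤ (1 + d) * Real.log (Real.exp 1 + R ^ (1 / d)) := by
  have hone := one_le_log_exp_add (Real.rpow_nonneg hR.le (1 / d))
  have hlog : Real.log R ≤ d * Real.log (Real.exp 1 + R ^ (1 / d)) := by
    rw [← div_le_iff₀' hd, ← one_div_mul_eq_div]
    exact mul_log_le_log_exp_add_rpow hR _
  rw [Real.log_mul two_ne_zero hR.ne']
  linarith [Real.log_two_lt_d9]

theorem log_two_mul_le_log_exp_add_criticalProfile (hb : 0 < b) (hR : 1 < R) :
    Real.log (2 * R) ≤ (2 / b + 2) * Real.log (Real.exp 1 + criticalProfile b R) := by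
  have hR0 : 0 < R := one_pos.trans hR
  have hL := log_two_mul_pos hR
  have hsum : Real.log (2 * R) = Real.log 2 + Real.log R := Real.log_mul two_ne_zero hR0.ne'
  have hone := one_le_log_exp_add (criticalProfile_pos b hR).le
  have hquot := mul_log_le_log_exp_add_rpow (div_pos hR0 hL) b
  rw [← criticalProfile, ← le_div_iff₀' hb, Real.log_div hR0.ne' hL.ne'] at hquot
  have hloglog : Real.log (Real.log (2 * R)) ≤ Real.log (2 * R) / 2 := by
    have hle := Real.log_le_sub_one_of_pos (half_pos hL)
    rw [Real.log_div hL.ne' two_ne_zero] at hle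
    linarith [Real.log_two_lt_d9]
  have hexpand : (2 / b + 2) * Real.log (Real.exp 1 + criticalProfile b R) =
      2 * (Real.log (Real.exp 1 + criticalProfile b R) / b) +
        2 * Real.log (Real.exp 1 + criticalProfile b R) := by ring
  linarith [Real.log_two_lt_d9]

theorem criticalProfile_le (hb : 0 ≤ b) (hR : 1 < R) : criticalProfile b R ≤ (2 * R) ^ b := by
  have : 0 < R := one_pos.trans hR
  have hL := log_two_mul_pos hR
  refine Real.rpow_le_rpow (by positivity) ?_ hb
  rw [div_le_iff₀ hL]
  nlinarith [one_half_lt_log_two_mul hR]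

theorem log_exp_add_criticalProfile_le (hb : 0 ≤ b) (hR : 1 < R) :
    Real.log (Real.exp 1 + criticalProfile b R) ≤ (6 + b) * Real.log (2 * R) := by
  have hU := criticalProfile_le hb hR
  have := criticalProfile_pos b hR
  have hone : 1 ≤ (2 * R) ^ b := Real.one_le_rpow (by linarith) hb
  calc Real.log (Real.exp 1 + criticalProfile b R)
      ≤ Real.log ((Real.exp 1 + 1) * (2 * R) ^ b) := by
        refine Real.log_le_log (by positivity) ?_
        nlinarith [Real.exp_pos 1]
    _ = Real.log (Real.exp 1 + 1) + b * Real.log (2 * R) := by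
        rw [Real.log_mul (by positivity) (by positivity), Real.log_rpow (by linarith)]
    _ ≤ (6 + b) * Real.log (2 * R) := by
        have hlog := Real.log_le_sub_one_of_pos (show 0 < Real.exp 1 + 1 by positivity)
        linarith [Real.exp_one_lt_d9, one_half_lt_log_two_mul hR]

theorem criticalProfile_div_eq {t T : ℝ} (b : ℝ) (ht : 0 < t) (htT : t < T) :
    criticalProfile b (T / t) = T ^ b * t ^ (-b) * |Real.log (t / (2 * T))| ^ (-b) := by
  have hT : 0 < T := ht.trans htT
  have hL := log_two_mul_pos ((one_lt_div ht).2 htT)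
  have hinv : t / (2 * T) = (2 * (T / t))⁻¹ := by field_simp
  rw [hinv, Real.log_inv, abs_neg, abs_of_pos hL, criticalProfile,
    Real.div_rpow (by positivity) hL.le, Real.div_rpow hT.le ht.le, Real.rpow_neg ht.le,
    Real.rpow_neg hL.le, div_eq_mul_inv, div_eq_mul_inv]

theorem rho_le {N : ℕ} {t T : ℝ} (hd : 0 < d) (ht : 0 < t) (htT : t < T) :
    rho N d (t ^ (1 / d) * T ^ (-(1 / d))) ≤
      (1 + d) ^ ((N : ℝ) / d) * criticalProfile ((N : ℝ) / d) (T / t) := by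
  have hT : 0 < T := ht.trans htT
  have hL := log_two_mul_pos ((one_lt_div ht).2 htT)
  have hscale : t ^ (1 / d) * T ^ (-(1 / d)) = ((T / t) ^ (1 / d))⁻¹ := by
    rw [Real.div_rpow hT.le ht.le, Real.rpow_neg hT.le, inv_div, ← div_eq_mul_inv]
  have hR : 0 < T / t := by positivity
  set R := T / t
  have hpow : (R ^ (1 / d))⁻¹ ^ (-(N : ℝ)) = R ^ ((N : ℝ) / d) := by
    rw [Real.inv_rpow (by positivity), Real.rpow_neg (by positivity), inv_inv,
      ← Real.rpow_mul hR.le, one_div_mul_eq_div]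
  rw [rho, hscale, inv_inv, hpow, criticalProfile, Real.div_rpow hR.le hL.le, mul_div_left_comm]
  refine mul_le_mul_of_nonneg_left ?_ (by positivity)
  rw [div_eq_mul_inv (_ ^ _), ← Real.rpow_neg hL.le]
  exact rpow_neg_le_of_le_mul (log_exp_add_pos (by positivity)) hL (by positivity)
    (log_two_mul_le_log_exp_add hd hR)

end CriticalProfile

section CriticalIntegral

variable {β s t T : ℝ}

theorem hasDerivAt_log_two_mul_div_rpow (hβ : β ≠ 0) (hs : 0 < s) (hsT : s < T) :
    HasDerivAt (fun s => Real.log (2 * (T / s)) ^ (-β) / β)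
      (s⁻¹ * Real.log (2 * (T / s)) ^ (-1 - β)) s := by
  have hT : T ≠ 0 := (hs.trans hsT).ne'
  have hquot : HasDerivAt (fun s => 2 * (T / s)) (2 * (T * -(s ^ 2)⁻¹)) s := by
    simpa only [div_eq_mul_inv] using ((hasDerivAt_inv hs.ne').const_mul T).const_mul 2
  have hlog := log_two_mul_pos ((one_lt_div hs).2 hsT)
  refine (((hquot.log (by positivity)).rpow_const (p := -β) (Or.inl hlog.ne')).div_const
    β).congr_deriv ?_
  rw [neg_sub_comm β 1]
  field_simp

theorem continuousOn_log_two_mul_div_rpow (hβ : 0 < β) (hT : 0 < T) (htT : t < T) :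
    ContinuousOn (fun s => Real.log (2 * (T / s)) ^ (-β) / β) (Icc 0 t) := by
  intro s hs
  rcases hs.1.eq_or_lt with rfl | hs0
  · have harg : Filter.Tendsto (fun s : ℝ => 2 * (T / s)) (nhdsWithin 0 (Ioi 0)) Filter.atTop :=
      (((tendsto_inv_nhdsGT_zero (𝕜 := ℝ)).const_mul_atTop hT).const_mul_atTop two_pos).congr
        fun s => by rw [div_eq_mul_inv]
    have hlim := ((tendsto_rpow_neg_atTop hβ).comp (Real.tendsto_log_atTop.comp harg)).div_const β
    have hIoi : ContinuousWithinAt (fun s => Real.log (2 * (T / s)) ^ (-β) / β) (Ioi 0) 0 := by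
      simpa only [ContinuousWithinAt, Function.comp_def, div_zero, mul_zero, Real.log_zero,
        Real.zero_rpow (neg_ne_zero.2 hβ.ne'), zero_div] using hlim
    have hIci := continuousWithinAt_insert_self.2 hIoi
    rw [Ioi_insert] at hIci
    exact hIci.mono Icc_subset_Ici_self
  · exact (hasDerivAt_log_two_mul_div_rpow hβ.ne' hs0
      (hs.2.trans_lt htT)).continuousAt.continuousWithinAt

theorem lintegral_inv_mul_log (hβ : 0 < β) (ht : 0 < t) (htT : t < T) :
    ∫⁻ s in Ioo 0 t, ENNReal.ofReal (s⁻¹ * Real.log (2 * (T / s)) ^ (-1 - β)) =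
      ENNReal.ofReal (Real.log (2 * (T / t)) ^ (-β) / β) := by
  have hcont := continuousOn_log_two_mul_div_rpow hβ (ht.trans htT) htT
  have hderiv : ∀ s ∈ Ioo 0 t, HasDerivAt (fun s => Real.log (2 * (T / s)) ^ (-β) / β)
      (s⁻¹ * Real.log (2 * (T / s)) ^ (-1 - β)) s := fun s hs =>
    hasDerivAt_log_two_mul_div_rpow hβ.ne' hs.1 (hs.2.trans htT)
  have hpos : ∀ s ∈ Ioo 0 t, 0 ≤ s⁻¹ * Real.log (2 * (T / s)) ^ (-1 - β) := fun s hs =>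
    mul_nonneg (inv_nonneg.2 hs.1.le)
      (Real.rpow_nonneg (log_two_mul_pos ((one_lt_div hs.1).2 (hs.2.trans htT))).le _)
  have hint : IntegrableOn (fun s => s⁻¹ * Real.log (2 * (T / s)) ^ (-1 - β)) (Ioc 0 t) :=
    intervalIntegral.integrableOn_deriv_of_nonneg hcont hderiv hpos
  rw [← ofReal_integral_eq_lintegral_ofReal (hint.mono_set Ioo_subset_Ioc_self)
      ((ae_restrict_iff' measurableSet_Ioo).2 (Filter.Eventually.of_forall hpos)),
    ← integral_Ioc_eq_integral_Ioo, ← intervalIntegral.integral_of_le ht.le,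
    intervalIntegral.integral_eq_sub_of_hasDerivAt_of_le ht.le hcont hderiv
      ((intervalIntegrable_iff_integrableOn_Ioc_of_le ht.le).2 hint),
    div_zero, mul_zero, Real.log_zero, Real.zero_rpow (neg_ne_zero.2 hβ.ne'), zero_div, sub_zero]

end CriticalIntegral

section Orlicz

variable {N : ℕ} {d p b β γ ε δ k R T : ℝ} {φ : Space N → ℝ}

/-- The constant in the bound of `v^{1/b}` by a multiple of `[log(e + v)]^β` for `v` below the
critical profile. -/
def criticalConst (b β : ℝ) : ℝ :=
  ((1 + β / (b⁻¹ / 2)) * (2 / b + 2)) ^ β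

theorem criticalConst_pos (hb : 0 < b) (hβ : 0 < β) : 0 < criticalConst b β :=
  Real.rpow_pos_of_pos (by positivity) β

theorem rpow_mul_log_le_criticalProfile {v : ℝ} (hb : 0 < b) (hβ : 0 < β) (hR : 1 < R)
    (hv : 0 < v) (hvU : v ≤ criticalProfile b R) :
    v ^ (b⁻¹ / 2) * Real.log (2 * R) ^ β ≤ criticalConst b β *
      criticalProfile b R ^ (b⁻¹ / 2) * Real.log (Real.exp 1 + v) ^ β := by
  have hU := criticalProfile_pos b hR
  have hlogU := log_exp_add_pos hU.le
  have hlog : Real.log (2 * R) ^ β ≤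
      (2 / b + 2) ^ β * Real.log (Real.exp 1 + criticalProfile b R) ^ β := by
    rw [← Real.mul_rpow (by positivity) hlogU.le]
    exact Real.rpow_le_rpow (log_two_mul_pos hR).le
      (log_two_mul_le_log_exp_add_criticalProfile hb hR) hβ.le
  calc v ^ (b⁻¹ / 2) * Real.log (2 * R) ^ β
      ≤ (2 / b + 2) ^ β *
          (v ^ (b⁻¹ / 2) * Real.log (Real.exp 1 + criticalProfile b R) ^ β) := by
        rw [mul_left_comm]
        gcongr
    _ ≤ (2 / b + 2) ^ β * ((1 + β / (b⁻¹ / 2)) ^ β * criticalProfile b R ^ (b⁻¹ / 2) *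
          Real.log (Real.exp 1 + v) ^ β) := by
        refine mul_le_mul_of_nonneg_left ?_ (by positivity)
        exact rpow_mul_log_le (by positivity) hβ hv hvU
    _ = criticalConst b β * criticalProfile b R ^ (b⁻¹ / 2) *
          Real.log (Real.exp 1 + v) ^ β := by
        rw [criticalConst, Real.mul_rpow (by positivity) (by positivity)]
        ring

theorem rpow_inv_le_of_le_criticalProfile {v : ℝ} (hb : 0 < b) (hβ : 0 < β) (hR : 1 < R)
    (hk : 0 < k) (hk1 : k ≤ 1) (hv : 0 < v) (hvk : v ≤ k * criticalProfile b R) :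
    v ^ b⁻¹ ≤ k ^ (b⁻¹ / 2) * criticalConst b β * (R * Real.log (2 * R) ^ (-1 - β)) *
      Real.log (Real.exp 1 + v) ^ β := by
  have hU := criticalProfile_pos b hR
  have hL := log_two_mul_pos hR
  have hvU : v ≤ criticalProfile b R := hvk.trans (mul_le_of_le_one_left hU.le hk1)
  have hhalf {x : ℝ} (hx : 0 < x) : x ^ b⁻¹ = x ^ (b⁻¹ / 2) * x ^ (b⁻¹ / 2) := by
    rw [← Real.rpow_add hx, add_halves]
  have hvη : v ^ (b⁻¹ / 2) ≤ k ^ (b⁻¹ / 2) * criticalProfile b R ^ (b⁻¹ / 2) := by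
    rw [← Real.mul_rpow hk.le hU.le]
    exact Real.rpow_le_rpow hv.le hvk (by positivity)
  have hsquare : criticalProfile b R ^ (b⁻¹ / 2) * criticalProfile b R ^ (b⁻¹ / 2) =
      R / Real.log (2 * R) := by
    rw [← hhalf hU, criticalProfile_rpow_inv hb.ne' hR]
  have hLβ : 0 < Real.log (2 * R) ^ β := Real.rpow_pos_of_pos hL _
  rw [Real.rpow_sub hL, Real.rpow_neg_one, ← mul_le_mul_iff_left₀ hLβ]
  calc v ^ b⁻¹ * Real.log (2 * R) ^ β
      = v ^ (b⁻¹ / 2) * (v ^ (b⁻¹ / 2) * Real.log (2 * R) ^ β) := by rw [hhalf hv, mul_assoc]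
    _ ≤ k ^ (b⁻¹ / 2) * criticalProfile b R ^ (b⁻¹ / 2) * (criticalConst b β *
          criticalProfile b R ^ (b⁻¹ / 2) * Real.log (Real.exp 1 + v) ^ β) :=
        mul_le_mul hvη (rpow_mul_log_le_criticalProfile hb hβ hR hv hvU)
          (by positivity) (by positivity)
    _ = k ^ (b⁻¹ / 2) * criticalConst b β *
          (criticalProfile b R ^ (b⁻¹ / 2) * criticalProfile b R ^ (b⁻¹ / 2)) *
          Real.log (Real.exp 1 + v) ^ β := by ring
    _ = k ^ (b⁻¹ / 2) * criticalConst b β * (R * ((Real.log (2 * R))⁻¹ / Real.log (2 * R) ^ β)) *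
          Real.log (Real.exp 1 + v) ^ β * Real.log (2 * R) ^ β := by
        rw [hsquare]
        field_simp

theorem log_exp_add_mul_criticalProfile_rpow_le (hb : 0 ≤ b) (hβ : 0 ≤ β) (hR : 1 < R)
    (hk : 0 ≤ k) (hk1 : k ≤ 1) :
    Real.log (Real.exp 1 + k * criticalProfile b R) ^ β ≤
      (6 + b) ^ β * Real.log (2 * R) ^ β := by
  have hU := (criticalProfile_pos b hR).le
  refine (log_exp_add_rpow_monotoneOn hβ (mul_nonneg hk hU) hU
    (mul_le_of_le_one_left hU hk1)).trans ?_
  rw [← Real.mul_rpow (by positivity) (log_two_mul_pos hR).le]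
  exact Real.rpow_le_rpow (log_exp_add_pos hU).le (log_exp_add_criticalProfile_le hb hR) hβ

theorem lintegral_critical_weight_le {t K : ℝ} (hb : 0 ≤ b) (hβ : 0 < β) (hk : 0 ≤ k) (hk1 : k ≤ 1)
    (hK : 0 ≤ K) (hδ : K * ((6 + b) ^ β / β) ≤ δ) (ht : 0 < t) (htT : t < T) :
    ENNReal.ofReal (Real.log (Real.exp 1 + k * criticalProfile b (T / t)) ^ β) *
        ∫⁻ s in Ioo 0 t, ENNReal.ofReal (K * (T / s * Real.log (2 * (T / s)) ^ (-1 - β))) ≤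
      ENNReal.ofReal (δ * T) := by
  have hT : 0 < T := ht.trans htT
  have hR : 1 < T / t := (one_lt_div ht).2 htT
  have hL := log_two_mul_pos hR
  have hU := criticalProfile_pos b hR
  have hlog := log_exp_add_mul_criticalProfile_rpow_le hb hβ.le hR hk hk1
  have hintegral :
      ∫⁻ s in Ioo 0 t, ENNReal.ofReal (K * (T / s * Real.log (2 * (T / s)) ^ (-1 - β))) =
        ENNReal.ofReal (K * T * (Real.log (2 * (T / t)) ^ (-β) / β)) := by
    simp_rw [div_eq_mul_inv T, mul_assoc T, ← mul_assoc K, ← div_eq_mul_inv T,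
      ENNReal.ofReal_mul (mul_nonneg hK hT.le)]
    rw [lintegral_const_mul' _ _ ENNReal.ofReal_ne_top, lintegral_inv_mul_log hβ ht htT]
  rw [hintegral, ← ENNReal.ofReal_mul (Real.rpow_nonneg (log_exp_add_pos (by positivity)).le _)]
  refine ENNReal.ofReal_le_ofReal ?_
  set L := Real.log (2 * (T / t))
  calc Real.log (Real.exp 1 + k * criticalProfile b (T / t)) ^ β * (K * T * (L ^ (-β) / β))
      ≤ (6 + b) ^ β * L ^ β * (K * T * (L ^ (-β) / β)) := by gcongr
    _ = K * ((6 + b) ^ β / β) * T := by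
        rw [Real.rpow_neg hL.le]
        field_simp
    _ ≤ δ * T := by gcongr

theorem gaugeControl_of_lintegral_Phi_le (hb : (N : ℝ) / d = (p - 1)⁻¹) (hp : 1 < p) (hβ : 0 < β)
    (hT : 0 < T) (hk : 0 < k) (hk1 : k ≤ 1)
    (hδ : k ^ (((N : ℝ) / d)⁻¹ / 2) * criticalConst ((N : ℝ) / d) β *
      ((6 + (N : ℝ) / d) ^ β / β) ≤ δ)
    (hball : ∀ t ∈ times (ENNReal.ofReal T), ∀ z,
      ∫⁻ y in ball z (t ^ (1 / d)), ENNReal.ofReal (Phi β (T ^ ((N : ℝ) / d) * |φ y|)) ≤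
        ENNReal.ofReal (t ^ ((N : ℝ) / d) *
          Phi β (k * criticalProfile ((N : ℝ) / d) (T / t)) / ballConst N ε)) :
    GaugeControl N d p ε δ (fun s => Real.log (Real.exp 1 + s) ^ β) (T ^ ((N : ℝ) / d)) φ
      (ENNReal.ofReal T) (fun t => k * criticalProfile ((N : ℝ) / d) (T / t))
      (fun s => k ^ (((N : ℝ) / d)⁻¹ / 2) * criticalConst ((N : ℝ) / d) β *
        (T / s * Real.log (2 * (T / s)) ^ (-1 - β))) := by
  have hb0 : 0 < (N : ℝ) / d := hb ▸ inv_pos.2 (sub_pos.2 hp)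
  have hpb : p - 1 = ((N : ℝ) / d)⁻¹ := by rw [hb, inv_inv]
  set b := (N : ℝ) / d
  have hR {t : ℝ} (ht : t ∈ times (ENNReal.ofReal T)) : 1 < T / t :=
    (one_lt_div ht.1).2 ((mem_times_ofReal hT).1 ht).2
  refine ⟨fun t ht => mul_pos hk (criticalProfile_pos _ (hR ht)), fun τ hτ => ?_,
    fun t ht z => ?_, fun t ht v hv hvk => ?_, fun t ht => ?_⟩
  · refine ⟨(2 * (T / τ)) ^ b, fun t ht hτt => ?_⟩
    have ht0 : 0 < t := ht.1
    calc k * criticalProfile b (T / t) ≤ criticalProfile b (T / t) :=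
          mul_le_of_le_one_left (criticalProfile_pos _ (hR ht)).le hk1
      _ ≤ (2 * (T / t)) ^ b := criticalProfile_le hb0.le (hR ht)
      _ ≤ (2 * (T / τ)) ^ b := by gcongr
  · exact hball t ht z
  · rw [hpb]
    exact rpow_inv_le_of_le_criticalProfile hb0 hβ (hR ht) hk hk1 hv hvk
  · rw [hpb, Real.rpow_rpow_inv hT.le hb0.ne']
    have := criticalConst_pos hb0 hβ
    exact lintegral_critical_weight_le hb0.le hβ hk.le hk1 (by positivity) hδ ht.1
      ((mem_times_ofReal hT).1 ht).2

theorem lintegral_ball_Phi_le {t B C : ℝ} {z : Space N} (hd : 0 < d) (hβ : 0 < β) (hC : 0 < C)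
    (hk : 0 < k) (hB : 1 ≤ B) (hCB : C * volume.real (ball (0 : Space N) 1) ≤ B) (ht : 0 < t)
    (htT : t < T)
    (hint : IntegrableOn (fun y => Phi β (T ^ ((N : ℝ) / d) * |φ y|)) (ball z (t ^ (1 / d))))
    (havg : PhiInv β (⨍ y in ball z (t ^ (1 / d)), Phi β (T ^ ((N : ℝ) / d) * |φ y|)) ≤
      k / (B * (1 + d) ^ ((N : ℝ) / d)) * rho N d (t ^ (1 / d) * T ^ (-(1 / d)))) :
    ∫⁻ y in ball z (t ^ (1 / d)), ENNReal.ofReal (Phi β (T ^ ((N : ℝ) / d) * |φ y|)) ≤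
      ENNReal.ofReal (t ^ ((N : ℝ) / d) *
        Phi β (k * criticalProfile ((N : ℝ) / d) (T / t)) / C) := by
  have hT : 0 < T := ht.trans htT
  have hσ : 0 < t ^ (1 / d) := Real.rpow_pos_of_pos ht _
  have hU := criticalProfile_pos ((N : ℝ) / d) ((one_lt_div ht).2 htT)
  set U := criticalProfile ((N : ℝ) / d) (T / t)
  have hB0 : 0 < B := one_pos.trans_le hB
  have hw : 0 < k / B * U := by positivity
  have hPhi : ∀ y, 0 ≤ Phi β (T ^ ((N : ℝ) / d) * |φ y|) := fun y =>
    (Phi_bijOn hβ).mapsTo (mem_Ici.2 (by positivity))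
  have hmean : ⨍ y in ball z (t ^ (1 / d)), Phi β (T ^ ((N : ℝ) / d) * |φ y|) ≤
      Phi β (k / B * U) := by
    rw [← PhiInv_le_iff hβ (setAverage_nonneg hPhi _) hw.le]
    calc PhiInv β (⨍ y in ball z (t ^ (1 / d)), Phi β (T ^ ((N : ℝ) / d) * |φ y|))
        ≤ k / (B * (1 + d) ^ ((N : ℝ) / d)) * ((1 + d) ^ ((N : ℝ) / d) * U) := by
          refine havg.trans ?_
          gcongr
          exact rho_le hd ht htT
      _ = k / B * U := by field_simp
  refine (lintegral_ball_le_of_average_le hσ hPhi hint hmean).trans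
    (ENNReal.ofReal_le_ofReal ?_)
  rw [rpow_one_div_pow ht.le, mul_div_assoc]
  refine mul_le_mul_of_nonneg_left ?_ (by positivity)
  rw [le_div_iff₀' hC, ← mul_assoc]
  refine (mul_Phi_le hβ.le hw.le hB hCB).trans_eq ?_
  rw [← mul_assoc, mul_div_cancel₀ k hB0.ne']

theorem exists_rpow_mul_le {a K : ℝ} (ha : 0 < a) (hK : 0 < K) (hδ : 0 < δ) :
    ∃ k : ℝ, 0 < k ∧ k ≤ 1 ∧ k ^ a * K ≤ δ := by
  refine ⟨min 1 ((δ / K) ^ a⁻¹), by positivity, min_le_left _ _, ?_⟩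
  rw [← le_div_iff₀ hK, ← Real.le_rpow_inv_iff_of_pos (by positivity) (by positivity) ha]
  exact min_le_right _ _

theorem exists_solution_of_orlicz (hd : 0 < d) (hp : 1 < p) (hr : r0 N d p = 1)
    (hβ : 0 < β) :
    ∃ γ : ℝ, 0 < γ ∧ ∃ C : ℝ, 0 < C ∧
      ∀ φ : Space N → ℝ, AEStronglyMeasurable φ → ∀ T : ℝ, 0 < T →
      (∀ (x : Space N) (σ : ℝ), 0 < σ → σ < T ^ (1 / d) →
        IntegrableOn (fun y => Phi β (T ^ ((N : ℝ) / d) * |φ y|)) (ball x σ) ∧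
        PhiInv β (⨍ y in ball x σ, Phi β (T ^ ((N : ℝ) / d) * |φ y|)) ≤
          γ * rho N d (σ * T ^ (-(1 / d)))) →
      ∃ u : Space N → ℝ → ℝ, IsSolution N d p φ (ENNReal.ofReal T) u ∧
        ∀ (x : Space N) (t : ℝ), 0 < t → t < T →
          |u x t| ≤ C * t ^ (-((N : ℝ) / d)) * |Real.log (t / (2 * T))| ^ (-((N : ℝ) / d)) := by
  obtain ⟨ε, hε, hεd, hε1⟩ := exists_decay_exponent hd
  obtain ⟨δ, hδ, A, hA, hexist⟩ := exists_solution_of_gaugeControl N hp.le hε hεd hε1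
  have hC := ballConst_pos N hε
  have hb : (N : ℝ) / d = (p - 1)⁻¹ := eq_inv_of_mul_eq_one_left ((r0_eq N d p).symm.trans hr)
  have hb0 : 0 < (N : ℝ) / d := hb ▸ inv_pos.2 (sub_pos.2 hp)
  have := criticalConst_pos hb0 hβ
  obtain ⟨k, hk, hk1, hkδ⟩ := exists_rpow_mul_le (half_pos (inv_pos.2 hb0))
    (show 0 < criticalConst ((N : ℝ) / d) β * ((6 + (N : ℝ) / d) ^ β / β) by positivity) hδ
  set B := max 1 (ballConst N ε * volume.real (ball (0 : Space N) 1))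
  have hB : 1 ≤ B := le_max_left _ _
  refine ⟨k / (B * (1 + d) ^ ((N : ℝ) / d)), by positivity, A * k, by positivity,
    fun φ hφ T hT horlicz => ?_⟩
  have hball : ∀ t ∈ times (ENNReal.ofReal T), ∀ z,
      ∫⁻ y in ball z (t ^ (1 / d)), ENNReal.ofReal (Phi β (T ^ ((N : ℝ) / d) * |φ y|)) ≤
        ENNReal.ofReal (t ^ ((N : ℝ) / d) *
          Phi β (k * criticalProfile ((N : ℝ) / d) (T / t)) / ballConst N ε) := by
    intro t ht z
    obtain ⟨ht0, htT⟩ := (mem_times_ofReal hT).1 ht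
    obtain ⟨hint, havg⟩ := horlicz z (t ^ (1 / d)) (Real.rpow_pos_of_pos ht0 _)
      (Real.rpow_lt_rpow ht0.le htT (by positivity))
    exact lintegral_ball_Phi_le hd hβ hC hk hB (le_max_right _ _) ht0 htT hint havg
  obtain ⟨u, hu, hle⟩ := hexist _ _ (isGauge_log hβ) (T ^ ((N : ℝ) / d)) φ _ _ _
    (by positivity) hφ
    (gaugeControl_of_lintegral_Phi_le hb hp hβ hT hk hk1 ((mul_assoc _ _ _).trans_le hkδ) hball)
  refine ⟨u, hu, fun x t ht htT => (hle x t ((mem_times_ofReal hT).2 ⟨ht, htT⟩)).trans_eq ?_⟩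
  rw [criticalProfile_div_eq _ ht htT]
  field_simp

end Orlicz

end FracHeat

end

theorem theorem7p1_general (N : ℕ) (hN : 1 ≤ N) (d p : ℝ) (hd : 0 < d) (hp : 1 < p) :
    (r0 N d p < 1 →
      ∃ γ : ℝ, 0 < γ ∧ ∃ C : ℝ, 0 < C ∧
        ∀ φ : Space N → ℝ, LocallyIntegrable φ → ∃ C' : ℝ, 0 < C' ∧
        ∀ T : ℝ, 0 < T →
        (∀ x : Space N,
          (⨍ y in ball x (T ^ (1 / d)), |φ y|) ≤ γ * T ^ (-((N : ℝ) / (d * r0 N d p)))) →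
        ∃ u : Space N → ℝ → ℝ, IsSolution N d p φ (ENNReal.ofReal T) u ∧
          ∀ (x : Space N) (t : ℝ), 0 < t → t < T →
            |u x t| ≤ C * T ^ (-((N : ℝ) / d * (1 / r0 N d p - 1))) * t ^ (-((N : ℝ) / d)) ∧
            |u x t| ≤ C' * t ^ (-((N : ℝ) / d))) ∧
    (∀ q : ℝ, 1 < q →
      ∃ γ : ℝ, 0 < γ ∧ ∃ C : ℝ, 0 < C ∧
        ∀ φ : Space N → ℝ, AEStronglyMeasurable φ → ∀ T : ℝ≥0∞,
        (∀ (x : Space N) (σ : ℝ), 0 < σ → ENNReal.ofReal σ < T ^ (1 / d) →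
          IntegrableOn (fun y => |φ y| ^ q) (ball x σ) ∧
          σ ^ ((N : ℝ) / r0 N d p) * (⨍ y in ball x σ, |φ y| ^ q) ^ (1 / q) ≤ γ) →
        ∃ u : Space N → ℝ → ℝ, IsSolution N d p φ T u ∧
          ∀ (x : Space N) (t : ℝ), 0 < t → ENNReal.ofReal t < T →
            |u x t| ≤ C * t ^ (-((N : ℝ) / (d * r0 N d p)))) ∧
    (r0 N d p = 1 →
      ∀ β : ℝ, 0 < β →
      ∃ γ : ℝ, 0 < γ ∧ ∃ C : ℝ, 0 < C ∧
        ∀ φ : Space N → ℝ, AEStronglyMeasurable φ → ∀ T : ℝ, 0 < T →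
        (∀ (x : Space N) (σ : ℝ), 0 < σ → σ < T ^ (1 / d) →
          IntegrableOn (fun y => Phi β (T ^ ((N : ℝ) / d) * |φ y|)) (ball x σ) ∧
          PhiInv β (⨍ y in ball x σ, Phi β (T ^ ((N : ℝ) / d) * |φ y|)) ≤
            γ * rho N d (σ * T ^ (-(1 / d)))) →
        ∃ u : Space N → ℝ → ℝ, IsSolution N d p φ (ENNReal.ofReal T) u ∧
          ∀ (x : Space N) (t : ℝ), 0 < t → t < T →
            |u x t| ≤ C * t ^ (-((N : ℝ) / d)) * |Real.log (t / (2 * T))| ^ (-((N : ℝ) / d))) :=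
  ⟨exists_solution_of_r0_lt_one hN hd hp, fun _ hq => exists_solution_of_morrey hN hd hp hq,
    fun hr _ hβ => exists_solution_of_orlicz hd hp hr hβ⟩

theorem theorem7p1 (N : ℕ) (hN : 1 ≤ N) (d p : ℝ) (hd : 0 < d) (hp : 1 < p) :
    -- the case `r_0 < 1`
    (r0 N d p < 1 →
      ∃ γ : ℝ, 0 < γ ∧ ∃ C : ℝ, 0 < C ∧
        ∀ φ : Space N → ℝ, LocallyIntegrable φ → ∃ C' : ℝ, 0 < C' ∧
        ∀ T : ℝ, 0 < T →
        (∀ x : Space N,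
          (⨍ y in ball x (T ^ (1 / d)), |φ y|) ≤ γ * T ^ (-((N : ℝ) / (d * r0 N d p)))) →
        ∃ u : Space N → ℝ → ℝ, IsSolution N d p φ (ENNReal.ofReal T) u ∧
          ∀ (x : Space N) (t : ℝ), 0 < t → t < T →
            |u x t| ≤ C * T ^ (-((N : ℝ) / d * (1 / r0 N d p - 1))) * t ^ (-((N : ℝ) / d)) ∧
            |u x t| ≤ C' * t ^ (-((N : ℝ) / d))) ∧
    -- the case `r_0 > 1`; here `T = ∞` is allowed
    (1 < r0 N d p →
      ∀ q : ℝ, 1 < q →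
      ∃ γ : ℝ, 0 < γ ∧ ∃ C : ℝ, 0 < C ∧
        ∀ φ : Space N → ℝ, LocallyIntegrable φ → ∀ T : ℝ≥0∞, 0 < T →
        (∀ (x : Space N) (σ : ℝ), 0 < σ → ENNReal.ofReal σ < T ^ (1 / d) →
          IntegrableOn (fun y => |φ y| ^ q) (ball x σ) ∧
          σ ^ ((N : ℝ) / r0 N d p) * (⨍ y in ball x σ, |φ y| ^ q) ^ (1 / q) ≤ γ) →
        ∃ u : Space N → ℝ → ℝ, IsSolution N d p φ T u ∧
          ∀ (x : Space N) (t : ℝ), 0 < t → ENNReal.ofReal t < T →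
            |u x t| ≤ C * t ^ (-((N : ℝ) / (d * r0 N d p)))) ∧
    -- the case `r_0 = 1`
    (r0 N d p = 1 →
      ∀ β : ℝ, 0 < β →
      ∃ γ : ℝ, 0 < γ ∧ ∃ C : ℝ, 0 < C ∧
        ∀ φ : Space N → ℝ, LocallyIntegrable φ → ∀ T : ℝ, 0 < T →
        (∀ (x : Space N) (σ : ℝ), 0 < σ → σ < T ^ (1 / d) →
          IntegrableOn (fun y => Phi β (T ^ ((N : ℝ) / d) * |φ y|)) (ball x σ) ∧
          PhiInv β (⨍ y in ball x σ, Phi β (T ^ ((N : ℝ) / d) * |φ y|)) ≤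
            γ * rho N d (σ * T ^ (-(1 / d)))) →
        ∃ u : Space N → ℝ → ℝ, IsSolution N d p φ (ENNReal.ofReal T) u ∧
          ∀ (x : Space N) (t : ℝ), 0 < t → t < T →
            |u x t| ≤ C * t ^ (-((N : ℝ) / d)) * |Real.log (t / (2 * T))| ^ (-((N : ℝ) / d))) := by
  obtain ⟨hsub, hsuper, hcrit⟩ := theorem7p1_general N hN d p hd hp
  refine ⟨hsub, fun _ q hq => ?_, fun hr β hβ => ?_⟩
  · obtain ⟨γ, hγ, C, hC, h⟩ := hsuper q hq
    exact ⟨γ, hγ, C, hC, fun φ hφ T _ => h φ hφ.aestronglyMeasurable T⟩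
  · obtain ⟨γ, hγ, C, hC, h⟩ := hcrit hr β hβ
    exact ⟨γ, hγ, C, hC, fun φ hφ => h φ hφ.aestronglyMeasurable⟩
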